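/- Let $p,q\ge 0$ be integers, $r=p\vee q$, and write $\theta=(\omega,\gamma_1,\dots,\gamma_q,\alpha_1,\dots,\alpha_r)$. For known constants $\omega_l<\omega_u$ and $\gamma_l,\gamma_u,\alpha_l,\alpha_u\in(-1,1)$ let $$\Theta=\Big\{\theta:\ \omega_l<\omega<\omega_u,\ \gamma_l<\gamma_i<\gamma_u\ (1\le i\le q),\ \alpha_l<\alpha_i<\alpha_u\ (1\le i\le r),\ \sum_{i=1}^q|\gamma_i|<1,\ \sum_{i=1}^{r}\big|\mathbf 1_{\{i\le q\}}\gamma_i+\alpha_i\big|<1\Big\}.$$ On a probability space with a filtration $(\mathcal F_i)_{i\ge 0}$, let $(I\beta_i)$ be an adapted real process (the daily integrated betas) that follows the dynamic realized beta (DR Beta) model with parameter $\theta_0\in\Theta$: for $i\ge 1$, $$I\beta_i=h_i(\theta_0)+D_i,\qquad h_i(\theta_0)=\omega_0+\sum_{j=1}^q\gamma_{0,j}h_{i-j}(\theta_0)+\sum_{j=1}^{r}\alpha_{0,j}I\beta_{i-j},$$ with $\mathcal F_0$-measurable initial values $h_j(\theta_0), I\beta_j$, $j\le 0$, where $(D_i)_{i\ge1}$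 is a square integrable martingale difference sequence: $\mathbb E[D_i\mid\mathcal F_{i-1}]=0$. Assume: 1. For every $\theta\in\Theta$ all complex zeros of $\varphi_\theta(x)=1-\sum_{i=1}^{r}(\mathbf 1_{\{i\le q\}}\gamma_i+\alpha_i)x^i$ satisfy $|x|>1$. 2. $\varphi_{\theta_0}(x)$ and $\Upsilon_{\theta_0}(x)=\sum_{i=1}^{r}\alpha_{0,i}x^i$ have no common complex root, and, if $q\ge1$, $\gamma_{0,q}$ and $\alpha_{0,r}$ are not both zero. 3. $(D_i)_{i\ge1}$ is strictly stationary and ergodic, is not almost surely zero, and $\sup_{i}\mathbb E[D_i^2\mid\mathcal F_{i-1}]\le C$ a.s. for a constant $C$. 4. The $I\beta_i$, $1\le i\le n$, are estimated by random variables $RIB_i$ (depending on $n$ and on the average number $m>0$ of high-frequency observations per day) with $\sup_{1\le i\le n}\mathbb E|RIB_i-I\beta_i|^2\le C\,m^{-1/2}$, where $C$ does not depend on $m,n$. Put, for $i\ge1$, $$\widehat h_i(\theta)=\omega+\sum_{j=1}^q\gamma_j\widehat h_{i-j}(\theta)+\sum_{j=1}^{r}\alpha_jRIB_{i-j},$$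 where the initial values $\widehat h_j$ and $RIB_j$, $j\le0$, are random variables that do not depend on $\theta$ and are $O_p(1)$ (for example $\frac1n\sum_{i=1}^nRIB_i$), and let the quasi-maximum likelihood estimator be $$\widehat\theta=\operatorname*{arg\,max}_{\theta\in\Theta}\Big(-\frac1n\sum_{i=1}^n\{RIB_i-\widehat h_i(\theta)\}^2\Big),$$ that is, any choice of a maximizer over $\Theta$ when one exists, and an arbitrary value otherwise. Then, as $m,n\to\infty$, without any condition on the relative growth of $m$ and $n$, $$\|\widehat\theta-\theta_0\|_{\max}=O_p\big(m^{-1/4}+n^{-1/2}\big).$$ -/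

import Mathlib

open MeasureTheory ProbabilityTheory Filter

noncomputable section

namespace DRBeta

/-- Parameter vectors `θ = (ω, (γ_1, …, γ_q), (α_1, …, α_{p ∨ q}))`; the coefficient with
mathematical index `j + 1` is the entry at `j`. The norm of this product type is the maximum of
the absolute values of all the coordinates, that is, `‖·‖_max`. -/
abbrev Param (p q : ℕ) : Type := ℝ × (Fin q → ℝ) × (Fin (max p q) → ℝ)

/-- The intercept `ω`. -/
abbrev Param.om {p q : ℕ} (θ : Param p q) : ℝ := θ.1

/-- The coefficients `γ_1, …, γ_q`. -/
abbrev Param.ga {p q : ℕ} (θ : Param p q) : Fin q → ℝ := θ.2.1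

/-- The coefficients `α_1, …, α_{p ∨ q}`. -/
abbrev Param.al {p q : ℕ} (θ : Param p q) : Fin (max p q) → ℝ := θ.2.2

/-- The autoregressive coefficient `1_{i ≤ q} γ_i + α_i`, for `1 ≤ i ≤ p ∨ q`. -/
def arCoeff {p q : ℕ} (θ : Param p q) (i : Fin (max p q)) : ℝ :=
  (if hi : (i : ℕ) < q then Param.ga θ ⟨i, hi⟩ else 0) + Param.al θ i

/-- The parameter space `Θ`, with the known bounds for `ω`, the `γ_i` and the `α_i`. -/
def paramSpace (p q : ℕ) (ωl ωu γl γu αl αu : ℝ) : Set (Param p q) :=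
  {θ | (ωl < Param.om θ ∧ Param.om θ < ωu) ∧
    (∀ i, γl < Param.ga θ i ∧ Param.ga θ i < γu) ∧
    (∀ i, αl < Param.al θ i ∧ Param.al θ i < αu) ∧
    ∑ i, |Param.ga θ i| < 1 ∧
    ∑ i, |arCoeff θ i| < 1}

/-- The polynomial `φ_θ(x) = 1 - ∑_{i=1}^{p ∨ q} (1_{i ≤ q} γ_i + α_i) x^i`. -/
def phi {p q : ℕ} (θ : Param p q) (x : ℂ) : ℂ :=
  1 - ∑ i : Fin (max p q), ((arCoeff θ i : ℝ) : ℂ) * x ^ ((i : ℕ) + 1)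

/-- The polynomial `Υ_θ(x) = ∑_{i=1}^{p ∨ q} α_i x^i`. -/
def upsilon {p q : ℕ} (θ : Param p q) (x : ℂ) : ℂ :=
  ∑ i : Fin (max p q), ((Param.al θ i : ℝ) : ℂ) * x ^ ((i : ℕ) + 1)

/-- The sequence `h_i(θ)` driven by the sequence `x`, with the initial values `h0 i` at `i ≤ 0`:
`h_i = ω + ∑_{j=1}^{q} γ_j h_{i-j} + ∑_{j=1}^{p ∨ q} α_j x_{i-j}` for `i ≥ 1`. -/
def hSeq {p q : ℕ} (θ : Param p q) (x h0 : ℤ → ℝ) (i : ℤ) : ℝ :=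
  if i ≤ 0 then h0 i
  else Param.om θ + ∑ j : Fin q, Param.ga θ j * hSeq θ x h0 (i - ((j : ℤ) + 1))
    + ∑ j : Fin (max p q), Param.al θ j * x (i - ((j : ℤ) + 1))
termination_by i.toNat
decreasing_by omega

/-- The innovation `D_i = Iβ_i - h_i(θ)` of the process `Iβ`, where `h_i(θ)` is driven by `Iβ`
and started from `h0`. -/
def innovation {Ω : Type*} {p q : ℕ} (θ : Param p q) (Iβ h0 : ℤ → Ω → ℝ) (i : ℤ) (ω : Ω) : ℝ :=
  Iβ i ω - hSeq θ (fun j => Iβ j ω) (fun j => h0 j ω) i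

/-- The quasi-likelihood `-(1/n) ∑_{i=1}^n (x_i - h_i(θ))²`, with `h_i(θ)` driven by the data
`x` itself and started from `h0`. -/
def quasiLik {p q : ℕ} (n : ℕ) (x h0 : ℤ → ℝ) (θ : Param p q) : ℝ :=
  -((1 / (n : ℝ)) * ∑ i ∈ Finset.Icc 1 n, (x (i : ℤ) - hSeq θ x h0 (i : ℤ)) ^ 2)

/-- `θhat` is an `argmax` of the quasi-likelihood over `Θ`, provided that there is one. -/
def IsQMLE {p q : ℕ} (Θ : Set (Param p q)) (n : ℕ) (x h0 : ℤ → ℝ) (θhat : Param p q) : Prop :=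
  (∃ θ ∈ Θ, IsMaxOn (quasiLik n x h0) Θ θ) → θhat ∈ Θ ∧ IsMaxOn (quasiLik n x h0) Θ θhat

/-- The process `(D_1, D_2, …)` is strictly stationary and ergodic: the shift is measure
preserving and ergodic for its law. -/
def StationaryErgodic {Ω : Type*} [MeasurableSpace Ω] (P : Measure Ω) (D : ℤ → Ω → ℝ) : Prop :=
  Ergodic (fun (x : ℕ → ℝ) (i : ℕ) => x (i + 1))
    (P.map (fun ω (i : ℕ) => D ((i : ℤ) + 1) ω))

/-- `X_k = O_p(a_k)` along the filter `l`. -/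
def IsBigOp {Ω ι : Type*} [MeasurableSpace Ω] (P : Measure Ω) (l : Filter ι)
    (X : ι → Ω → ℝ) (a : ι → ℝ) : Prop :=
  ∀ ε : ℝ, 0 < ε → ∃ M : ℝ, 0 < M ∧
    ∀ᶠ k in l, P {ω | M * a k < |X k ω|} ≤ ENNReal.ofReal ε

end DRBeta

end

/-! A daily sequence is encoded as a power series whose coefficient of `X ^ t` is the value on day
`t + 1`; lagging is then multiplication by `X`, up to initial values, and all norms are `ℓ²` norms
of the first `n` coefficients. Let `E` and `W` be the residuals at `θ₀` and at a `θ` with no larger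
sum of squares, and let `δ = θ₀ - θ`. Both recursions use the same data and initial values, so `(1 -
γ_θ(B)) (W - E)` is exactly a series `S` that is linear in `δ` (`filter_resid_sub`). Now `‖W‖ ≤ ‖E‖`
gives `‖W - E‖² ≤ -2⟨E, W - E⟩`. Here `E` is `D` up to an error of norm `O(√n a)`, where `a` is the
rate, and `D` is a martingale difference, so its correlation with `W - E` is `O(n a ‖δ‖)`. If `‖S‖`
is at least of order `√n ‖δ‖`, then `‖δ‖²` is at most of order `a ‖δ‖ + a²`, whence `‖δ‖ = O(a)`.
Linearity in `δ` makes this uniform in `θ`, without a Taylor expansion or a uniform law of large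
numbers.

Three points need an argument. (1) The correlation of `D` with `(1 - γ_θ(B))⁻¹ S`, uniformly in `θ`:
the seminorm `corr` weights the correlations with all lags geometrically, so that shifts and inverse
filters are bounded for it (`shiftBound_corr`, `ShiftBound.filter_le`). It then suffices to control
`corr` at the constant and at the lagged `D` (`exists_corr_score_le`), where martingale
orthogonality gives `O_p(√n)`.

(2) The lower bound on `‖S‖` (`exists_l2_score_ge`): `φ_{θ₀}(B) S` is, up to errors, a constant plus
a moving average of `D`. Its coefficients determine `δ` by coprimality and full order
(`maPoly_eq_zero`), and the constant and the lags of `D` are nearly orthogonal, with norms of order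
`√n` by the ergodic theorem.

(3) `Θ` is not compact, and `∑ |γ_j|` may be arbitrarily close to `1` on it. In `basic_inequality`
the filter `1 - γ` is replaced by `1 + η - γ`, at the price of a term of order `η`. A fixed small
`η` gives consistency over all of `Θ`, hence also existence of a maximizer (`IsQMLE.mem_and_le`);
near `θ₀` one may take `η = 0`, which gives the rate. `exists_estimator_bound` collects this
deterministic part; `isBigOp_estimator` adds the probability. -/

namespace DRBeta

/-! ### Sequences as power series, truncated `ℓ²` norms and lag polynomials. -/

open PowerSeries Finset

/-- The first `n` coefficients of a power series, as a vector. -/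
noncomputable def coords (n : ℕ) : ℝ⟦X⟧ →ₗ[ℝ] EuclideanSpace ℝ (Fin n) where
  toFun U := WithLp.toLp 2 fun t => coeff t U
  map_add' U V := by ext t; simp
  map_smul' a U := by ext t; simp

/-- The `ℓ²` seminorm of the first `n` coefficients. -/
noncomputable def l2 (n : ℕ) : Seminorm ℝ ℝ⟦X⟧ := (normSeminorm ℝ (EuclideanSpace ℝ (Fin n))).comp (coords n)

/-- The `ℓ²` inner product of the first `n` coefficients. -/
noncomputable def ip (n : ℕ) (U V : ℝ⟦X⟧) : ℝ := ∑ t ∈ range n, coeff t U * coeff t V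

lemma l2_apply (n : ℕ) (U : ℝ⟦X⟧) : l2 n U = ‖coords n U‖ := rfl

lemma ip_eq_inner (n : ℕ) (U V : ℝ⟦X⟧) : ip n U V = inner ℝ (coords n U) (coords n V) := by
  simp only [ip, coords, PiLp.inner_apply, LinearMap.coe_mk, AddHom.coe_mk]
  rw [Finset.sum_range]
  simp [mul_comm]

lemma l2_sq (n : ℕ) (U : ℝ⟦X⟧) : l2 n U ^ 2 = ip n U U := by
  rw [ip_eq_inner, real_inner_self_eq_norm_sq, l2_apply]

lemma l2_sq_eq_sum (n : ℕ) (U : ℝ⟦X⟧) : l2 n U ^ 2 = ∑ t ∈ range n, coeff t U ^ 2 := by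
  rw [l2_sq, ip]; simp [sq]

lemma ip_add_right (n : ℕ) (U V W : ℝ⟦X⟧) : ip n U (V + W) = ip n U V + ip n U W := by
  simp [ip_eq_inner, inner_add_right]

lemma ip_sub_right (n : ℕ) (U V W : ℝ⟦X⟧) : ip n U (V - W) = ip n U V - ip n U W := by
  simp [ip_eq_inner, inner_sub_right]

lemma ip_smul_right (n : ℕ) (a : ℝ) (U V : ℝ⟦X⟧) : ip n U (a • V) = a * ip n U V := by
  simp [ip_eq_inner, inner_smul_right]

lemma ip_comm (n : ℕ) (U V : ℝ⟦X⟧) : ip n U V = ip n V U := by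
  simp [ip_eq_inner, real_inner_comm]

lemma abs_ip_le (n : ℕ) (U V : ℝ⟦X⟧) : |ip n U V| ≤ l2 n U * l2 n V := by
  rw [ip_eq_inner]; exact abs_real_inner_le_norm _ _

lemma l2_add_sq (n : ℕ) (U V : ℝ⟦X⟧) :
    l2 n (U + V) ^ 2 = l2 n U ^ 2 + 2 * ip n U V + l2 n V ^ 2 := by
  simp only [l2_apply, map_add, ip_eq_inner, norm_add_sq_real]

lemma coeff_X_mul (t : ℕ) (U : ℝ⟦X⟧) :
    coeff t ((X : ℝ⟦X⟧) * U) = if t = 0 then 0 else coeff (t - 1) U := by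
  cases t with
  | zero => simp
  | succ t => simp [coeff_succ_X_mul]

lemma ip_X_mul_X_mul (n : ℕ) (U V : ℝ⟦X⟧) : ip (n + 1) (X * U) (X * V) = ip n U V := by
  simp [ip, sum_range_succ', coeff_succ_X_mul]

lemma ip_X_pow_mul (n : ℕ) (U V : ℝ⟦X⟧) (k : ℕ) :
    ip (n + k) (X ^ k * U) (X ^ k * V) = ip n U V := by
  induction k with
  | zero => simp
  | succ k ih => rw [← add_assoc, pow_succ', mul_assoc, mul_assoc, ip_X_mul_X_mul, ih]

lemma l2_X_mul_le (n : ℕ) (U : ℝ⟦X⟧) : l2 n (X * U) ≤ l2 n U := by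
  refine (sq_le_sq₀ (apply_nonneg _ _) (apply_nonneg _ _)).1 ?_
  cases n with
  | zero => simp [l2_sq, ip]
  | succ n =>
    rw [l2_sq, ip_X_mul_X_mul, l2_sq, ip, ip, sum_range_succ]
    exact le_add_of_nonneg_right (mul_self_nonneg _)

lemma l2_mono_sq {m n : ℕ} (h : m ≤ n) (U : ℝ⟦X⟧) : l2 m U ^ 2 ≤ l2 n U ^ 2 := by
  rw [l2_sq_eq_sum, l2_sq_eq_sum]
  exact sum_le_sum_of_subset_of_nonneg (range_mono h) fun _ _ _ => sq_nonneg _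

lemma l2_X_pow_mul_le (n k : ℕ) (U : ℝ⟦X⟧) : l2 n (X ^ k * U) ≤ l2 n U := by
  induction k with
  | zero => simp
  | succ k ih => rw [pow_succ', mul_assoc]; exact (l2_X_mul_le _ _).trans ih

/-- The lag polynomial `∑_j a_j X^{j+1}`. -/
noncomputable def lagPoly {r : ℕ} (a : Fin r → ℝ) : Polynomial ℝ :=
  ∑ j, Polynomial.C (a j) * Polynomial.X ^ ((j : ℕ) + 1)

/-- The lag polynomial as a power series. -/
noncomputable def lag {r : ℕ} (a : Fin r → ℝ) : ℝ⟦X⟧ := ∑ j, a j • X ^ ((j : ℕ) + 1)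

lemma coe_lagPoly {r : ℕ} (a : Fin r → ℝ) : ((lagPoly a : Polynomial ℝ) : ℝ⟦X⟧) = lag a := by
  unfold lagPoly lag
  rw [← Polynomial.coeToPowerSeries.ringHom_apply, map_sum]
  simp [Polynomial.coeToPowerSeries.ringHom_apply, PowerSeries.smul_eq_C_mul]

lemma lag_mul {r : ℕ} (a : Fin r → ℝ) (U : ℝ⟦X⟧) :
    lag a * U = ∑ j, a j • (X ^ ((j : ℕ) + 1) * U) := by
  simp [lag, sum_mul]

lemma lag_mul_eq {r : ℕ} (a : Fin r → ℝ) (U : ℝ⟦X⟧) :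
    lag a * U = ∑ j, a j • (X ^ (j : ℕ) * (X * U)) := by
  simp [lag_mul, pow_succ, mul_assoc]

lemma constantCoeff_lag {r : ℕ} (a : Fin r → ℝ) : constantCoeff (lag a) = 0 := by
  simp [lag, PowerSeries.smul_eq_C_mul]

/-! ### Seminorms and lags -/

/-- The shift has norm at most `lam` for the seminorm `p`. -/
def ShiftBound (p : Seminorm ℝ ℝ⟦X⟧) (lam : ℝ) : Prop := ∀ U, p (X * U) ≤ lam * p U

lemma shiftBound_l2 (n : ℕ) : ShiftBound (l2 n) 1 := fun U => by simpa using l2_X_mul_le n U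

lemma ShiftBound.pow {p : Seminorm ℝ ℝ⟦X⟧} {lam : ℝ} (h : ShiftBound p lam) (h0 : 0 ≤ lam)
    (k : ℕ) (U : ℝ⟦X⟧) : p (X ^ k * U) ≤ lam ^ k * p U := by
  induction k with
  | zero => simp
  | succ k ih =>
    rw [pow_succ', mul_assoc, pow_succ', mul_assoc]
    exact (h _).trans (mul_le_mul_of_nonneg_left ih h0)

lemma seminorm_sum_smul_le (p : Seminorm ℝ ℝ⟦X⟧) {r : ℕ} (a : Fin r → ℝ) (V : Fin r → ℝ⟦X⟧) :
    p (∑ j, a j • V j) ≤ ∑ j, |a j| * p (V j) := by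
  refine (Finset.le_sum_of_subadditive p (map_zero p).le (map_add_le_add p) _ _).trans (le_of_eq ?_)
  simp [map_smul_eq_mul]

lemma ShiftBound.lag_mul_le {p : Seminorm ℝ ℝ⟦X⟧} {lam : ℝ} (h : ShiftBound p lam)
    (h1 : 1 ≤ lam) {r : ℕ} (a : Fin r → ℝ) (U : ℝ⟦X⟧) :
    p (lag a * U) ≤ (lam ^ r * ∑ j, |a j|) * p U := by
  rw [lag_mul, mul_sum, sum_mul]
  refine (seminorm_sum_smul_le p _ _).trans (sum_le_sum fun j _ => ?_)
  have h2 := h.pow (by linarith) ((j : ℕ) + 1) U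
  have h3 : lam ^ ((j : ℕ) + 1) ≤ lam ^ r := pow_le_pow_right₀ h1 j.2
  have := apply_nonneg p U
  calc |a j| * p (X ^ ((j : ℕ) + 1) * U) ≤ |a j| * (lam ^ r * p U) := by
        gcongr; exact h2.trans (by gcongr)
    _ = _ := by ring

/-- Every lag contains at least one factor `X`, which can be left on `U`. This matters for `corr`:
the correlation of `D` with `X * D` is of order `√n`, whereas that of `D` with itself is of order
`n`. -/
lemma ShiftBound.lag_mul_le_shift {p : Seminorm ℝ ℝ⟦X⟧} {lam : ℝ} (h : ShiftBound p lam)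
    (h1 : 1 ≤ lam) {r : ℕ} (a : Fin r → ℝ) (U : ℝ⟦X⟧) :
    p (lag a * U) ≤ (lam ^ r * ∑ j, |a j|) * p (X * U) := by
  rw [lag_mul_eq, mul_sum, sum_mul]
  refine (seminorm_sum_smul_le p _ _).trans (sum_le_sum fun j _ => ?_)
  have h2 := h.pow (by linarith) (j : ℕ) (X * U)
  have h3 : lam ^ (j : ℕ) ≤ lam ^ r := pow_le_pow_right₀ h1 j.2.le
  have := apply_nonneg p (X * U)
  calc |a j| * p (X ^ (j : ℕ) * (X * U)) ≤ |a j| * (lam ^ r * p (X * U)) := by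
        gcongr; exact h2.trans (by gcongr)
    _ = _ := by ring

lemma l2_lag_mul_le (n : ℕ) {r : ℕ} (a : Fin r → ℝ) (U : ℝ⟦X⟧) :
    l2 n (lag a * U) ≤ (∑ j, |a j|) * l2 n U := by
  simpa using (shiftBound_l2 n).lag_mul_le le_rfl a U

/-- Inverting a contractive lag filter. -/
lemma ShiftBound.filter_le {p : Seminorm ℝ ℝ⟦X⟧} {lam : ℝ} (h : ShiftBound p lam)
    (h1 : 1 ≤ lam) {r : ℕ} (a : Fin r → ℝ) {c : ℝ} (hc : 0 ≤ c) {F U : ℝ⟦X⟧}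
    (hF : c • F - lag a * F = U) : (c - lam ^ r * ∑ j, |a j|) * p F ≤ p U := by
  have h2 : c • F = U + lag a * F := by rw [← hF]; ring
  have h3 : c * p F = p (c • F) := by rw [map_smul_eq_mul, Real.norm_of_nonneg hc]
  have h4 := map_add_le_add p U (lag a * F)
  have h5 := h.lag_mul_le h1 a F
  rw [h2] at h3
  nlinarith

/-- The filter itself, unlike its inverse, is bounded uniformly in the coefficients. This is what
turns a bound on a filtered difference of residuals back into a bound on the score. -/
lemma l2_filter_le (n : ℕ) {r : ℕ} (a : Fin r → ℝ) {c : ℝ} (hc : 0 ≤ c) {F U : ℝ⟦X⟧}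
    (hF : c • F - lag a * F = U) : l2 n U ≤ (c + ∑ j, |a j|) * l2 n F := by
  rw [← hF, add_mul]
  refine (map_sub_le_add (l2 n) _ _).trans (add_le_add (le_of_eq ?_) (l2_lag_mul_le n a F))
  rw [map_smul_eq_mul, Real.norm_of_nonneg hc]

/-- A filter `1 - γ` with `∑ |γ_j| ≤ 1` is accretive. -/
lemma ip_filter_nonneg (n : ℕ) {r : ℕ} (a : Fin r → ℝ) (ha : ∑ j, |a j| ≤ 1) (V : ℝ⟦X⟧) :
    0 ≤ ip n V (V - lag a * V) := by
  rw [ip_sub_right, ← l2_sq]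
  have h1 := (abs_le.1 (abs_ip_le n V (lag a * V))).2
  have h2 := l2_lag_mul_le n a V
  have h3 := apply_nonneg (l2 n) V
  nlinarith [mul_le_mul_of_nonneg_left h2 h3, mul_le_mul_of_nonneg_right ha (mul_nonneg h3 h3)]

/-- The resolvent of an accretive lag filter is a contraction. -/
lemma exists_resolvent (n : ℕ) {r : ℕ} (a : Fin r → ℝ) (ha : ∑ j, |a j| ≤ 1) {η : ℝ} (hη : 0 ≤ η)
    (W : ℝ⟦X⟧) : ∃ Y : ℝ⟦X⟧, (1 + η) • Y - lag a * Y = W - lag a * W ∧ l2 n Y ≤ l2 n W := by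
  rcases hη.eq_or_lt with rfl | hη
  · exact ⟨W, by simp, le_rfl⟩
  have hne : constantCoeff ((1 + η) • (1 : ℝ⟦X⟧) - lag a) ≠ 0 := by
    simp [constantCoeff_lag, PowerSeries.smul_eq_C_mul]; positivity
  set Y : ℝ⟦X⟧ := ((1 + η) • (1 : ℝ⟦X⟧) - lag a)⁻¹ * (W - lag a * W) with hY
  have hYeq : (1 + η) • Y - lag a * Y = W - lag a * W := by
    have : (1 + η) • Y - lag a * Y = ((1 + η) • (1 : ℝ⟦X⟧) - lag a) * Y := by
      rw [sub_mul, smul_mul_assoc, one_mul]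
    rw [this, hY, ← mul_assoc, PowerSeries.mul_inv_cancel _ hne, one_mul]
  refine ⟨Y, hYeq, ?_⟩
  -- Accretivity is used at `W - Y` because the filter `1 - a` maps it to `η • Y`. Hence `‖Y‖² ≤ ⟨Y,
  -- W⟩`, and Cauchy–Schwarz concludes.
  have h1 := ip_filter_nonneg n a ha (W - Y)
  have h2 : (W - Y) - lag a * (W - Y) = η • Y := by
    have : η • Y = (1 + η) • Y - Y := by rw [add_smul, one_smul]; ring
    rw [this, mul_sub]
    linear_combination -hYeq
  rw [h2, ip_smul_right, ip_comm, ip_sub_right, ← l2_sq] at h1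
  have h3 := (abs_le.1 (abs_ip_le n Y W)).2
  have h4 : 0 ≤ ip n Y W - l2 n Y ^ 2 := nonneg_of_mul_nonneg_right h1 hη
  by_contra! h
  nlinarith [apply_nonneg (l2 n) W, apply_nonneg (l2 n) Y]

/-- The geometric series `∑ X^t`. -/
noncomputable def geom : ℝ⟦X⟧ := PowerSeries.mk fun _ => 1

lemma coeff_geom (t : ℕ) : coeff t geom = 1 := by simp [geom]

lemma X_mul_geom : X * geom = geom - 1 := by
  ext t
  rw [coeff_X_mul]
  cases t <;> simp [coeff_geom, PowerSeries.coeff_one, -coeff_zero_eq_constantCoeff]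

lemma l2_geom_sq (n : ℕ) : l2 n geom ^ 2 = n := by simp [l2_sq_eq_sum, coeff_geom]

lemma l2_C_le (n : ℕ) (a : ℝ) : l2 n (C a) ≤ |a| := by
  refine (sq_le_sq₀ (apply_nonneg _ _) (abs_nonneg _)).1 ?_
  rw [l2_sq_eq_sum, sq_abs]
  cases n with
  | zero => simp; positivity
  | succ n => rw [sum_range_succ']; simp [coeff_C]

lemma l2_one_le (n : ℕ) : l2 n 1 ≤ 1 := by simpa using l2_C_le n 1

/-- Lagging the constant sequence changes only its first `k` entries, so the cost does not grow with
`n`. -/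
lemma l2_X_pow_mul_geom_sub (n k : ℕ) : l2 n (X ^ k * geom - geom) ≤ k := by
  induction k with
  | zero => simp
  | succ k ih =>
    have : X ^ (k + 1) * geom - geom = X * (X ^ k * geom - geom) - 1 := by
      rw [mul_sub, X_mul_geom, pow_succ']; ring
    rw [this]
    refine (map_sub_le_add (l2 n) _ _).trans ?_
    push_cast
    exact add_le_add ((l2_X_mul_le _ _).trans ih) (l2_one_le n)

lemma l2_lag_mul_geom_sub (n : ℕ) {r : ℕ} (a : Fin r → ℝ) :
    l2 n (lag a * geom - (∑ j, a j) • geom) ≤ r * ∑ j, |a j| := by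
  have : lag a * geom - (∑ j, a j) • geom = ∑ j, a j • (X ^ ((j : ℕ) + 1) * geom - geom) := by
    rw [lag_mul]; simp [smul_sub, sum_sub_distrib, sum_smul]
  rw [this, mul_sum]
  refine (seminorm_sum_smul_le _ _ _).trans (sum_le_sum fun j _ => ?_)
  rw [mul_comm]
  gcongr
  refine (l2_X_pow_mul_geom_sub _ _).trans ?_
  exact_mod_cast j.2

/-! ### The weighted sums of correlations with `D` -/

/-- The seminorm `∑_{k<n} ρ^k |⟨D, X^k V⟩|`. -/
noncomputable def corr (n : ℕ) (ρ : ℝ) (D : ℝ⟦X⟧) : Seminorm ℝ ℝ⟦X⟧ :=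
  Seminorm.of (fun V => ∑ k ∈ range n, |ρ| ^ k * |ip n D (X ^ k * V)|)
    (fun U V => by
      rw [← sum_add_distrib]
      refine sum_le_sum fun k _ => ?_
      rw [mul_add, ip_add_right, ← mul_add]
      gcongr
      exact abs_add_le _ _)
    (fun a V => by
      rw [mul_sum]
      refine sum_congr rfl fun k _ => ?_
      rw [mul_smul_comm, ip_smul_right, abs_mul, Real.norm_eq_abs]; ring)

lemma corr_apply (n : ℕ) {ρ : ℝ} (hρ : 0 ≤ ρ) (D V : ℝ⟦X⟧) :
    corr n ρ D V = ∑ k ∈ range n, ρ ^ k * |ip n D (X ^ k * V)| := by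
  change ∑ k ∈ range n, |ρ| ^ k * |ip n D (X ^ k * V)| = _
  rw [abs_of_nonneg hρ]

/-- After `n` shifts nothing is left in the window of length `n`; this is why the sum in `corr` can
stop at `n` without a boundary term in `shiftBound_corr`. -/
lemma ip_X_pow_mul_self_eq_zero (n : ℕ) (D V : ℝ⟦X⟧) : ip n D (X ^ n * V) = 0 := by
  refine sum_eq_zero fun t ht => ?_
  rw [PowerSeries.coeff_X_pow_mul', if_neg (by simpa using ht), mul_zero]

lemma shiftBound_corr (n : ℕ) {ρ : ℝ} (hρ : 0 < ρ) (D : ℝ⟦X⟧) :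
    ShiftBound (corr n ρ D) ρ⁻¹ := fun U => by
  rw [corr_apply n hρ.le, corr_apply n hρ.le, mul_sum]
  set f : ℕ → ℝ := fun k => ρ⁻¹ * (ρ ^ k * |ip n D (X ^ k * U)|) with hf
  have h1 : ∀ k, ρ ^ k * |ip n D (X ^ k * (X * U))| = f (k + 1) := fun k => by
    simp only [hf]; rw [pow_succ X, mul_assoc]; field_simp; ring_nf
  simp only [h1]
  have h2 := sum_range_succ' f n
  rw [sum_range_succ] at h2
  have h3 : f n = 0 := by simp [hf, ip_X_pow_mul_self_eq_zero]
  have h4 : 0 ≤ f 0 := by simp only [hf]; positivity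
  linarith

lemma abs_ip_le_corr {n : ℕ} {ρ : ℝ} (hρ : 0 ≤ ρ) (D V : ℝ⟦X⟧) : |ip n D V| ≤ corr n ρ D V := by
  rw [corr_apply n hρ]
  cases n with
  | zero => simp [ip]
  | succ n =>
    rw [sum_range_succ']
    have : 0 ≤ ∑ k ∈ range n, ρ ^ (k + 1) * |ip (n + 1) D (X ^ (k + 1) * V)| := by positivity
    simpa using this

lemma sum_pow_le {ρ : ℝ} (hρ : 0 ≤ ρ) (hρ1 : ρ < 1) (n : ℕ) :
    ∑ k ∈ range n, ρ ^ k ≤ (1 - ρ)⁻¹ := by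
  rw [← tsum_geometric_of_lt_one hρ hρ1]
  exact (summable_geometric_of_lt_one hρ hρ1).sum_le_tsum _ fun _ _ => by positivity

/-- A crude Cauchy–Schwarz bound, for error terms that are small in `ℓ²` but have no martingale
structure with respect to `D`. -/
lemma corr_le_l2 (n : ℕ) {ρ : ℝ} (hρ : 0 ≤ ρ) (hρ1 : ρ < 1) (D V : ℝ⟦X⟧) :
    corr n ρ D V ≤ (1 - ρ)⁻¹ * (l2 n D * l2 n V) := by
  rw [corr_apply n hρ]
  refine le_trans ?_ (mul_le_mul_of_nonneg_right (sum_pow_le hρ hρ1 n) (by positivity))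
  rw [sum_mul]
  refine sum_le_sum fun k _ => ?_
  gcongr
  exact (abs_ip_le _ _ _).trans (by gcongr; exact l2_X_pow_mul_le _ _ _)

/-- A lower bound on the norm of a linear combination of nearly orthogonal vectors. -/
lemma l2_sum_sq_ge {κ : Type*} [Fintype κ] (n : ℕ) (u : κ → ℝ⟦X⟧) (c : κ → ℝ)
    {μ τ : ℝ} (hτ : 0 ≤ τ) (hdiag : ∀ i, μ ≤ l2 n (u i) ^ 2)
    (hoff : ∀ i j, i ≠ j → |ip n (u i) (u j)| ≤ τ) :
    (μ - τ * Fintype.card κ) * ∑ i, c i ^ 2 ≤ l2 n (∑ i, c i • u i) ^ 2 := by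
  classical
  have hexp : l2 n (∑ i, c i • u i) ^ 2 = ∑ i, ∑ j, c i * c j * ip n (u i) (u j) := by
    simp only [l2_sq, ip_eq_inner, map_sum, map_smul, sum_inner, inner_sum, real_inner_smul_left,
      real_inner_smul_right, mul_assoc]
    exact sum_congr rfl fun i _ => sum_congr rfl fun j _ => by rw [real_inner_comm]
  -- Subtracting the off-diagonal bound on the diagonal too makes the error a full square `τ (∑ |c
  -- i|)²`, which Cauchy–Schwarz bounds with the factor `card κ`.
  have hterm : ∀ i j, (if i = j then μ * c i ^ 2 else 0) - τ * (|c i| * |c j|) ≤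
      c i * c j * ip n (u i) (u j) := fun i j => by
    split_ifs with h
    · subst h
      have := hdiag i
      rw [l2_sq] at this
      nlinarith [mul_le_mul_of_nonneg_right this (sq_nonneg (c i)),
        mul_nonneg hτ (mul_nonneg (abs_nonneg (c i)) (abs_nonneg (c i)))]
    · have h1 := hoff i j h
      have h2 : |c i * c j * ip n (u i) (u j)| ≤ |c i| * |c j| * τ := by
        rw [abs_mul, abs_mul]; gcongr
      linarith [(abs_le.1 h2).1]
  have hcs : (∑ i, |c i|) ^ 2 ≤ Fintype.card κ * ∑ i, c i ^ 2 := by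
    have := sq_sum_le_card_mul_sum_sq (s := univ) (f := fun i => |c i|)
    simpa using this
  rw [hexp]
  refine le_trans ?_ (sum_le_sum fun i _ => sum_le_sum fun j _ => hterm i j)
  simp only [sum_sub_distrib, sum_ite_eq, mem_univ, if_true, ← mul_sum, ← sum_mul]
  nlinarith

end DRBeta

namespace DRBeta

open PowerSeries Finset

/-! ### Identification -/

lemma coeff_lagPoly {r : ℕ} (a : Fin r → ℝ) (j : Fin r) : (lagPoly a).coeff ((j : ℕ) + 1) = a j := by
  simp only [lagPoly, Polynomial.finsetSum_coeff, Polynomial.coeff_C_mul_X_pow]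
  rw [sum_eq_single j]
  · simp
  · intro b _ hb
    rw [if_neg]
    intro h
    exact hb (Fin.ext (by omega))
  · simp

lemma coeff_zero_lagPoly {r : ℕ} (a : Fin r → ℝ) : (lagPoly a).coeff 0 = 0 := by
  simp [lagPoly]

lemma lagPoly_eq_zero {r : ℕ} {a : Fin r → ℝ} (h : lagPoly a = 0) : a = 0 := by
  ext j; rw [← coeff_lagPoly a j, h]; simp

lemma natDegree_lagPoly_le {r : ℕ} (a : Fin r → ℝ) : (lagPoly a).natDegree ≤ r := by
  refine Polynomial.natDegree_sum_le_of_forall_le _ _ fun j _ => ?_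
  exact (Polynomial.natDegree_C_mul_X_pow_le _ _).trans j.2

lemma lagPoly_add {r : ℕ} (a b : Fin r → ℝ) : lagPoly (a + b) = lagPoly a + lagPoly b := by
  simp [lagPoly, add_mul, sum_add_distrib]

lemma lagPoly_smul {r : ℕ} (c : ℝ) (a : Fin r → ℝ) : lagPoly (c • a) = c • lagPoly a := by
  simp [lagPoly, smul_sum, Polynomial.smul_eq_C_mul, mul_assoc]

variable {p q : ℕ}

/-- The target is a general module so that the same splitting serves power series and complex values
of `phi`. -/
lemma sum_arCoeff {M : Type*} [AddCommGroup M] [Module ℝ M] (θ : Param p q) (f : ℕ → M) :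
    ∑ i, arCoeff θ i • f i = ∑ j, Param.ga θ j • f j + ∑ j, Param.al θ j • f j := by
  simp only [arCoeff, add_smul, sum_add_distrib]
  congr 1
  set F : ℕ → M := fun i => (if hi : i < q then Param.ga θ ⟨i, hi⟩ else 0) • f i with hF
  have h1 : ∑ i : Fin (max p q), F i = ∑ j : Fin q, F j := by
    rw [Fin.sum_univ_eq_sum_range, Fin.sum_univ_eq_sum_range]
    refine (sum_subset (range_mono (le_max_right p q)) fun i _ hi => ?_).symm
    simp [hF, mem_range.not.1 hi]
  simpa [hF] using h1

lemma lag_arCoeff (θ : Param p q) : lag (arCoeff θ) = lag (Param.ga θ) + lag (Param.al θ) :=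
  sum_arCoeff θ fun i => (X : ℝ⟦X⟧) ^ (i + 1)

lemma aeval_lagPoly {r : ℕ} (a : Fin r → ℝ) (x : ℂ) :
    Polynomial.aeval x (lagPoly a) = ∑ j, ((a j : ℝ) : ℂ) * x ^ ((j : ℕ) + 1) := by
  simp [lagPoly]

lemma phi_eq_aeval (θ : Param p q) (x : ℂ) : phi θ x =
    Polynomial.aeval x (1 - lagPoly (Param.ga θ)) - Polynomial.aeval x (lagPoly (Param.al θ)) := by
  have := sum_arCoeff θ fun i => x ^ (i + 1)
  simp only [Complex.real_smul] at this
  rw [phi, this, map_sub, aeval_lagPoly, aeval_lagPoly, map_one]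
  ring

lemma upsilon_eq_aeval (θ : Param p q) (x : ℂ) :
    upsilon θ x = Polynomial.aeval x (lagPoly (Param.al θ)) := by
  rw [upsilon, aeval_lagPoly]

/-- Since `φ = (1 - γ) - Υ`, a common root of `1 - γ` and `Υ` is one of `φ` and `Υ`; over `ℂ`,
having no common root means being coprime. -/
lemma isCoprime_of_no_common_root (θ : Param p q)
    (h : ∀ x : ℂ, phi θ x = 0 → upsilon θ x ≠ 0) :
    IsCoprime (1 - lagPoly (Param.ga θ)) (lagPoly (Param.al θ)) := by
  refine (Polynomial.isCoprime_iff_aeval_ne_zero_of_isAlgClosed (k := ℝ) ℂ _ _).2 fun x => ?_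
  by_contra! hx
  exact h x (by rw [phi_eq_aeval, hx.1, hx.2, sub_zero]) (by rw [upsilon_eq_aeval, hx.2])

/-- The moving average polynomial of `φ_{θ₀}(B) (1 - γ_θ(B)) (h(θ₀) - h(θ))` for `δ = θ₀ - θ`. -/
noncomputable def maPoly (θ₀ δ : Param p q) : Polynomial ℝ :=
  lagPoly (Param.ga δ) * lagPoly (Param.al θ₀) +
    lagPoly (Param.al δ) * (1 - lagPoly (Param.ga θ₀))

/-- There is no redundant order: `γ_q` and `α_{p ∨ q}` do not both vanish if `q ≥ 1`. -/
def HasFullOrder (θ : Param p q) : Prop :=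
  0 < q → (∃ j : Fin q, (j : ℕ) + 1 = q ∧ Param.ga θ j ≠ 0) ∨
    ∃ j : Fin (max p q), (j : ℕ) + 1 = max p q ∧ Param.al θ j ≠ 0

/-- By coprimality `1 - γ₀` divides `γ_δ`, say `γ_δ = (1 - γ₀) m`, and then `α_δ = -m α₀`. Full
order makes one of these two products exceed the permitted degree unless `m` is constant. As `γ_δ`
vanishes at `0` and `1 - γ₀` equals `1` there, `m = 0`. -/
lemma maPoly_eq_zero {θ₀ δ : Param p q}
    (hcop : IsCoprime (1 - lagPoly (Param.ga θ₀)) (lagPoly (Param.al θ₀)))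
    (horder : HasFullOrder θ₀)
    (h : maPoly θ₀ δ = 0) : Param.ga δ = 0 ∧ Param.al δ = 0 := by
  have hA0 : (1 - lagPoly (Param.ga θ₀)).coeff 0 = 1 := by simp [coeff_zero_lagPoly]
  have hAne : 1 - lagPoly (Param.ga θ₀) ≠ 0 := fun h0 => by simp [h0] at hA0
  have hga : Param.ga δ = 0 → Param.ga δ = 0 ∧ Param.al δ = 0 := fun h0 => by
    refine ⟨h0, lagPoly_eq_zero ?_⟩
    have h1 : lagPoly (Param.ga δ) = 0 := by rw [h0]; simp [lagPoly]
    rw [maPoly, h1, zero_mul, zero_add] at h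
    exact (mul_eq_zero.1 h).resolve_right hAne
  refine hga ?_
  obtain ⟨m, hm⟩ : 1 - lagPoly (Param.ga θ₀) ∣ lagPoly (Param.ga δ) :=
    hcop.dvd_of_dvd_mul_right ⟨-lagPoly (Param.al δ), by rw [maPoly] at h; linear_combination h⟩
  suffices hdeg : m.natDegree = 0 by
    have h0 := congrArg (fun P => Polynomial.coeff P 0) hm
    simp only [Polynomial.mul_coeff_zero, hA0, coeff_zero_lagPoly, one_mul] at h0
    refine lagPoly_eq_zero ?_
    rw [hm, Polynomial.eq_C_of_natDegree_eq_zero hdeg, ← h0]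
    simp
  rcases Nat.eq_zero_or_pos q with rfl | hq
  · have h1 : lagPoly (Param.ga δ) = 0 := by simp [lagPoly]
    rw [h1] at hm
    simp [(mul_eq_zero.1 hm.symm).resolve_left hAne]
  by_cases hm0 : m = 0
  · simp [hm0]
  rcases horder hq with ⟨j, hj, hγ⟩ | ⟨j, hj, hα⟩
  · have h1 : q ≤ (1 - lagPoly (Param.ga θ₀)).natDegree := by
      refine Polynomial.le_natDegree_of_ne_zero ?_
      have h2 := coeff_lagPoly (Param.ga θ₀) j
      rw [hj] at h2
      simpa [Polynomial.coeff_one, h2, hq.ne'] using hγ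
    have h2 := natDegree_lagPoly_le (Param.ga δ)
    rw [hm, Polynomial.natDegree_mul hAne hm0] at h2
    omega
  · have hr : 0 < max p q := lt_max_of_lt_right hq
    have h1 : max p q ≤ (lagPoly (Param.al θ₀)).natDegree := by
      refine Polynomial.le_natDegree_of_ne_zero ?_
      have h2 := coeff_lagPoly (Param.al θ₀) j
      rw [hj] at h2
      rwa [h2]
    have hne : lagPoly (Param.al θ₀) ≠ 0 := fun h0 => by simp [h0] at h1; omega
    have h3 : m * lagPoly (Param.al θ₀) = - lagPoly (Param.al δ) := by
      refine mul_left_cancel₀ hAne ?_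
      rw [maPoly, hm] at h
      linear_combination h
    have h2 := natDegree_lagPoly_le (Param.al δ)
    rw [← Polynomial.natDegree_neg, ← h3, Polynomial.natDegree_mul hm0 hne] at h2
    omega

/-- This fixes the number `2 * max p q + 1` of lags of `D` whose near orthogonality is needed. -/
lemma natDegree_maPoly_lt (θ₀ δ : Param p q) :
    (maPoly θ₀ δ).natDegree < 2 * max p q + 1 := by
  refine Nat.lt_succ_of_le ((Polynomial.natDegree_add_le _ _).trans (max_le ?_ ?_))
  · refine Polynomial.natDegree_mul_le.trans ?_
    have := natDegree_lagPoly_le (Param.ga δ)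
    have := natDegree_lagPoly_le (Param.al θ₀)
    omega
  · refine Polynomial.natDegree_mul_le.trans ?_
    have h1 := natDegree_lagPoly_le (Param.al δ)
    have h2 := natDegree_lagPoly_le (Param.ga θ₀)
    have h3 := Polynomial.natDegree_sub_le (1 : Polynomial ℝ) (lagPoly (Param.ga θ₀))
    simp only [Polynomial.natDegree_one] at h3
    omega

lemma maPoly_add (θ₀ δ δ' : Param p q) : maPoly θ₀ (δ + δ') = maPoly θ₀ δ + maPoly θ₀ δ' := by
  simp only [maPoly, Param.ga, Param.al, Prod.snd_add, Prod.fst_add, lagPoly_add]; ring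

lemma maPoly_smul (θ₀ δ : Param p q) (c : ℝ) : maPoly θ₀ (c • δ) = c • maPoly θ₀ δ := by
  simp only [maPoly, Param.ga, Param.al, Prod.smul_snd, Prod.smul_fst, lagPoly_smul, smul_add,
    smul_mul_assoc]

/-- The constant term that goes with `maPoly`. -/
noncomputable def maConst (θ₀ δ : Param p q) : ℝ :=
  Param.om δ * (1 - ∑ i, arCoeff θ₀ i) +
    Param.om θ₀ * (∑ j, Param.ga δ j + ∑ j, Param.al δ j)

/-- The coefficients of `maConst` and `maPoly`, as a linear map of `δ`. -/
noncomputable def maMap (θ₀ : Param p q) :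
    Param p q →ₗ[ℝ] (Option (Fin (2 * max p q + 1)) → ℝ) where
  toFun δ := fun o => o.elim (maConst θ₀ δ) fun l => (maPoly θ₀ δ).coeff l
  map_add' δ δ' := by
    ext o
    cases o with
    | none => simp [maConst, Param.om, Param.ga, Param.al, sum_add_distrib]; ring
    | some l => simp [maPoly_add]
  map_smul' c δ := by
    ext o
    cases o with
    | none => simp [maConst, Param.om, Param.ga, Param.al, ← mul_sum]; ring
    | some l => simp [maPoly_smul]

/-- Identification made quantitative: an injective linear map on a finite-dimensional space is
bounded below. The intercept is recovered last, because `1 - ∑ arCoeff θ₀ i ≠ 0`. -/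
lemma exists_le_maMap {θ₀ : Param p q}
    (hcop : IsCoprime (1 - lagPoly (Param.ga θ₀)) (lagPoly (Param.al θ₀)))
    (horder : HasFullOrder θ₀)
    (hsum : ∑ i, |arCoeff θ₀ i| < 1) :
    ∃ c : ℝ, 0 < c ∧ ∀ δ, c * ‖δ‖ ^ 2 ≤ ∑ o, maMap θ₀ δ o ^ 2 := by
  have hker : LinearMap.ker (maMap θ₀) = ⊥ := by
    refine LinearMap.ker_eq_bot'.2 fun δ hδ => ?_
    have hpoly : maPoly θ₀ δ = 0 := by
      ext k
      by_cases hk : k < 2 * max p q + 1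
      · simpa [maMap] using congrFun hδ (some ⟨k, hk⟩)
      · rw [Polynomial.coeff_eq_zero_of_natDegree_lt
          ((natDegree_maPoly_lt θ₀ δ).trans_le (not_lt.1 hk))]
        simp
    obtain ⟨h1, h2⟩ := maPoly_eq_zero hcop horder hpoly
    have h3 : maConst θ₀ δ = 0 := by simpa [maMap] using congrFun hδ none
    have h4 : Param.om δ = 0 := by
      simp only [maConst, h1, h2, Pi.zero_apply, sum_const_zero, add_zero, mul_zero] at h3
      refine (mul_eq_zero.1 h3).resolve_right ?_
      have := (le_abs_self _).trans (abs_sum_le_sum_abs (arCoeff θ₀) univ)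
      linarith
    exact Prod.ext h4 (Prod.ext h1 h2)
  obtain ⟨K, hK0, hK⟩ := (maMap θ₀).exists_antilipschitzWith hker
  have hKpos : (0 : ℝ) < K := by exact_mod_cast hK0
  refine ⟨((K : ℝ) ^ 2)⁻¹, by positivity, fun δ => ?_⟩
  have h1 : ‖δ‖ ≤ K * ‖maMap θ₀ δ‖ := by
    have := hK.le_mul_dist δ 0
    simpa using this
  have h2 : ‖maMap θ₀ δ‖ ^ 2 ≤ ∑ o, maMap θ₀ δ o ^ 2 := by
    obtain ⟨o, -, ho⟩ := exists_mem_eq_sup' (univ_nonempty) fun o => ‖maMap θ₀ δ o‖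
    have h3 : ‖maMap θ₀ δ‖ ≤ ‖maMap θ₀ δ o‖ := by
      refine (pi_norm_le_iff_of_nonneg (norm_nonneg _)).2 fun i => ?_
      rw [← ho]; exact le_sup' (fun o => ‖maMap θ₀ δ o‖) (mem_univ i)
    calc ‖maMap θ₀ δ‖ ^ 2 ≤ ‖maMap θ₀ δ o‖ ^ 2 := by gcongr
      _ = maMap θ₀ δ o ^ 2 := by simp
      _ ≤ _ := single_le_sum (f := fun o => maMap θ₀ δ o ^ 2) (fun _ _ => sq_nonneg _) (mem_univ o)
  rw [inv_mul_le_iff₀ (by positivity)]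
  calc ‖δ‖ ^ 2 ≤ (K * ‖maMap θ₀ δ‖) ^ 2 := by gcongr
    _ = K ^ 2 * ‖maMap θ₀ δ‖ ^ 2 := by ring
    _ ≤ _ := by gcongr

end DRBeta

namespace DRBeta

open PowerSeries Finset

/-! ### The recursion in terms of power series -/

/-- The power series whose coefficient at `t` is `y_{t+1}`. -/
noncomputable def ser (y : ℤ → ℝ) : ℝ⟦X⟧ := PowerSeries.mk fun t => y ((t : ℤ) + 1)

/-- The series of `∑_j a_j y_{i-j}`. -/
noncomputable def lagSer {r : ℕ} (a : Fin r → ℝ) (y : ℤ → ℝ) : ℝ⟦X⟧ :=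
  ∑ j : Fin r, a j • ser fun i => y (i - ((j : ℤ) + 1))

/-- The size of the initial values `y_0, …, y_{-(r-1)}`. -/
noncomputable def initSize (r : ℕ) (y : ℤ → ℝ) : ℝ := ∑ i ∈ range r, |y (-(i : ℤ))|

lemma initSize_nonneg (r : ℕ) (y : ℤ → ℝ) : 0 ≤ initSize r y := sum_nonneg fun _ _ => abs_nonneg _

lemma coeff_ser (t : ℕ) (y : ℤ → ℝ) : coeff t (ser y) = y ((t : ℤ) + 1) := by simp [ser]

lemma ser_sub (y z : ℤ → ℝ) : ser (y - z) = ser y - ser z := by ext t; simp [coeff_ser]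

lemma ser_back_succ (y : ℤ → ℝ) (j : ℕ) : ser (fun i => y (i - ((j : ℤ) + 1))) =
    X * ser (fun i => y (i - j)) + C (y (-(j : ℤ))) := by
  ext t
  rw [map_add, coeff_X_mul, coeff_C, coeff_ser]
  cases t with
  | zero => simp
  | succ t => simp [coeff_ser]

lemma l2_ser_back_sub (n : ℕ) (y : ℤ → ℝ) (j : ℕ) :
    l2 n (ser (fun i => y (i - j)) - X ^ j * ser y) ≤ initSize j y := by
  induction j with
  | zero => simp [initSize]
  | succ j ih =>
    have h1 : ser (fun i => y (i - ((j + 1 : ℕ) : ℤ))) - X ^ (j + 1) * ser y =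
        X * (ser (fun i => y (i - j)) - X ^ j * ser y) + C (y (-(j : ℤ))) := by
      push_cast; rw [ser_back_succ]; ring
    rw [h1, initSize, sum_range_succ]
    exact (map_add_le_add (l2 n) _ _).trans
      (add_le_add ((l2_X_mul_le _ _).trans ih) (l2_C_le _ _))

lemma initSize_mono {r s : ℕ} (h : r ≤ s) (y : ℤ → ℝ) : initSize r y ≤ initSize s y :=
  sum_le_sum_of_subset_of_nonneg (range_mono h) fun _ _ _ => abs_nonneg _

lemma l2_lagSer_sub (n : ℕ) {r R : ℕ} (hr : r ≤ R) (a : Fin r → ℝ) (y : ℤ → ℝ) :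
    l2 n (lagSer a y - lag a * ser y) ≤ (∑ j, |a j|) * initSize R y := by
  rw [lagSer, lag_mul, ← sum_sub_distrib, sum_mul]
  simp only [← smul_sub]
  refine (seminorm_sum_smul_le _ _ _).trans (sum_le_sum fun j _ => ?_)
  gcongr
  have := l2_ser_back_sub n y ((j : ℕ) + 1)
  push_cast at this
  exact this.trans (initSize_mono (by omega) y)

lemma ser_back_eq {y : ℤ → ℝ} (hy : ∀ i ≤ 0, y i = 0) (j : ℕ) :
    ser (fun i => y (i - j)) = X ^ j * ser y := by
  induction j with
  | zero => simp
  | succ j ih =>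
    push_cast
    rw [ser_back_succ, ih, hy _ (by omega)]
    simp [pow_succ', mul_assoc]

/-- With zero initial values lags are exactly powers of `X`; it is used for differences of two
recursions with common initial values. -/
lemma lagSer_eq {r : ℕ} (a : Fin r → ℝ) {y : ℤ → ℝ} (hy : ∀ i ≤ 0, y i = 0) :
    lagSer a y = lag a * ser y := by
  rw [lagSer, lag_mul]
  refine sum_congr rfl fun j _ => ?_
  have := ser_back_eq hy ((j : ℕ) + 1)
  push_cast at this
  rw [this]

lemma lagSer_sub {r : ℕ} (a : Fin r → ℝ) (y z : ℤ → ℝ) :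
    lagSer a (y - z) = lagSer a y - lagSer a z := by
  simp only [lagSer, ← sum_sub_distrib, ← smul_sub, ← ser_sub]
  rfl

lemma lagSer_sub_left {r : ℕ} (a b : Fin r → ℝ) (y : ℤ → ℝ) :
    lagSer (a - b) y = lagSer a y - lagSer b y := by
  simp [lagSer, sub_smul, sum_sub_distrib]

variable {p q : ℕ}

lemma hSeq_of_nonpos (θ : Param p q) (x h0 : ℤ → ℝ) {i : ℤ} (hi : i ≤ 0) :
    hSeq θ x h0 i = h0 i := by rw [hSeq, if_pos hi]

lemma hSeq_of_pos (θ : Param p q) (x h0 : ℤ → ℝ) {i : ℤ} (hi : 0 < i) :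
    hSeq θ x h0 i = Param.om θ + ∑ j : Fin q, Param.ga θ j * hSeq θ x h0 (i - ((j : ℤ) + 1))
      + ∑ j : Fin (max p q), Param.al θ j * x (i - ((j : ℤ) + 1)) := by
  rw [hSeq, if_neg (not_le.2 hi)]

lemma ser_hSeq (θ : Param p q) (x h0 : ℤ → ℝ) : ser (hSeq θ x h0) =
    Param.om θ • geom + lagSer (Param.ga θ) (hSeq θ x h0) + lagSer (Param.al θ) x := by
  ext t
  rw [coeff_ser, hSeq_of_pos _ _ _ (by omega)]
  simp [lagSer, coeff_ser, coeff_geom]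

/-- The residuals `x_i - h_i(θ)`, as a power series. -/
noncomputable def resid (θ : Param p q) (x h0 : ℤ → ℝ) : ℝ⟦X⟧ := ser x - ser (hSeq θ x h0)

/-- The total size of the initial values. -/
noncomputable def initTotal (p q : ℕ) (x h0 : ℤ → ℝ) : ℝ :=
  initSize (max p q) x + initSize (max p q) h0

lemma initTotal_nonneg (x h0 : ℤ → ℝ) : 0 ≤ initTotal p q x h0 :=
  add_nonneg (initSize_nonneg _ _) (initSize_nonneg _ _)

lemma initSize_hSeq (θ : Param p q) (x h0 : ℤ → ℝ) (r : ℕ) :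
    initSize r (hSeq θ x h0) = initSize r h0 :=
  sum_congr rfl fun i _ => by rw [hSeq_of_nonpos _ _ _ (by omega)]

lemma quasiLik_eq (n : ℕ) (x h0 : ℤ → ℝ) (θ : Param p q) :
    quasiLik n x h0 θ = -((1 / (n : ℝ)) * l2 n (resid θ x h0) ^ 2) := by
  rw [quasiLik, l2_sq_eq_sum]
  congr 2
  rw [range_eq_Ico, sum_Ico_eq_sum_range, ← Ico_succ_right_eq_Icc, sum_Ico_eq_sum_range]
  refine sum_congr (by simp) fun t _ => ?_
  simp only [resid, map_sub, coeff_ser]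
  push_cast
  simp [add_comm]

/-- The linear function of `δ` with `(1 - γ_θ(B)) (h(θ₀) - h(θ)) = score (θ₀ - θ)`. -/
noncomputable def score (θ₀ : Param p q) (x h0 : ℤ → ℝ) (δ : Param p q) : ℝ⟦X⟧ :=
  Param.om δ • geom + lagSer (Param.ga δ) (hSeq θ₀ x h0) + lagSer (Param.al δ) x

/-- The identity is exact: the initial values do not depend on the parameter, so they cancel in
`h(θ₀) - h(θ)`, and writing the recursion with `γ_θ` on the left leaves a right side linear in `θ₀ -
θ`. -/
lemma filter_resid_sub (θ₀ θ : Param p q) (x h0 : ℤ → ℝ) :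
    (resid θ x h0 - resid θ₀ x h0) - lag (Param.ga θ) * (resid θ x h0 - resid θ₀ x h0) =
      score θ₀ x h0 (θ₀ - θ) := by
  have h1 : resid θ x h0 - resid θ₀ x h0 = ser (hSeq θ₀ x h0 - hSeq θ x h0) := by
    rw [ser_sub, resid, resid]; ring
  rw [h1, ← lagSer_eq _ (fun i hi => by simp [hSeq_of_nonpos _ _ _ hi]), lagSer_sub, ser_sub,
    ser_hSeq θ₀, ser_hSeq θ, score]
  have h2 : Param.ga (θ₀ - θ) = Param.ga θ₀ - Param.ga θ := rfl
  have h3 : Param.al (θ₀ - θ) = Param.al θ₀ - Param.al θ := rfl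
  have h4 : Param.om (θ₀ - θ) = Param.om θ₀ - Param.om θ := rfl
  rw [h2, h3, h4, lagSer_sub_left, lagSer_sub_left, sub_smul]
  ring

lemma sum_abs_ga_le (δ : Param p q) : ∑ j, |Param.ga δ j| ≤ max p q * ‖δ‖ := by
  have h1 : ∀ j, |Param.ga δ j| ≤ ‖δ‖ := fun j =>
    (norm_le_pi_norm δ.2.1 j).trans ((norm_fst_le δ.2).trans (norm_snd_le δ))
  refine (sum_le_card_nsmul _ _ _ fun j _ => h1 j).trans ?_
  simp only [card_univ, Fintype.card_fin, nsmul_eq_mul]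
  gcongr
  exact le_max_right _ _

lemma sum_abs_al_le (δ : Param p q) : ∑ j, |Param.al δ j| ≤ max p q * ‖δ‖ := by
  have h1 : ∀ j, |Param.al δ j| ≤ ‖δ‖ := fun j =>
    (norm_le_pi_norm δ.2.2 j).trans ((norm_snd_le δ.2).trans (norm_snd_le δ))
  refine (sum_le_card_nsmul _ _ _ fun j _ => h1 j).trans ?_
  simp

lemma abs_om_le (δ : Param p q) : |Param.om δ| ≤ ‖δ‖ := norm_fst_le δ

/-- The error in `φ_{θ₀}(B) h = ω₀ + α₀(B) D` due to the initial values. -/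
lemma l2_filter_hSeq_sub (n : ℕ) (θ : Param p q) (x h0 : ℤ → ℝ) :
    l2 n ((ser (hSeq θ x h0) - lag (arCoeff θ) * ser (hSeq θ x h0)) -
      (Param.om θ • geom + lag (Param.al θ) * resid θ x h0)) ≤
      (∑ j, |Param.ga θ j| + ∑ j, |Param.al θ j|) * initTotal p q x h0 := by
  have h1 : (ser (hSeq θ x h0) - lag (arCoeff θ) * ser (hSeq θ x h0)) -
      (Param.om θ • geom + lag (Param.al θ) * resid θ x h0) =
      (lagSer (Param.ga θ) (hSeq θ x h0) - lag (Param.ga θ) * ser (hSeq θ x h0)) +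
      (lagSer (Param.al θ) x - lag (Param.al θ) * ser x) := by
    rw [lag_arCoeff, resid]
    linear_combination ser_hSeq θ x h0
  rw [h1, add_mul]
  refine (map_add_le_add (l2 n) _ _).trans (add_le_add ?_ ?_)
  · refine (l2_lagSer_sub n (le_max_right p q) _ _).trans ?_
    rw [initSize_hSeq]
    gcongr
    exact le_add_of_nonneg_left (initSize_nonneg _ _)
  · refine (l2_lagSer_sub n le_rfl _ _).trans ?_
    gcongr
    exact le_add_of_nonneg_right (initSize_nonneg _ _)

/-- The error from the initial values carries a factor `‖δ‖`, as it must if it is not to spoil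
bounds that are linear in `δ`. -/
lemma l2_score_sub (n : ℕ) (θ₀ : Param p q) (x h0 : ℤ → ℝ) (δ : Param p q) :
    l2 n (score θ₀ x h0 δ - (Param.om δ • geom + lag (Param.ga δ) * ser (hSeq θ₀ x h0) +
      lag (Param.al δ) * ser x)) ≤ 2 * max p q * ‖δ‖ * initTotal p q x h0 := by
  have h1 : score θ₀ x h0 δ - (Param.om δ • geom + lag (Param.ga δ) * ser (hSeq θ₀ x h0) +
      lag (Param.al δ) * ser x) =
      (lagSer (Param.ga δ) (hSeq θ₀ x h0) - lag (Param.ga δ) * ser (hSeq θ₀ x h0)) +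
      (lagSer (Param.al δ) x - lag (Param.al δ) * ser x) := by
    rw [score]; ring
  have h2 := l2_lagSer_sub n (le_max_right p q) (Param.ga δ) (hSeq θ₀ x h0)
  have h3 := l2_lagSer_sub n (le_refl (max p q)) (Param.al δ) x
  rw [initSize_hSeq] at h2
  have h4 := mul_le_mul_of_nonneg_right (sum_abs_ga_le δ) (initSize_nonneg (max p q) h0)
  have h5 := mul_le_mul_of_nonneg_right (sum_abs_al_le δ) (initSize_nonneg (max p q) x)
  have h6 : 0 ≤ max p q * ‖δ‖ * initSize (max p q) h0 :=
    mul_nonneg (by positivity) (initSize_nonneg _ _)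
  have h7 : 0 ≤ max p q * ‖δ‖ * initSize (max p q) x :=
    mul_nonneg (by positivity) (initSize_nonneg _ _)
  rw [h1, initTotal]
  refine (map_add_le_add (l2 n) _ _).trans ?_
  push_cast at *
  linarith

/-- The residuals at `θ₀` for the data `x` are close to those for the data `x'`. -/
lemma exists_l2_resid_sub_le (θ₀ : Param p q) (hγ : ∑ j, |Param.ga θ₀ j| < 1) :
    ∃ K : ℝ, 0 ≤ K ∧ ∀ (n : ℕ) (x h0 x' h0' : ℤ → ℝ),
      l2 n (resid θ₀ x h0 - resid θ₀ x' h0') ≤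
        K * (l2 n (ser (x - x')) + initTotal p q (x - x') (h0 - h0')) := by
  set g := ∑ j, |Param.ga θ₀ j| with hg
  set a := ∑ j, |Param.al θ₀ j| with ha
  have hg0 : 0 ≤ g := sum_nonneg fun _ _ => abs_nonneg _
  have ha0 : 0 ≤ a := sum_nonneg fun _ _ => abs_nonneg _
  refine ⟨(1 - g)⁻¹ * (1 + g + a), mul_nonneg (inv_nonneg.2 (by linarith)) (by linarith),
    fun n x h0 x' h0' => ?_⟩
  set d := resid θ₀ x h0 - resid θ₀ x' h0' with hd
  set ξ := ser (x - x') with hξ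
  set y := hSeq θ₀ x h0 - hSeq θ₀ x' h0' with hy
  have hdy : d = ξ - ser y := by rw [hd, hξ, hy, ser_sub, ser_sub, resid, resid]; ring
  have hy2 : ser y = lagSer (Param.ga θ₀) y + lagSer (Param.al θ₀) (x - x') := by
    rw [hy, ser_sub, lagSer_sub, lagSer_sub, ser_hSeq, ser_hSeq]; ring
  -- The difference of residuals solves the same recursion, driven by the data error `ξ` and
  -- perturbed by the differences of initial values; `∑ |γ₀| < 1` inverts its filter.
  have h1 : (1 : ℝ) • d - lag (Param.ga θ₀) * d = ξ - lag (Param.ga θ₀) * ξ -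
      lag (Param.al θ₀) * ξ - (lagSer (Param.al θ₀) (x - x') - lag (Param.al θ₀) * ser (x - x')) -
      (lagSer (Param.ga θ₀) y - lag (Param.ga θ₀) * ser y) := by
    rw [one_smul, hdy]
    linear_combination -hy2
  have h2 := (shiftBound_l2 n).filter_le le_rfl (Param.ga θ₀) zero_le_one h1
  rw [one_pow, one_mul, ← hg] at h2
  have h3 := l2_lag_mul_le n (Param.ga θ₀) ξ
  have h4 := l2_lag_mul_le n (Param.al θ₀) ξ
  have h5 := l2_lagSer_sub n (le_refl (max p q)) (Param.al θ₀) (x - x')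
  have h6 := l2_lagSer_sub n (le_max_right p q) (Param.ga θ₀) y
  have h7 : initSize (max p q) y = initSize (max p q) (h0 - h0') :=
    sum_congr rfl fun i _ => by
      simp only [hy, Pi.sub_apply]
      rw [hSeq_of_nonpos _ _ _ (by omega), hSeq_of_nonpos _ _ _ (by omega)]
  rw [h7] at h6
  rw [mul_assoc, inv_mul_eq_div, le_div_iff₀ (by linarith), mul_comm]
  refine h2.trans ?_
  refine (map_sub_le_add (l2 n) _ _).trans ?_
  refine (add_le_add_left (map_sub_le_add (l2 n) _ _) _).trans ?_
  refine (add_le_add_left (add_le_add_left (map_sub_le_add (l2 n) _ _) _) _).trans ?_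
  refine (add_le_add_left (add_le_add_left (add_le_add_left (map_sub_le_add (l2 n) _ _) _) _) _).trans ?_
  rw [initTotal]
  have h8 := initSize_nonneg (max p q) (x - x')
  have h9 := initSize_nonneg (max p q) (h0 - h0')
  have h10 : 0 ≤ g * initSize (max p q) (x - x') := by positivity
  have h11 : 0 ≤ a * initSize (max p q) (h0 - h0') := by positivity
  linarith

end DRBeta

/-! ### Structure of the score and its correlation with the innovations. -/

namespace DRBeta

open PowerSeries Finset

variable {p q : ℕ}

/-- Filtering the score by `φ_{θ₀}(B)` gives a constant plus a moving average of residuals. -/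
lemma exists_l2_filter_score_sub_le (θ₀ : Param p q) (hφ : ∑ i, |arCoeff θ₀ i| ≤ 1) :
    ∃ K : ℝ, 0 ≤ K ∧ ∀ (n : ℕ) (x h0 : ℤ → ℝ) (δ : Param p q),
      l2 n ((score θ₀ x h0 δ - lag (arCoeff θ₀) * score θ₀ x h0 δ) -
        (maConst θ₀ δ • geom + (maPoly θ₀ δ : ℝ⟦X⟧) * resid θ₀ x h0)) ≤
        K * ‖δ‖ * (1 + initTotal p q x h0) := by
  set r : ℝ := max (p : ℝ) q with hr
  set s := ∑ j, |Param.ga θ₀ j| + ∑ j, |Param.al θ₀ j| with hs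
  have hs0 : 0 ≤ s := add_nonneg (sum_nonneg fun _ _ => abs_nonneg _)
    (sum_nonneg fun _ _ => abs_nonneg _)
  have hr0 : 0 ≤ r := le_max_of_le_left (by positivity)
  refine ⟨r + 2 * r ^ 2 * |Param.om θ₀| + 2 * r * s + 4 * r, by positivity,
    fun n x h0 δ => ?_⟩
  set B := initTotal p q x h0 with hB
  have hB0 : 0 ≤ B := initTotal_nonneg x h0
  set H := ser (hSeq θ₀ x h0) with hH
  set R0 := score θ₀ x h0 δ - (Param.om δ • geom + lag (Param.ga δ) * H + lag (Param.al δ) * ser x)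
    with hR0
  set R1 := (H - lag (arCoeff θ₀) * H) -
    (Param.om θ₀ • geom + lag (Param.al θ₀) * resid θ₀ x h0) with hR1
  set gφ := lag (arCoeff θ₀) * geom - (∑ j, arCoeff θ₀ j) • geom with hgφ
  set gγ := lag (Param.ga δ) * geom - (∑ j, Param.ga δ j) • geom with hgγ
  set gα := lag (Param.al δ) * geom - (∑ j, Param.al δ j) • geom with hgα
  -- Substitute `x = H + E` and `φ(B) H ≈ ω₀ + α₀(B) E`. The coefficient of `E` becomes `(γ_δ + α_δ)
  -- α₀ + α_δ (1 - γ₀ - α₀) = γ_δ α₀ + α_δ (1 - γ₀)`, which is `maPoly`; the rest is remainders.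
  have hid : (score θ₀ x h0 δ - lag (arCoeff θ₀) * score θ₀ x h0 δ) -
        (maConst θ₀ δ • geom + (maPoly θ₀ δ : ℝ⟦X⟧) * resid θ₀ x h0) =
      (-Param.om δ) • gφ + Param.om θ₀ • gγ + Param.om θ₀ • gα +
        lag (Param.ga δ) * R1 + lag (Param.al δ) * R1 + R0 - lag (arCoeff θ₀) * R0 := by
    have h1 : ser x = H + resid θ₀ x h0 := by rw [resid]; ring
    have h2 : (maPoly θ₀ δ : ℝ⟦X⟧) = lag (Param.ga δ) * lag (Param.al θ₀) +
        lag (Param.al δ) * (1 - lag (Param.ga θ₀)) := by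
      simp only [maPoly, Polynomial.coe_add, Polynomial.coe_mul, Polynomial.coe_sub,
        Polynomial.coe_one, coe_lagPoly]
    rw [h2, maConst, hR0, hR1, hgφ, hgγ, hgα, h1]
    simp only [smul_eq_C_mul, map_add, map_sub, map_mul, map_neg, map_one]
    have h3 := lag_arCoeff θ₀
    linear_combination (-lag (Param.al δ) * resid θ₀ x h0) * h3
  have hc : ((max p q : ℕ) : ℝ) = r := by simp [hr]
  have b0 : l2 n R0 ≤ 2 * r * ‖δ‖ * B := by
    have := l2_score_sub n θ₀ x h0 δ
    simpa [hr] using this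
  have b1 : l2 n R1 ≤ s * B := l2_filter_hSeq_sub n θ₀ x h0
  have dγ : ∑ j, |Param.ga δ j| ≤ r * ‖δ‖ := by simpa [hr] using sum_abs_ga_le δ
  have dα : ∑ j, |Param.al δ j| ≤ r * ‖δ‖ := by simpa [hr] using sum_abs_al_le δ
  have bφ : l2 n gφ ≤ r := by
    refine (l2_lag_mul_geom_sub n _).trans ?_
    rw [hc]; exact mul_le_of_le_one_right hr0 hφ
  have bγ : l2 n gγ ≤ r * (r * ‖δ‖) := by
    refine (l2_lag_mul_geom_sub n _).trans ?_
    have : (q : ℝ) ≤ r := le_max_right _ _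
    gcongr
  have bα : l2 n gα ≤ r * (r * ‖δ‖) := by
    refine (l2_lag_mul_geom_sub n _).trans ?_
    rw [hc]; gcongr
  have c1 : l2 n ((-Param.om δ) • gφ) ≤ ‖δ‖ * r := by
    rw [map_smul_eq_mul, norm_neg]
    exact mul_le_mul (abs_om_le δ) bφ (apply_nonneg _ _) (norm_nonneg _)
  have c2 : l2 n (Param.om θ₀ • gγ) ≤ |Param.om θ₀| * (r * (r * ‖δ‖)) := by
    rw [map_smul_eq_mul, Real.norm_eq_abs]; gcongr
  have c3 : l2 n (Param.om θ₀ • gα) ≤ |Param.om θ₀| * (r * (r * ‖δ‖)) := by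
    rw [map_smul_eq_mul, Real.norm_eq_abs]; gcongr
  have c4 : l2 n (lag (Param.ga δ) * R1) ≤ r * ‖δ‖ * (s * B) := by
    refine (l2_lag_mul_le n _ _).trans ?_
    gcongr
  have c5 : l2 n (lag (Param.al δ) * R1) ≤ r * ‖δ‖ * (s * B) := by
    refine (l2_lag_mul_le n _ _).trans ?_
    gcongr
  have c6 : l2 n (lag (arCoeff θ₀) * R0) ≤ 2 * r * ‖δ‖ * B := by
    refine (l2_lag_mul_le n _ _).trans ?_
    calc _ ≤ 1 * l2 n R0 := by gcongr
      _ ≤ _ := by rwa [one_mul]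
  rw [hid]
  have t1 := map_sub_le_add (l2 n) ((-Param.om δ) • gφ + Param.om θ₀ • gγ + Param.om θ₀ • gα +
        lag (Param.ga δ) * R1 + lag (Param.al δ) * R1 + R0) (lag (arCoeff θ₀) * R0)
  have t2 := map_add_le_add (l2 n) ((-Param.om δ) • gφ + Param.om θ₀ • gγ + Param.om θ₀ • gα +
        lag (Param.ga δ) * R1 + lag (Param.al δ) * R1) R0
  have t3 := map_add_le_add (l2 n) ((-Param.om δ) • gφ + Param.om θ₀ • gγ + Param.om θ₀ • gα +
        lag (Param.ga δ) * R1) (lag (Param.al δ) * R1)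
  have t4 := map_add_le_add (l2 n) ((-Param.om δ) • gφ + Param.om θ₀ • gγ + Param.om θ₀ • gα)
    (lag (Param.ga δ) * R1)
  have t5 := map_add_le_add (l2 n) ((-Param.om δ) • gφ + Param.om θ₀ • gγ) (Param.om θ₀ • gα)
  have t6 := map_add_le_add (l2 n) ((-Param.om δ) • gφ) (Param.om θ₀ • gγ)
  have e1 : 0 ≤ r * ‖δ‖ * B := by positivity
  have e2 : 0 ≤ r ^ 2 * |Param.om θ₀| * ‖δ‖ * B := by positivity
  have e3 : 0 ≤ r * s * ‖δ‖ := by positivity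
  have e4 : 0 ≤ r * ‖δ‖ := by positivity
  linarith

/-- The weighted correlations of the score with `D`. -/
lemma exists_corr_score_le (θ₀ : Param p q) {ρ : ℝ} (hρ0 : 0 < ρ) (hρ1 : ρ < 1)
    (hρ : ρ⁻¹ ^ max p q * ∑ i, |arCoeff θ₀ i| < 1) :
    ∃ K : ℝ, 0 ≤ K ∧ ∀ (n : ℕ) (x h0 : ℤ → ℝ) (D : ℝ⟦X⟧) (δ : Param p q),
      corr n ρ D (score θ₀ x h0 δ) ≤ K * ‖δ‖ * (corr n ρ D geom + corr n ρ D (X * D) +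
        l2 n D * (l2 n (resid θ₀ x h0 - D) + initTotal p q x h0)) := by
  set r : ℝ := max (p : ℝ) q with hr
  have hr0 : 0 ≤ r := le_max_of_le_left (by positivity)
  set s := ∑ j, |Param.ga θ₀ j| + ∑ j, |Param.al θ₀ j| with hs
  have hs0 : 0 ≤ s := add_nonneg (sum_nonneg fun _ _ => abs_nonneg _)
    (sum_nonneg fun _ _ => abs_nonneg _)
  set f := ρ⁻¹ ^ max p q * ∑ i, |arCoeff θ₀ i| with hf
  set L := ρ⁻¹ ^ max p q with hL
  set u := (1 - ρ)⁻¹ with hu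
  have hu0 : 0 ≤ u := inv_nonneg.2 (by linarith)
  have hlam : 1 ≤ ρ⁻¹ := (one_le_inv₀ hρ0).2 hρ1.le
  have hL0 : 0 ≤ L := by positivity
  set a := ∑ j, |Param.al θ₀ j| with ha
  have ha0 : 0 ≤ a := sum_nonneg fun _ _ => abs_nonneg _
  set v := (1 - f)⁻¹ with hv
  have hv0 : 0 ≤ v := inv_nonneg.2 (by linarith)
  -- bounds by multiples of the total size `Z`
  set K1 := 1 + u with hK1
  set K2 := v * (|Param.om θ₀| + L * a * K1 + u * s) with hK2
  have hK10 : 0 ≤ K1 := by positivity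
  have hK20 : 0 ≤ K2 := by positivity
  refine ⟨1 + L * r * K2 + L * r * (ρ⁻¹ * K2 + K1) + 2 * r * u, by positivity,
    fun n x h0 D δ => ?_⟩
  set T := corr n ρ D with hT
  have hsh : ShiftBound T ρ⁻¹ := shiftBound_corr n hρ0 D
  set E := resid θ₀ x h0 with hE
  set H := ser (hSeq θ₀ x h0) with hH
  set B := initTotal p q x h0 with hB
  have hB0 : 0 ≤ B := initTotal_nonneg x h0
  set Z := T geom + T (X * D) + l2 n D * (l2 n (E - D) + B) with hZ
  have hl : ∀ V, T V ≤ u * (l2 n D * l2 n V) := fun V => corr_le_l2 n hρ0.le hρ1 D V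
  have n1 : 0 ≤ T geom := apply_nonneg _ _
  have n2 : 0 ≤ T (X * D) := apply_nonneg _ _
  have n3 : 0 ≤ l2 n D * l2 n (E - D) := by positivity
  have n4 : 0 ≤ l2 n D * B := by positivity
  have z1 : T geom ≤ Z := by rw [hZ, mul_add]; linarith
  have z2 : T (X * D) + l2 n D * l2 n (E - D) ≤ Z := by rw [hZ, mul_add]; linarith
  have z3 : l2 n D * B ≤ Z := by rw [hZ, mul_add]; linarith
  have hZ0 : 0 ≤ Z := n1.trans z1
  -- Only the lagged residuals can be bounded by `Z`, since `T D` contains `⟨D, D⟩`.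
  have kE : T (X * E) ≤ K1 * Z := by
    have e1 : X * E = X * D + X * (E - D) := by ring
    have e2 := map_add_le_add T (X * D) (X * (E - D))
    have e3 : T (X * (E - D)) ≤ u * (l2 n D * l2 n (E - D)) :=
      (hl _).trans (by gcongr; exact l2_X_mul_le _ _)
    have e4 : l2 n D * l2 n (E - D) ≤ Z := by linarith
    have e5 : u * (l2 n D * l2 n (E - D)) ≤ u * Z := by gcongr
    rw [e1, hK1]
    linarith
  -- The filter `φ_{θ₀}(B)` is inverted in the seminorm `T`; this is where `ρ⁻¹ ^ max p q * ∑
  -- |arCoeff θ₀ i| < 1` is used.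
  have kH : T H ≤ K2 * Z := by
    set R1 := (H - lag (arCoeff θ₀) * H) - (Param.om θ₀ • geom + lag (Param.al θ₀) * E) with hR1
    have e1 : (1 : ℝ) • H - lag (arCoeff θ₀) * H =
        Param.om θ₀ • geom + lag (Param.al θ₀) * E + R1 := by rw [one_smul, hR1]; ring
    have e2 := hsh.filter_le hlam (arCoeff θ₀) zero_le_one e1
    have b1 : l2 n R1 ≤ s * B := l2_filter_hSeq_sub n θ₀ x h0
    have e3 : T R1 ≤ u * s * Z := by
      refine (hl _).trans ?_
      calc u * (l2 n D * l2 n R1) ≤ u * (l2 n D * (s * B)) := by gcongr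
        _ = u * s * (l2 n D * B) := by ring
        _ ≤ _ := by gcongr
    have e4 : T (lag (Param.al θ₀) * E) ≤ L * a * (K1 * Z) :=
      (hsh.lag_mul_le_shift hlam _ _).trans (by gcongr)
    have e5 : T (Param.om θ₀ • geom) ≤ |Param.om θ₀| * Z := by
      rw [map_smul_eq_mul, Real.norm_eq_abs]; gcongr
    have e6 := map_add_le_add T (Param.om θ₀ • geom + lag (Param.al θ₀) * E) R1
    have e7 := map_add_le_add T (Param.om θ₀ • geom) (lag (Param.al θ₀) * E)
    have e8 : (1 - f) * T H ≤ (|Param.om θ₀| + L * a * K1 + u * s) * Z := by linarith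
    rw [hK2, mul_assoc, hv, inv_mul_eq_div, le_div_iff₀ (by linarith), mul_comm]
    exact e8
  set R0 := score θ₀ x h0 δ - (Param.om δ • geom + lag (Param.ga δ) * H + lag (Param.al δ) * ser x)
    with hR0
  have b0 : l2 n R0 ≤ 2 * r * ‖δ‖ * B := by
    have := l2_score_sub n θ₀ x h0 δ
    simpa [hr] using this
  have k0 : T R0 ≤ 2 * r * u * ‖δ‖ * Z := by
    refine (hl _).trans ?_
    calc u * (l2 n D * l2 n R0) ≤ u * (l2 n D * (2 * r * ‖δ‖ * B)) := by gcongr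
      _ = 2 * r * u * ‖δ‖ * (l2 n D * B) := by ring
      _ ≤ _ := by gcongr
  have dγ : ∑ j, |Param.ga δ j| ≤ r * ‖δ‖ := by simpa [hr] using sum_abs_ga_le δ
  have dα : ∑ j, |Param.al δ j| ≤ r * ‖δ‖ := by simpa [hr] using sum_abs_al_le δ
  have k1 : T (lag (Param.ga δ) * H) ≤ L * (r * ‖δ‖) * (K2 * Z) := by
    refine (hsh.lag_mul_le hlam _ _).trans ?_
    have : ρ⁻¹ ^ q ≤ L := pow_le_pow_right₀ hlam (le_max_right _ _)
    gcongr
  have kx : T (X * ser x) ≤ (ρ⁻¹ * K2 + K1) * Z := by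
    have e1 : X * ser x = X * H + X * E := by rw [hE, resid]; ring
    have e2 := map_add_le_add T (X * H) (X * E)
    have e3 : T (X * H) ≤ ρ⁻¹ * (K2 * Z) := (hsh H).trans (by gcongr)
    rw [e1]; linarith
  have k2 : T (lag (Param.al δ) * ser x) ≤ L * (r * ‖δ‖) * ((ρ⁻¹ * K2 + K1) * Z) :=
    (hsh.lag_mul_le_shift hlam _ _).trans (by gcongr)
  have k3 : T (Param.om δ • geom) ≤ ‖δ‖ * Z := by
    rw [map_smul_eq_mul]
    exact mul_le_mul (abs_om_le δ) z1 n1 (norm_nonneg _)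
  have hS : score θ₀ x h0 δ = Param.om δ • geom + lag (Param.ga δ) * H +
      lag (Param.al δ) * ser x + R0 := by rw [hR0]; ring
  rw [hS]
  have t1 := map_add_le_add T (Param.om δ • geom + lag (Param.ga δ) * H +
      lag (Param.al δ) * ser x) R0
  have t2 := map_add_le_add T (Param.om δ • geom + lag (Param.ga δ) * H) (lag (Param.al δ) * ser x)
  have t3 := map_add_le_add T (Param.om δ • geom) (lag (Param.ga δ) * H)
  linarith

lemma coe_mul_eq_sum {P : Polynomial ℝ} {m : ℕ} (hP : P.natDegree < m) (U : ℝ⟦X⟧) :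
    (P : ℝ⟦X⟧) * U = ∑ l : Fin m, P.coeff l • (X ^ (l : ℕ) * U) := by
  rw [Fin.sum_univ_eq_sum_range (fun l => P.coeff l • (X ^ l * U)) m]
  conv_lhs => rw [P.as_sum_range' m hP]
  rw [← Polynomial.coeToPowerSeries.ringHom_apply, map_sum, sum_mul]
  refine sum_congr rfl fun l _ => ?_
  rw [← Polynomial.C_mul_X_pow_eq_monomial]
  simp [Polynomial.coeToPowerSeries.ringHom_apply, smul_eq_C_mul, mul_assoc]

end DRBeta

/-! ### Nondegeneracy of the score and the basic inequality. -/

namespace DRBeta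

open PowerSeries Finset

variable {p q : ℕ}

/-- This bounds the cost of replacing the residuals by `D` in the moving average. -/
lemma exists_l2_maPoly_mul_le (θ₀ : Param p q) : ∃ K : ℝ, 0 ≤ K ∧ ∀ (n : ℕ) (δ : Param p q)
    (V : ℝ⟦X⟧), l2 n ((maPoly θ₀ δ : ℝ⟦X⟧) * V) ≤ K * ‖δ‖ * l2 n V := by
  set r : ℝ := max (p : ℝ) q with hr
  have hr0 : 0 ≤ r := le_max_of_le_left (by positivity)
  set g := ∑ j, |Param.ga θ₀ j| with hg
  have hg0 : 0 ≤ g := sum_nonneg fun _ _ => abs_nonneg _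
  set a := ∑ j, |Param.al θ₀ j| with ha
  have ha0 : 0 ≤ a := sum_nonneg fun _ _ => abs_nonneg _
  refine ⟨r * (a + 1 + g), by positivity, fun n δ V => ?_⟩
  have dγ : ∑ j, |Param.ga δ j| ≤ r * ‖δ‖ := by simpa [hr] using sum_abs_ga_le δ
  have dα : ∑ j, |Param.al δ j| ≤ r * ‖δ‖ := by simpa [hr] using sum_abs_al_le δ
  have h2 : (maPoly θ₀ δ : ℝ⟦X⟧) * V = lag (Param.ga δ) * (lag (Param.al θ₀) * V) +
      lag (Param.al δ) * (V - lag (Param.ga θ₀) * V) := by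
    simp only [maPoly, Polynomial.coe_add, Polynomial.coe_mul, Polynomial.coe_sub,
      Polynomial.coe_one, coe_lagPoly]
    ring
  have c1 := l2_lag_mul_le n (Param.al θ₀) V
  have c2 := map_sub_le_add (l2 n) V (lag (Param.ga θ₀) * V)
  have c3 := l2_lag_mul_le n (Param.ga θ₀) V
  have c4 : l2 n (V - lag (Param.ga θ₀) * V) ≤ (1 + g) * l2 n V := by linarith
  have c5 : l2 n (lag (Param.ga δ) * (lag (Param.al θ₀) * V)) ≤ r * ‖δ‖ * (a * l2 n V) :=
    (l2_lag_mul_le n _ _).trans (by gcongr)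
  have c6 : l2 n (lag (Param.al δ) * (V - lag (Param.ga θ₀) * V)) ≤
      r * ‖δ‖ * ((1 + g) * l2 n V) := (l2_lag_mul_le n _ _).trans (by gcongr)
  rw [h2]
  refine (map_add_le_add (l2 n) _ _).trans ((add_le_add c5 c6).trans (le_of_eq ?_))
  ring

/-- Nondegeneracy: a lower bound on the score when the lags of `D` and the constant are
nearly orthogonal. -/
lemma exists_l2_score_ge {θ₀ : Param p q}
    (hcop : IsCoprime (1 - lagPoly (Param.ga θ₀)) (lagPoly (Param.al θ₀)))
    (horder : HasFullOrder θ₀)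
    (hφ : ∑ i, |arCoeff θ₀ i| < 1) :
    ∃ c K : ℝ, 0 < c ∧ 0 ≤ K ∧ ∀ (n : ℕ) (x h0 : ℤ → ℝ) (D : ℝ⟦X⟧) (δ : Param p q) (μ τ : ℝ),
      0 ≤ μ → 0 ≤ τ → μ ≤ n → (∀ l < 2 * max p q + 1, μ ≤ l2 n (X ^ l * D) ^ 2) →
      (∀ l < 2 * max p q + 1, |ip n (X ^ l * D) geom| ≤ τ) →
      (∀ l < 2 * max p q + 1, ∀ k < l, |ip n (X ^ l * D) (X ^ k * D)| ≤ τ) →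
      2 * (τ * ((2 * max p q + 2 : ℕ) : ℝ)) ≤ μ →
      c * √μ * ‖δ‖ ≤ l2 n (score θ₀ x h0 δ) +
        K * ‖δ‖ * (1 + l2 n (resid θ₀ x h0 - D) + initTotal p q x h0) := by
  obtain ⟨c0, hc0, hc⟩ := exists_le_maMap hcop horder hφ
  obtain ⟨K1, hK1, h1⟩ := exists_l2_filter_score_sub_le θ₀ hφ.le
  obtain ⟨K2, hK2, h2⟩ := exists_l2_maPoly_mul_le θ₀
  refine ⟨√(c0 / 2) / 2, K1 + K2, by positivity, by positivity,
    fun n x h0 D δ μ τ hμ hτ hμn hdiag hgeom hoff hτμ => ?_⟩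
  set S := score θ₀ x h0 δ with hS
  set E := resid θ₀ x h0 with hE
  set B := initTotal p q x h0 with hB
  have hB0 : 0 ≤ B := initTotal_nonneg x h0
  set u : Option (Fin (2 * max p q + 1)) → ℝ⟦X⟧ :=
    fun o => o.elim geom fun l => X ^ (l : ℕ) * D with hu
  set Q := maConst θ₀ δ • geom + (maPoly θ₀ δ : ℝ⟦X⟧) * D with hQ
  have hQu : Q = ∑ o, maMap θ₀ δ o • u o := by
    rw [Fintype.sum_option, hQ, coe_mul_eq_sum (natDegree_maPoly_lt θ₀ δ)]
    rfl
  -- There are `2 * max p q + 2` vectors, the constant and the lags, so the off-diagonal part costs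
  -- at most half of `μ`.
  have hQge : μ / 2 * (c0 * ‖δ‖ ^ 2) ≤ l2 n Q ^ 2 := by
    rw [hQu]
    refine le_trans ?_ (l2_sum_sq_ge n u (maMap θ₀ δ) (μ := μ) hτ ?_ ?_)
    · have h3 : μ / 2 ≤ μ - τ * (Fintype.card (Option (Fin (2 * max p q + 1))) : ℝ) := by
        simp only [Fintype.card_option, Fintype.card_fin]
        linarith
      exact mul_le_mul h3 (hc δ) (by positivity) (by linarith)
    · rintro (_ | l)
      · simpa [hu, l2_geom_sq] using hμn
      · exact hdiag l l.2
    · rintro (_ | l) (_ | k) hlk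
      · exact absurd rfl hlk
      · rw [ip_comm]; exact hgeom k k.2
      · exact hgeom l l.2
      · rcases lt_trichotomy (k : ℕ) l with h | h | h
        · exact hoff l l.2 k h
        · exact absurd (congrArg some (Fin.ext h.symm)) hlk
        · rw [ip_comm]; exact hoff k k.2 l h
  have hQge' : √(c0 / 2) * √μ * ‖δ‖ ≤ l2 n Q := by
    refine (sq_le_sq₀ (by positivity) (apply_nonneg _ _)).1 ?_
    rw [mul_pow, mul_pow, Real.sq_sqrt (by positivity), Real.sq_sqrt hμ]
    linarith
  have h3 : Q = (S - lag (arCoeff θ₀) * S) - ((S - lag (arCoeff θ₀) * S) -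
      (maConst θ₀ δ • geom + (maPoly θ₀ δ : ℝ⟦X⟧) * E)) - (maPoly θ₀ δ : ℝ⟦X⟧) * (E - D) := by
    rw [hQ]; ring
  have h4 := map_sub_le_add (l2 n) ((S - lag (arCoeff θ₀) * S) - ((S - lag (arCoeff θ₀) * S) -
      (maConst θ₀ δ • geom + (maPoly θ₀ δ : ℝ⟦X⟧) * E))) ((maPoly θ₀ δ : ℝ⟦X⟧) * (E - D))
  have h5 := map_sub_le_add (l2 n) (S - lag (arCoeff θ₀) * S) ((S - lag (arCoeff θ₀) * S) -
      (maConst θ₀ δ • geom + (maPoly θ₀ δ : ℝ⟦X⟧) * E))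
  rw [← h3] at h4
  have h6 := h1 n x h0 δ
  have h7 := h2 n δ (E - D)
  have h8 := map_sub_le_add (l2 n) S (lag (arCoeff θ₀) * S)
  have h9 : l2 n (lag (arCoeff θ₀) * S) ≤ l2 n S := by
    refine (l2_lag_mul_le n _ _).trans ?_
    exact mul_le_of_le_one_left (apply_nonneg _ _) hφ.le
  have e1 : 0 ≤ K1 * ‖δ‖ * l2 n (E - D) := by positivity
  have e2 : 0 ≤ K2 * ‖δ‖ * (1 + B) := by positivity
  have e3 : 0 ≤ K1 * ‖δ‖ * (1 + B) := by positivity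
  have e4 : 0 ≤ K2 * ‖δ‖ * l2 n (E - D) := by positivity
  linarith

/-- The basic inequality for a parameter at which the sum of squares is not larger than at the
true parameter; `η` regularizes filters close to the boundary of invertibility. -/
lemma basic_inequality (n : ℕ) {r : ℕ} (a : Fin r → ℝ) (ha : ∑ j, |a j| ≤ 1) {W E D S : ℝ⟦X⟧}
    (hWE : l2 n W ≤ l2 n E) (hS : (W - E) - lag a * (W - E) = S)
    {η : ℝ} (hη0 : 0 ≤ η) (hη1 : η ≤ 1) {ρ : ℝ} (hρ0 : 0 < ρ) (hρ1 : ρ < 1) {κ : ℝ} (hκ : 0 < κ)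
    (hκρ : κ ≤ 1 + η - ρ⁻¹ ^ r * ∑ j, |a j|) :
    l2 n S ^ 2 ≤ 18 * (4 * (κ⁻¹ * (2 * corr n ρ D S + η * ρ⁻¹ ^ r * corr n ρ D (X * E))) +
      4 * l2 n (E - D) ^ 2 + 6 * η * l2 n E ^ 2) + 2 * η * l2 n E ^ 2 := by
  obtain ⟨Y, hY, hYW⟩ := exists_resolvent n a ha hη0 W
  -- For `η = 0` the equation for `F` is that of `W - E`. For `η > 0`, `F` solves an equation with
  -- the uniformly invertible filter `1 + η - a`, and `E + F = (1 + η) • Y` still has norm at most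
  -- `(1 + η) ‖E‖` by the resolvent contraction.
  set F := (1 + η) • Y - E with hF
  set U := (1 + η) • S - η • (lag a * E) with hU
  have hFU : (1 + η) • F - lag a * F = U := by
    rw [hF, hU, ← hS]
    simp only [smul_eq_C_mul, map_add, map_one] at hY ⊢
    linear_combination (1 + C η) * hY
  have hlam : 1 ≤ ρ⁻¹ := (one_le_inv₀ hρ0).2 hρ1.le
  set T := corr n ρ D with hT
  have hsh : ShiftBound T ρ⁻¹ := shiftBound_corr n hρ0 D
  have hTU : T U ≤ 2 * T S + η * ρ⁻¹ ^ r * T (X * E) := by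
    refine (map_sub_le_add T _ _).trans (add_le_add ?_ ?_)
    · rw [map_smul_eq_mul, Real.norm_of_nonneg (by linarith)]
      have := apply_nonneg T S
      gcongr; linarith
    · rw [map_smul_eq_mul, Real.norm_of_nonneg hη0, mul_assoc]
      have h1 := hsh.lag_mul_le_shift hlam a E
      have h2 : ρ⁻¹ ^ r * ∑ j, |a j| ≤ ρ⁻¹ ^ r := mul_le_of_le_one_right (by positivity) ha
      gcongr
      exact h1.trans (by gcongr)
  have hTF : T F ≤ κ⁻¹ * (2 * T S + η * ρ⁻¹ ^ r * T (X * E)) := by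
    have h1 := hsh.filter_le hlam a (by linarith : 0 ≤ 1 + η) hFU
    have h2 := mul_le_mul_of_nonneg_right hκρ (apply_nonneg T F)
    rw [inv_mul_eq_div, le_div_iff₀ hκ]
    linarith
  set e := l2 n E with he
  set d := l2 n (E - D) with hd
  set f := l2 n F with hf
  have he0 : 0 ≤ e := apply_nonneg _ _
  have hd0 : 0 ≤ d := apply_nonneg _ _
  have hf0 : 0 ≤ f := apply_nonneg _ _
  have h1 : l2 n (E + F) ≤ (1 + η) * e := by
    have : E + F = (1 + η) • Y := by rw [hF]; ring
    rw [this, map_smul_eq_mul, Real.norm_of_nonneg (by linarith)]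
    have := hYW.trans hWE
    gcongr
  have h2 : l2 n (E + F) ^ 2 ≤ ((1 + η) * e) ^ 2 := by gcongr
  rw [l2_add_sq] at h2
  have h3 : -ip n E F ≤ T F + d * f := by
    have e1 : ip n E F = ip n D F + ip n (E - D) F := by
      rw [ip_comm n E, ip_comm n D, ip_comm n (E - D), ip_sub_right]; ring
    have e2 := (abs_le.1 (abs_ip_le_corr (n := n) hρ0.le D F)).1
    have e3 := (abs_le.1 (abs_ip_le n (E - D) F)).1
    rw [e1]; linarith
  -- Expanding `‖E + F‖² ≤ (1 + η)² ‖E‖²` gives `f² ≤ 3 η e² + 2 T F + 2 d f`, and `2 d f ≤ 2 d² +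
  -- f² / 2` is absorbed.
  have h4 : f ^ 2 ≤ 4 * T F + 4 * d ^ 2 + 6 * η * e ^ 2 := by
    have e1 : η ^ 2 * e ^ 2 ≤ η * e ^ 2 := by
      gcongr; nlinarith
    nlinarith [sq_nonneg (2 * d - f)]
  have h5 : l2 n U ≤ 3 * f := by
    refine (l2_filter_le n a (by linarith) hFU).trans ?_
    gcongr; linarith
  have h6 : l2 n S ≤ 3 * f + η * e := by
    have e1 : (1 + η) • S = U + η • (lag a * E) := by rw [hU]; ring
    have e2 := map_add_le_add (l2 n) U (η • (lag a * E))
    rw [← e1, map_smul_eq_mul, map_smul_eq_mul, Real.norm_of_nonneg (by linarith),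
      Real.norm_of_nonneg hη0] at e2
    have e3 : l2 n (lag a * E) ≤ e :=
      (l2_lag_mul_le n a E).trans (mul_le_of_le_one_left he0 ha)
    have e4 : η * l2 n (lag a * E) ≤ η * e := by gcongr
    nlinarith [apply_nonneg (l2 n) S]
  have h7 : l2 n S ^ 2 ≤ (3 * f + η * e) ^ 2 := by
    have := apply_nonneg (l2 n) S
    gcongr
  have h8 : η ^ 2 * e ^ 2 ≤ η * e ^ 2 := by
    gcongr; nlinarith
  nlinarith [sq_nonneg (3 * f - η * e)]

/-- The deterministic part of the argument. -/
lemma exists_rate_inequality (θ₀ : Param p q) (K K₁ : ℝ) (hK : 0 ≤ K) (hK₁ : 0 ≤ K₁)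
    {ρ : ℝ} (hρ0 : 0 < ρ) (hρ1 : ρ < 1)
    (hρ : ρ⁻¹ ^ max p q * ∑ i, |arCoeff θ₀ i| < 1) {κ : ℝ} (hκ : 0 < κ) :
    ∃ M : ℝ, 0 ≤ M ∧ ∀ (n : ℕ) (x h0 : ℤ → ℝ) (D : ℝ⟦X⟧) (a c : ℝ), 0 < n → 0 ≤ c → a ≤ 1 →
      1 ≤ √n * a → l2 n D ≤ K * √n → corr n ρ D geom ≤ K₁ * √n → corr n ρ D (X * D) ≤ K₁ * √n →
      l2 n (resid θ₀ x h0 - D) ≤ K * √n * a → initTotal p q x h0 ≤ K →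
      (∀ δ, c * √n * ‖δ‖ ≤ l2 n (score θ₀ x h0 δ)) →
      ∀ (θ : Param p q) (η : ℝ), 0 ≤ η → η ≤ 1 → ∑ j, |Param.ga θ j| ≤ 1 →
      κ ≤ 1 + η - ρ⁻¹ ^ q * ∑ j, |Param.ga θ j| →
      l2 n (resid θ x h0) ≤ l2 n (resid θ₀ x h0) →
      c ^ 2 * ‖θ - θ₀‖ ^ 2 ≤ M * a * (‖θ - θ₀‖ + η + a) + 440 * K ^ 2 * η := by
  obtain ⟨K₂, hK₂, hscore⟩ := exists_corr_score_le θ₀ hρ0 hρ1 hρ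
  set A := K₂ * (2 * K₁ + 2 * K ^ 2) with hA
  set L := ρ⁻¹ ^ q with hL
  set u := (1 - ρ)⁻¹ with hu
  have hu0 : 0 ≤ u := inv_nonneg.2 (by linarith)
  have hL0 : 0 ≤ L := by positivity
  set A' := L * (K₁ + u * K ^ 2) with hA'
  have hA0 : 0 ≤ A := by positivity
  have hA'0 : 0 ≤ A' := by positivity
  -- With `‖E‖² ≤ 4 K² n` in the basic inequality, `72 = 18 · 4` and `440 = 18 · 6 · 4 + 2 · 4`.
  refine ⟨72 * κ⁻¹ * (2 * A + A') + 72 * K ^ 2, by positivity,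
    fun n x h0 D a c hn hc ha1 hsa hD hgeom hXD hd hB hcS θ η hη0 hη1 hγ hκθ hle => ?_⟩
  set s := √(n : ℝ) with hs
  have hs0 : 0 < s := Real.sqrt_pos.2 (by exact_mod_cast hn)
  have ha0 : 0 ≤ a := by
    by_contra! h
    nlinarith
  set E := resid θ₀ x h0 with hE
  have hbasic := basic_inequality n (Param.ga θ) hγ (D := D) hle (filter_resid_sub θ₀ θ x h0)
    hη0 hη1 hρ0 hρ1 hκ hκθ
  set δ := θ₀ - θ with hδ
  have hnorm : ‖θ - θ₀‖ = ‖δ‖ := norm_sub_rev _ _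
  rw [hnorm]
  set S := score θ₀ x h0 δ with hS
  -- Since `1 ≤ √n a`, terms of order `√n` are absorbed into `n a`.
  have hss : s ≤ s ^ 2 * a := by nlinarith
  have hB0 : 0 ≤ initTotal p q x h0 := initTotal_nonneg x h0
  have hld : l2 n D * (l2 n (E - D) + initTotal p q x h0) ≤ 2 * K ^ 2 * (s ^ 2 * a) := by
    calc _ ≤ (K * s) * (K * s * a + K) := by gcongr
      _ = K ^ 2 * (s ^ 2 * a) + K ^ 2 * s := by ring
      _ ≤ K ^ 2 * (s ^ 2 * a) + K ^ 2 * (s ^ 2 * a) := by gcongr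
      _ = _ := by ring
  have h1 : corr n ρ D S ≤ A * ‖δ‖ * (s ^ 2 * a) := by
    refine (hscore n x h0 D δ).trans ?_
    calc _ ≤ K₂ * ‖δ‖ * (K₁ * s + K₁ * s + 2 * K ^ 2 * (s ^ 2 * a)) := by gcongr
      _ ≤ K₂ * ‖δ‖ * (K₁ * (s ^ 2 * a) + K₁ * (s ^ 2 * a) + 2 * K ^ 2 * (s ^ 2 * a)) := by gcongr
      _ = _ := by rw [hA]; ring
  have h2 : L * corr n ρ D (X * E) ≤ A' * (s ^ 2 * a) := by
    have e1 : X * E = X * D + X * (E - D) := by ring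
    have e2 := map_add_le_add (corr n ρ D) (X * D) (X * (E - D))
    have e3 : corr n ρ D (X * (E - D)) ≤ u * (K * s * (K * s * a)) := by
      refine (corr_le_l2 n hρ0.le hρ1 D _).trans ?_
      have := (l2_X_mul_le n (E - D)).trans hd
      gcongr
    have e4 : corr n ρ D (X * E) ≤ (K₁ + u * K ^ 2) * (s ^ 2 * a) := by
      rw [e1]
      have : K₁ * s ≤ K₁ * (s ^ 2 * a) := by gcongr
      linarith
    calc _ ≤ L * ((K₁ + u * K ^ 2) * (s ^ 2 * a)) := by gcongr
      _ = _ := by rw [hA']; ring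
  have h3 : l2 n (E - D) ^ 2 ≤ K ^ 2 * a ^ 2 * s ^ 2 := by
    have : l2 n (E - D) ^ 2 ≤ (K * s * a) ^ 2 := by gcongr
    linarith
  have h4 : l2 n E ^ 2 ≤ 4 * K ^ 2 * s ^ 2 := by
    have e1 : E = D + (E - D) := by ring
    have e2 := map_add_le_add (l2 n) D (E - D)
    rw [← e1] at e2
    have e3 : K * s * a ≤ K * s := mul_le_of_le_one_right (by positivity) ha1
    have e4 : l2 n E ≤ 2 * K * s := by linarith
    have : l2 n E ^ 2 ≤ (2 * K * s) ^ 2 := by gcongr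
    linarith
  have h5 : (c * s * ‖δ‖) ^ 2 ≤ l2 n S ^ 2 := by
    have := hcS δ
    gcongr
  have h6 : κ⁻¹ * (2 * corr n ρ D S + η * L * corr n ρ D (X * E)) ≤
      κ⁻¹ * (2 * (A * ‖δ‖ * (s ^ 2 * a)) + η * (A' * (s ^ 2 * a))) := by
    rw [mul_assoc]
    gcongr
  have h7 : η * l2 n E ^ 2 ≤ η * (4 * K ^ 2 * s ^ 2) := by gcongr
  have h8 : s ^ 2 * (c ^ 2 * ‖δ‖ ^ 2) ≤ s ^ 2 * ((72 * κ⁻¹ * (2 * A * ‖δ‖ + A' * η) +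
      72 * K ^ 2 * a) * a + 440 * K ^ 2 * η) := by
    linarith
  refine (le_of_mul_le_mul_left h8 (by positivity)).trans ?_
  have hκ0 : 0 ≤ κ⁻¹ := by positivity
  have e1 : 0 ≤ κ⁻¹ * A * a * η := by positivity
  have e2 : 0 ≤ κ⁻¹ * A * a * a := by positivity
  have e3 : 0 ≤ κ⁻¹ * A' * a * ‖δ‖ := by positivity
  have e4 : 0 ≤ κ⁻¹ * A' * a * a := by positivity
  have e5 : 0 ≤ K ^ 2 * a * ‖δ‖ := by positivity
  have e6 : 0 ≤ K ^ 2 * a * η := by positivity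
  linarith

end DRBeta

/-! ### Existence of a maximizer and the deterministic bound for the estimator. -/

namespace DRBeta

open PowerSeries Finset Topology

variable {p q : ℕ}

lemma continuous_hSeq (x h0 : ℤ → ℝ) (i : ℤ) : Continuous fun θ : Param p q => hSeq θ x h0 i := by
  induction hk : i.toNat using Nat.strong_induction_on generalizing i with
  | _ k ih =>
    rcases le_or_gt i 0 with hi | hi
    · simp only [hSeq_of_nonpos _ _ _ hi]; exact continuous_const
    · simp only [hSeq_of_pos _ _ _ hi]
      have h1 : ∀ j : Fin q, Continuous fun θ : Param p q => hSeq θ x h0 (i - ((j : ℤ) + 1)) :=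
        fun j => ih _ (by omega) _ rfl
      unfold Param.om Param.ga Param.al
      fun_prop

lemma continuous_quasiLik (n : ℕ) (x h0 : ℤ → ℝ) :
    Continuous (quasiLik n x h0 : Param p q → ℝ) := by
  have := continuous_hSeq (p := p) (q := q) x h0
  unfold quasiLik
  fun_prop

lemma isOpen_paramSpace (ωl ωu γl γu αl αu : ℝ) :
    IsOpen (paramSpace p q ωl ωu γl γu αl αu) := by
  have h1 : ∀ i, Continuous fun θ : Param p q => arCoeff θ i := fun i => by
    unfold arCoeff
    unfold Param.ga Param.al
    split_ifs <;> fun_prop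
  unfold paramSpace
  simp only [Set.ofPred_and, Set.ofPred_forall]
  refine (IsOpen.inter ?_ ?_).inter (IsOpen.inter ?_ (IsOpen.inter ?_ (IsOpen.inter ?_ ?_)))
  · exact isOpen_lt (by fun_prop) (by fun_prop)
  · exact isOpen_lt (by fun_prop) (by fun_prop)
  · exact isOpen_iInter_of_finite fun i =>
      (isOpen_lt (by fun_prop) (by fun_prop)).inter (isOpen_lt (by fun_prop) (by fun_prop))
  · exact isOpen_iInter_of_finite fun i =>
      (isOpen_lt (by fun_prop) (by fun_prop)).inter (isOpen_lt (by fun_prop) (by fun_prop))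
  · unfold Param.ga; exact isOpen_lt (by fun_prop) (by fun_prop)
  · exact isOpen_lt (by fun_prop) (by fun_prop)

lemma quasiLik_le_iff {n : ℕ} (hn : 0 < n) (x h0 : ℤ → ℝ) (θ θ' : Param p q) :
    quasiLik n x h0 θ ≤ quasiLik n x h0 θ' ↔
      l2 n (resid θ' x h0) ≤ l2 n (resid θ x h0) := by
  have hn' : (0 : ℝ) < 1 / n := by positivity
  rw [quasiLik_eq, quasiLik_eq, neg_le_neg_iff, mul_le_mul_iff_right₀ hn',
    sq_le_sq₀ (apply_nonneg _ _) (apply_nonneg _ _)]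

/-- If every parameter that is at least as good as `θ₀` is close to `θ₀`, a maximizer exists. -/
lemma IsQMLE.mem_and_le {Θ : Set (Param p q)} {n : ℕ} (hn : 0 < n) {x h0 : ℤ → ℝ}
    {θhat θ₀ : Param p q} (h : IsQMLE Θ n x h0 θhat) {δ₀ : ℝ} (hδ : 0 ≤ δ₀)
    (hball : Metric.closedBall θ₀ δ₀ ⊆ Θ)
    (hclose : ∀ θ ∈ Θ, l2 n (resid θ x h0) ≤ l2 n (resid θ₀ x h0) → ‖θ - θ₀‖ ≤ δ₀) :
    θhat ∈ Θ ∧ l2 n (resid θhat x h0) ≤ l2 n (resid θ₀ x h0) := by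
  have hmem : θ₀ ∈ Metric.closedBall θ₀ δ₀ := Metric.mem_closedBall_self hδ
  -- The maximum over the compact ball is global on `Θ`: outside the ball every value is below that
  -- at `θ₀`, which lies in the ball.
  obtain ⟨θ, hθ, hmax⟩ := (isCompact_closedBall θ₀ δ₀).exists_isMaxOn ⟨θ₀, hmem⟩
    (continuous_quasiLik n x h0).continuousOn
  obtain ⟨h1, h2⟩ := h ⟨θ, hball hθ, fun θ' hθ' => by
    by_cases hle : l2 n (resid θ' x h0) ≤ l2 n (resid θ₀ x h0)
    · exact hmax (by simpa [dist_eq_norm] using hclose θ' hθ' hle)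
    · have h3 : quasiLik n x h0 θ' ≤ quasiLik n x h0 θ₀ :=
        (quasiLik_le_iff hn _ _ _ _).2 (not_le.1 hle).le
      exact h3.trans (hmax hmem)⟩
  exact ⟨h1, (quasiLik_le_iff hn _ _ _ _).1 (h2 (hball hmem))⟩

lemma sum_abs_ga_le_add (θ θ₀ : Param p q) :
    ∑ j, |Param.ga θ j| ≤ ∑ j, |Param.ga θ₀ j| + max p q * ‖θ - θ₀‖ := by
  refine le_trans ?_ (add_le_add_right (sum_abs_ga_le (θ - θ₀)) _)
  rw [← sum_add_distrib]
  refine sum_le_sum fun j _ => ?_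
  have : Param.ga θ j = Param.ga θ₀ j + Param.ga (θ - θ₀) j := by
    simp [Param.ga]
  rw [this]; exact abs_add_le _ _

/-- The last three inequalities are strict at `ρ = 1` and continuous there, so they persist slightly
to the left of `1`. They serve, in order, the filter `φ_{θ₀}`, the filters `1 - γ_θ` near `θ₀`, and
the regularized filters on all of `Θ`. -/
lemma exists_weight (r q : ℕ) {f g η : ℝ} (hf : f < 1) (hg : g < 1) (hη : 0 < η) :
    ∃ ρ : ℝ, 0 < ρ ∧ ρ < 1 ∧ ρ⁻¹ ^ r * f < 1 ∧ ρ⁻¹ ^ q * g < (1 + g) / 2 ∧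
      ρ⁻¹ ^ q < 1 + η / 2 := by
  have ht : ∀ k : ℕ, Tendsto (fun ρ : ℝ => ρ⁻¹ ^ k) (𝓝[<] 1) (𝓝 1) := fun k => by
    have : ContinuousAt (fun ρ : ℝ => ρ⁻¹ ^ k) 1 :=
      (continuousAt_inv₀ one_ne_zero).pow k
    simpa using this.tendsto.mono_left nhdsWithin_le_nhds
  have h1 := ((ht r).mul_const f).eventually_lt_const (u := 1) (by linarith)
  have h2 := ((ht q).mul_const g).eventually_lt_const (u := (1 + g) / 2) (by linarith)
  have h3 := (ht q).eventually_lt_const (u := 1 + η / 2) (by linarith)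
  have h4 : ∀ᶠ ρ : ℝ in 𝓝[<] 1, 0 < ρ :=
    (eventually_gt_nhds zero_lt_one).filter_mono nhdsWithin_le_nhds
  have h5 : ∀ᶠ ρ : ℝ in 𝓝[<] 1, ρ < 1 := self_mem_nhdsWithin
  obtain ⟨ρ, a1, a2, a3, a4, a5⟩ := (h1.and (h2.and (h3.and (h4.and h5)))).exists
  exact ⟨ρ, a4, a5, a1, a2, a3⟩

/-- If `δ > a`, then `δ + a ≤ 2 δ` and one factor `δ` cancels. The summand `0` is the place of `η`.
-/
lemma le_of_quadratic {c M a δ : ℝ} (hc : 0 < c) (hM : 0 ≤ M) (ha : 0 ≤ a)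
    (h : c ^ 2 * δ ^ 2 ≤ M * a * (δ + 0 + a)) : δ ≤ (1 + 2 * M / c ^ 2) * a := by
  rcases le_or_gt δ a with h1 | h1
  · have : 0 ≤ 2 * M / c ^ 2 * a := by positivity
    linarith
  · have h2 : M * a * (δ + 0 + a) ≤ M * a * (2 * δ) := by gcongr; linarith
    have h3 : c ^ 2 * δ * δ ≤ 2 * M * a * δ := by linarith
    have h4 := le_of_mul_le_mul_right h3 (ha.trans_lt h1)
    have h5 : δ ≤ 2 * M / c ^ 2 * a := by
      rw [div_mul_eq_mul_div, le_div_iff₀ (by positivity)]; linarith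
    linarith

set_option maxHeartbeats 1000000 in
/-- The deterministic theorem: on the event that the innovations, the measurement errors and the
initial values behave regularly, the estimator is within a multiple of `a` of `θ₀`. -/
lemma exists_estimator_bound {ωl ωu γl γu αl αu : ℝ} {θ₀ : Param p q}
    (hθ₀ : θ₀ ∈ paramSpace p q ωl ωu γl γu αl αu)
    (hcop : IsCoprime (1 - lagPoly (Param.ga θ₀)) (lagPoly (Param.al θ₀)))
    (horder : HasFullOrder θ₀)
    {K μ : ℝ} (hK : 0 ≤ K) (hμ0 : 0 < μ) (hμ1 : μ ≤ 1) :
    ∃ ρ : ℝ, 0 < ρ ∧ ρ < 1 ∧ ∀ K₁ : ℝ, 0 ≤ K₁ → ∃ M a₀ : ℝ, 0 < M ∧ 0 < a₀ ∧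
      ∀ (n : ℕ) (x h0 : ℤ → ℝ) (D : ℝ⟦X⟧) (a : ℝ) (θhat : Param p q), 0 < n → a ≤ a₀ →
      1 ≤ √n * a → l2 n D ≤ K * √n → corr n ρ D geom ≤ K₁ * √n → corr n ρ D (X * D) ≤ K₁ * √n →
      (∀ l < 2 * max p q + 1, μ * n ≤ l2 n (X ^ l * D) ^ 2) →
      (∀ l < 2 * max p q + 1, |ip n (X ^ l * D) geom| ≤ K₁ * √n) →
      (∀ l < 2 * max p q + 1, ∀ k < l, |ip n (X ^ l * D) (X ^ k * D)| ≤ K₁ * √n) →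
      l2 n (resid θ₀ x h0 - D) ≤ K * √n * a → initTotal p q x h0 ≤ K →
      IsQMLE (paramSpace p q ωl ωu γl γu αl αu) n x h0 θhat → ‖θhat - θ₀‖ ≤ M * a := by
  have hφ : ∑ i, |arCoeff θ₀ i| < 1 := hθ₀.2.2.2.2
  set g := ∑ j, |Param.ga θ₀ j| with hg
  have hg1 : g < 1 := hθ₀.2.2.2.1
  have hg0 : 0 ≤ g := sum_nonneg fun _ _ => abs_nonneg _
  obtain ⟨c₁, K', hc₁, hK', hge⟩ := exists_l2_score_ge hcop horder hφ
  set c := c₁ * √μ / 2 with hc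
  have hc0 : 0 < c := by positivity
  obtain ⟨δ₁, hδ₁, hball₁⟩ := Metric.isOpen_iff.1 (isOpen_paramSpace ωl ωu γl γu αl αu) θ₀ hθ₀
  set g' := (1 + g) / 2 with hg'
  -- The first entry keeps the closed ball inside `Θ`; the second keeps `∑ |γ_j| ≤ (1 + g) / 2 < 1`
  -- on it.
  set δ₀ := min (δ₁ / 2) ((1 - g) / (2 * (max p q + 1))) with hδ₀
  have hδ₀pos : 0 < δ₀ := lt_min (by positivity) (div_pos (by linarith) (by positivity))
  have hball : Metric.closedBall θ₀ δ₀ ⊆ paramSpace p q ωl ωu γl γu αl αu :=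
    (Metric.closedBall_subset_ball ((min_le_left _ _).trans_lt (by linarith))).trans hball₁
  have hloc : ∀ θ : Param p q, ‖θ - θ₀‖ ≤ δ₀ → ∑ j, |Param.ga θ j| ≤ g' := fun θ hθ => by
    have h1 := sum_abs_ga_le_add θ θ₀
    have h2 : ‖θ - θ₀‖ ≤ (1 - g) / (2 * (max p q + 1)) := hθ.trans (min_le_right _ _)
    rw [le_div_iff₀ (by positivity)] at h2
    have := norm_nonneg (θ - θ₀)
    rw [hg']
    linarith
  -- The cost of the regularization is made at most a quarter of `c² δ₀²`, so it cannot account for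
  -- a distance larger than `δ₀`.
  obtain ⟨η, hη0, hη1, hη⟩ : ∃ η : ℝ, 0 < η ∧ η ≤ 1 ∧ 440 * K ^ 2 * η ≤ c ^ 2 * δ₀ ^ 2 / 4 := by
    refine ⟨min 1 (c ^ 2 * δ₀ ^ 2 / 4 / (440 * K ^ 2 + 1)), lt_min one_pos (by positivity),
      min_le_left _ _, ?_⟩
    have h1 := min_le_right 1 (c ^ 2 * δ₀ ^ 2 / 4 / (440 * K ^ 2 + 1))
    rw [le_div_iff₀ (by positivity)] at h1
    have h2 : 0 ≤ min 1 (c ^ 2 * δ₀ ^ 2 / 4 / (440 * K ^ 2 + 1)) := le_min zero_le_one (by positivity)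
    linarith
  obtain ⟨ρ, hρ0, hρ1, hρφ, hργ, hρη⟩ := exists_weight (max p q) q hφ (by linarith : g' < 1) hη0
  -- The weight `ρ` is fixed before `K₁`, because the stochastic bound `K₁` on `corr` depends on
  -- `ρ`.
  refine ⟨ρ, hρ0, hρ1, fun K₁ hK₁ => ?_⟩
  -- One `κ` for two passes: `η / 2` for the regularized global one, `(1 - g') / 2` for the local
  -- one with `η = 0`.
  set κ := min (η / 2) ((1 - g') / 2) with hκ
  have hκ0 : 0 < κ := lt_min (by linarith) (by linarith)
  obtain ⟨M, hM0, hM⟩ := exists_rate_inequality θ₀ K K₁ hK hK₁ hρ0 hρ1 hρφ hκ0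
  -- Chosen so that `t * (δ + 2) ≤ c² δ₀ δ / 4` whenever `δ ≥ δ₀`; the `2` bounds `η + a`.
  set t := c ^ 2 * δ₀ ^ 2 / (4 * (δ₀ + 2)) with ht
  have ht0 : 0 < t := by positivity
  have hμs : 0 < √μ := Real.sqrt_pos.2 hμ0
  set R : ℝ := ((2 * max p q + 2 : ℕ) : ℝ) with hR
  set a₀ := min (min 1 (t / (M + 1))) (min (c / (K' * (1 + 2 * K) + 1)) (μ / (2 * (K₁ * R) + 1)))
    with ha₀
  have ha₀pos : 0 < a₀ := by
    refine lt_min (lt_min one_pos (by positivity)) (lt_min (by positivity) (by positivity))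
  refine ⟨1 + 2 * M / c ^ 2, a₀, by positivity, ha₀pos,
    fun n x h0 D a θhat hn ha hsa hD hgeom hXD hdiag hipg hipo hd hB hqmle => ?_⟩
  have ha1 : a ≤ 1 := ha.trans ((min_le_left _ _).trans (min_le_left _ _))
  have hat : M * a ≤ t := by
    have h1 : a ≤ t / (M + 1) := ha.trans ((min_le_left _ _).trans (min_le_right _ _))
    have hs0 : 0 ≤ √(n : ℝ) := Real.sqrt_nonneg _
    have h0 : 0 ≤ a := by
      by_contra! h; nlinarith
    rw [le_div_iff₀ (by positivity)] at h1
    linarith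
  set s := √(n : ℝ) with hs
  have hs0 : 0 < s := Real.sqrt_pos.2 (by exact_mod_cast hn)
  have hss : s ^ 2 = n := Real.sq_sqrt (by positivity)
  have ha0 : 0 ≤ a := by
    by_contra! h
    nlinarith
  have hac : K' * (1 + 2 * K) * a ≤ c := by
    have h1 : a ≤ c / (K' * (1 + 2 * K) + 1) :=
      ha.trans ((min_le_right _ _).trans (min_le_left _ _))
    rw [le_div_iff₀ (by positivity)] at h1
    linarith
  have haμ : 2 * (K₁ * R) * a ≤ μ := by
    have h1 : a ≤ μ / (2 * (K₁ * R) + 1) := ha.trans ((min_le_right _ _).trans (min_le_right _ _))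
    rw [le_div_iff₀ (by positivity)] at h1
    linarith
  have hcS : ∀ δ, c * s * ‖δ‖ ≤ l2 n (score θ₀ x h0 δ) := fun δ => by
    have h1 := hge n x h0 D δ (μ * n) (K₁ * s) (by positivity) (by positivity)
      (mul_le_of_le_one_left (by positivity) hμ1) hdiag hipg hipo (by
        rw [← hss]
        have : 2 * (K₁ * R) * s ≤ 2 * (K₁ * R) * (s * (s * a)) := by
          gcongr; exact le_mul_of_one_le_right hs0.le hsa
        have h2 : 2 * (K₁ * R) * a * s ^ 2 ≤ μ * s ^ 2 := by gcongr
        linarith)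
    rw [Real.sqrt_mul hμ0.le] at h1
    have h2 : K' * ‖δ‖ * (1 + l2 n (resid θ₀ x h0 - D) + initTotal p q x h0) ≤
        c * s * ‖δ‖ := by
      calc _ ≤ K' * ‖δ‖ * (1 * (s * a) + K * s * a + K * (s * a)) := by
            have h3 : K ≤ K * (s * a) := le_mul_of_one_le_right hK hsa
            gcongr
            · linarith
            · linarith
        _ = K' * (1 + 2 * K) * a * (s * ‖δ‖) := by ring
        _ ≤ c * (s * ‖δ‖) := by gcongr
        _ = _ := by ring
    rw [hc] at h2 ⊢
    linarith
  -- Global consistency: were `‖θ - θ₀‖ > δ₀`, both terms on the right of the rate inequality would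
  -- be at most a quarter of the left side.
  have hglob : ∀ θ ∈ paramSpace p q ωl ωu γl γu αl αu,
      l2 n (resid θ x h0) ≤ l2 n (resid θ₀ x h0) → ‖θ - θ₀‖ ≤ δ₀ := fun θ hθ hle => by
    have hγ : ∑ j, |Param.ga θ j| ≤ 1 := hθ.2.2.2.1.le
    have h1 := hM n x h0 D a c hn hc0.le ha1 hsa hD hgeom hXD hd hB hcS θ η hη0.le hη1 hγ (by
      have h2 : ρ⁻¹ ^ q * ∑ j, |Param.ga θ j| ≤ ρ⁻¹ ^ q := mul_le_of_le_one_right (by positivity) hγ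
      have h3 : κ ≤ η / 2 := min_le_left _ _
      linarith) hle
    by_contra! hlt
    set δ := ‖θ - θ₀‖ with hδ
    have hδ1 : 0 ≤ δ := norm_nonneg _
    have h2 : M * a * (δ + η + a) ≤ t * (δ + 2) :=
      mul_le_mul hat (by linarith) (by linarith) ht0.le
    have h3 : t * (δ + 2) ≤ c ^ 2 * δ₀ * δ / 4 := by
      rw [ht, div_mul_eq_mul_div, div_le_div_iff₀ (by positivity) (by positivity)]
      have h4 : δ₀ * (δ + 2) ≤ δ * (δ₀ + 2) := by nlinarith
      have h5 := mul_le_mul_of_nonneg_left h4 (by positivity : 0 ≤ 4 * c ^ 2 * δ₀)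
      linarith
    have h4 : c ^ 2 * δ₀ * δ ≤ c ^ 2 * δ * δ := by gcongr
    have h5 : c ^ 2 * δ₀ ^ 2 ≤ c ^ 2 * δ ^ 2 := by gcongr
    have h6 : 0 < c ^ 2 * δ ^ 2 := by
      have : 0 < δ := hδ₀pos.trans hlt
      positivity
    linarith
  obtain ⟨hmem, hle⟩ := hqmle.mem_and_le hn hδ₀pos.le hball hglob
  have hclose := hglob θhat hmem hle
  have hγ := hloc θhat hclose
  -- Inside the ball the filter is uniformly invertible, so no regularization is needed and the
  -- right side is quadratic in the rate.
  have h1 := hM n x h0 D a c hn hc0.le ha1 hsa hD hgeom hXD hd hB hcS θhat 0 le_rfl zero_le_one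
    (hγ.trans (by linarith)) (by
      have h2 : ρ⁻¹ ^ q * ∑ j, |Param.ga θhat j| ≤ ρ⁻¹ ^ q * g' := by gcongr
      have h3 : κ ≤ (1 - g') / 2 := min_le_right _ _
      linarith) hle
  rw [mul_zero, add_zero] at h1
  exact le_of_quadratic hc0 hM0 ha0 h1

end DRBeta

namespace DRBeta

open Finset Topology

/-! ### Calculus of `O_p` -/

section BigOp

variable {Ω ι : Type*} [MeasurableSpace Ω] {P : Measure Ω} {l : Filter ι}

lemma IsBigOp.mono {X Y : ι → Ω → ℝ} {a : ι → ℝ} (hY : IsBigOp P l Y a)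
    (h : ∀ᶠ k in l, ∀ᵐ ω ∂P, |X k ω| ≤ |Y k ω|) : IsBigOp P l X a := fun ε hε => by
  obtain ⟨M, hM, hev⟩ := hY ε hε
  refine ⟨M, hM, (hev.and h).mono fun k hk => (measure_mono_ae ?_).trans hk.1⟩
  filter_upwards [hk.2] with ω hω hlt
  exact lt_of_lt_of_le hlt hω

lemma IsBigOp.mono_scale {X : ι → Ω → ℝ} {a b : ι → ℝ} (hX : IsBigOp P l X a) {C : ℝ}
    (hC : 0 < C) (h : ∀ᶠ k in l, a k ≤ C * b k) : IsBigOp P l X b := fun ε hε => by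
  obtain ⟨M, hM, hev⟩ := hX ε hε
  refine ⟨M * C, by positivity, (hev.and h).mono fun k hk => (measure_mono ?_).trans hk.1⟩
  intro ω hω
  have h1 : M * a k ≤ M * (C * b k) := by have := hk.2; gcongr
  have h2 : M * C * b k < |X k ω| := hω
  change M * a k < |X k ω|
  linarith

lemma IsBigOp.add {X Y : ι → Ω → ℝ} {a : ι → ℝ} (hX : IsBigOp P l X a) (hY : IsBigOp P l Y a) :
    IsBigOp P l (fun k ω => X k ω + Y k ω) a := fun ε hε => by
  obtain ⟨M, hM, hev⟩ := hX (ε / 2) (by positivity)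
  obtain ⟨M', hM', hev'⟩ := hY (ε / 2) (by positivity)
  refine ⟨M + M', by positivity, (hev.and hev').mono fun k hk => ?_⟩
  have hsub : {ω | (M + M') * a k < |X k ω + Y k ω|} ⊆
      {ω | M * a k < |X k ω|} ∪ {ω | M' * a k < |Y k ω|} := fun ω hω => by
    by_contra hn
    simp only [Set.mem_union, not_or] at hn
    have h1 : |X k ω| ≤ M * a k := not_lt.1 hn.1
    have h2 : |Y k ω| ≤ M' * a k := not_lt.1 hn.2
    have h3 : (M + M') * a k < |X k ω + Y k ω| := hω
    have := abs_add_le (X k ω) (Y k ω)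
    linarith
  refine (measure_mono hsub).trans ((measure_union_le _ _).trans ?_)
  refine (add_le_add hk.1 hk.2).trans (le_of_eq ?_)
  rw [← ENNReal.ofReal_add (by positivity) (by positivity), add_halves]

lemma isBigOp_zero {a : ι → ℝ} (ha : ∀ᶠ k in l, 0 ≤ a k) :
    IsBigOp P l (fun _ _ => 0) a := fun ε _ => by
  refine ⟨1, one_pos, ha.mono fun k hk => ?_⟩
  have : {ω : Ω | 1 * a k < |(0 : ℝ)|} = ∅ := by
    ext ω; simpa using hk
  rw [this]; simp

lemma IsBigOp.sum {κ : Type*} {X : κ → ι → Ω → ℝ} {a : ι → ℝ} (ha : ∀ᶠ k in l, 0 ≤ a k)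
    (s : Finset κ) (h : ∀ i ∈ s, IsBigOp P l (X i) a) :
    IsBigOp P l (fun k ω => ∑ i ∈ s, X i k ω) a := by
  classical
  induction s using Finset.induction_on with
  | empty => simpa using isBigOp_zero ha
  | insert i s hi ih =>
    simp only [Finset.sum_insert hi]
    exact (h i (by simp)).add (ih fun j hj => h j (by simp [hj]))

lemma IsBigOp.abs {X : ι → Ω → ℝ} {a : ι → ℝ} (hX : IsBigOp P l X a) :
    IsBigOp P l (fun k ω => |X k ω|) a := by
  simpa [IsBigOp] using hX

lemma IsBigOp.const_mul {X : ι → Ω → ℝ} {a : ι → ℝ} (ha : ∀ᶠ k in l, 0 ≤ a k)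
    (hX : IsBigOp P l X a) (c : ℝ) :
    IsBigOp P l (fun k ω => c * X k ω) a := fun ε hε => by
  obtain ⟨M, hM, hev⟩ := hX ε hε
  refine ⟨M * (|c| + 1), by positivity, (hev.and ha).mono fun k hk => (measure_mono ?_).trans hk.1⟩
  intro ω hω
  have h1 : M * (|c| + 1) * a k < |c * X k ω| := hω
  change M * a k < |X k ω|
  rw [abs_mul] at h1
  by_contra! h
  have h2 : |c| * |X k ω| ≤ |c| * (M * a k) := by gcongr
  have h3 : 0 ≤ M * a k := mul_nonneg hM.le hk.2
  linarith

lemma IsBigOp.comp_tendsto {ι' : Type*} {l' : Filter ι'} {X : ι → Ω → ℝ} {a : ι → ℝ}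
    (hX : IsBigOp P l X a) {f : ι' → ι} (hf : Tendsto f l' l) :
    IsBigOp P l' (fun k => X (f k)) (fun k => a (f k)) := fun ε hε => by
  obtain ⟨M, hM, hev⟩ := hX ε hε
  exact ⟨M, hM, hf.eventually hev⟩

/-- Chebyshev: second moments of order `a²` give `O_p(a)`. -/
lemma isBigOp_of_lintegral_sq {X : ι → Ω → ℝ} {a : ι → ℝ} (ha : ∀ᶠ k in l, 0 < a k)
    (hX : ∀ᶠ k in l, AEMeasurable (X k) P) {C : ℝ}
    (h : ∀ᶠ k in l, ∫⁻ ω, ENNReal.ofReal (X k ω ^ 2) ∂P ≤ ENNReal.ofReal (C * a k ^ 2)) :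
    IsBigOp P l X a := fun ε hε => by
  set C' := |C| + 1 with hC'
  have hC'0 : 0 < C' := by positivity
  refine ⟨√(C' / ε), by positivity, ?_⟩
  filter_upwards [ha, hX, h] with k hk hXk hint
  have h1 : {ω | √(C' / ε) * a k < |X k ω|} ⊆
      {ω | ENNReal.ofReal (C' / ε * a k ^ 2) ≤ ENNReal.ofReal (X k ω ^ 2)} := fun ω hω => by
    have h2 : √(C' / ε) * a k < |X k ω| := hω
    refine ENNReal.ofReal_le_ofReal ?_
    have h3 : (√(C' / ε) * a k) ^ 2 ≤ |X k ω| ^ 2 := by gcongr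
    rwa [mul_pow, Real.sq_sqrt (by positivity), sq_abs] at h3
  refine (measure_mono h1).trans ?_
  have h4 : (0 : ℝ) < C' / ε * a k ^ 2 := by positivity
  refine (meas_ge_le_lintegral_div (by fun_prop) (by simpa using h4)
    ENNReal.ofReal_ne_top).trans ?_
  refine (ENNReal.div_le_div_right hint _).trans ?_
  rw [← ENNReal.ofReal_div_of_pos h4]
  refine ENNReal.ofReal_le_ofReal ?_
  rw [div_le_iff₀ h4]
  have : ε * (C' / ε * a k ^ 2) = C' * a k ^ 2 := by field_simp
  rw [this]
  have := le_abs_self C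
  gcongr
  linarith

/-- A fixed random variable is `O_p(1)`. -/
lemma isBigOp_const [IsFiniteMeasure P] {X : Ω → ℝ} (hX : Measurable X) :
    IsBigOp P l (fun _ => X) (fun _ => 1) := fun ε hε => by
  have h1 : Tendsto (fun N : ℕ => P {ω | (N : ℝ) < |X ω|}) atTop
      (𝓝 (P (⋂ N : ℕ, {ω | (N : ℝ) < |X ω|}))) := by
    refine tendsto_measure_iInter_atTop (fun N => ?_) (fun N M hNM ω hω => ?_) ⟨0, measure_ne_top _ _⟩
    · exact (measurableSet_lt measurable_const hX.abs).nullMeasurableSet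
    · exact lt_of_le_of_lt (by exact_mod_cast hNM) (show (M : ℝ) < |X ω| from hω)
  have h2 : (⋂ N : ℕ, {ω | (N : ℝ) < |X ω|}) = ∅ := by
    ext ω
    simp only [Set.mem_iInter, Set.mem_ofPred_eq, Set.mem_empty_iff_false, iff_false, not_forall,
      not_lt]
    exact exists_nat_ge _
  rw [h2, measure_empty] at h1
  obtain ⟨N, hN, hN0⟩ := ((h1.eventually_le_const (ENNReal.ofReal_pos.2 hε)).and
    (eventually_gt_atTop 0)).exists
  exact ⟨N, by exact_mod_cast hN0, Eventually.of_forall fun _ => by simpa using hN⟩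

end BigOp

/-! ### Martingale second moments -/

section Martingale

variable {Ω : Type*} [mΩ : MeasurableSpace Ω] {P : Measure Ω} [IsProbabilityMeasure P]

/-- A bounded conditional second moment bounds `E[D² g]` for conditioned `g ≥ 0`. -/
lemma lintegral_sq_mul_le {m : MeasurableSpace Ω} (hm : m ≤ mΩ) {D : Ω → ℝ} (hD : MemLp D 2 P)
    {C : ℝ} (hC : P[fun ω => D ω ^ 2 | m] ≤ᵐ[P] fun _ => C) {g : Ω → ENNReal}
    (hg : Measurable[m] g) :
    ∫⁻ ω, ENNReal.ofReal (D ω ^ 2) * g ω ∂P ≤ ENNReal.ofReal C * ∫⁻ ω, g ω ∂P := by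
  have hint : Integrable (fun ω => D ω ^ 2) P := hD.integrable_sq
  have hmeas : AEMeasurable (fun ω => ENNReal.ofReal (D ω ^ 2)) P :=
    hint.aestronglyMeasurable.aemeasurable.ennreal_ofReal
  -- Comparing the two measures on the sub-σ-algebra avoids any integrability requirement on `g`.
  have hle : (P.withDensity fun ω => ENNReal.ofReal (D ω ^ 2)).trim hm ≤
      ENNReal.ofReal C • P.trim hm := by
    refine Measure.le_iff.2 fun s hs => ?_
    rw [Measure.smul_apply, trim_measurableSet_eq hm hs, trim_measurableSet_eq hm hs,
      withDensity_apply _ (hm s hs), smul_eq_mul,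
      ← ofReal_integral_eq_lintegral_ofReal hint.integrableOn (ae_of_all _ fun _ => sq_nonneg _),
      ← setIntegral_condExp hm hint hs]
    calc ENNReal.ofReal (∫ ω in s, (P[fun ω => D ω ^ 2 | m]) ω ∂P)
        ≤ ENNReal.ofReal (∫ _ in s, C ∂P) := by
          refine ENNReal.ofReal_le_ofReal (setIntegral_mono_ae integrable_condExp.integrableOn
            (integrable_const C).integrableOn hC)
      _ = ENNReal.ofReal (P.real s * C) := by simp
      _ = _ := by
          rw [ENNReal.ofReal_mul (by positivity), mul_comm, Measure.real,
            ENNReal.ofReal_toReal (measure_ne_top _ _)]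
  calc ∫⁻ ω, ENNReal.ofReal (D ω ^ 2) * g ω ∂P
      = ∫⁻ ω, g ω ∂(P.withDensity fun ω => ENNReal.ofReal (D ω ^ 2)) :=
        (lintegral_withDensity_eq_lintegral_mul₀ hmeas (hg.mono hm le_rfl).aemeasurable).symm
    _ = ∫⁻ ω, g ω ∂((P.withDensity fun ω => ENNReal.ofReal (D ω ^ 2)).trim hm) :=
        (lintegral_trim hm hg).symm
    _ ≤ ∫⁻ ω, g ω ∂(ENNReal.ofReal C • P.trim hm) := lintegral_mono' hle le_rfl
    _ = _ := by rw [lintegral_smul_measure, lintegral_trim hm hg, smul_eq_mul]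

omit [IsProbabilityMeasure P] in
lemma memLp_two_of_lintegral_sq {X : Ω → ℝ} (hX : AEStronglyMeasurable X P)
    (h : ∫⁻ ω, ENNReal.ofReal (X ω ^ 2) ∂P < ⊤) : MemLp X 2 P := by
  refine (memLp_two_iff_integrable_sq hX).2 ⟨hX.pow 2, ?_⟩
  rw [hasFiniteIntegral_iff_ofReal (ae_of_all _ fun _ => sq_nonneg _)]
  exact h

/-- The second moment of a martingale transform. -/
lemma lintegral_sq_sum_le {ℱ : Filtration ℕ mΩ} {W : ℕ → Ω → ℝ}
    (hWm : ∀ t, StronglyMeasurable[ℱ (t + 1)] (W t)) (hW2 : ∀ t, MemLp (W t) 2 P)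
    (hW0 : ∀ t, P[W t | ℱ t] =ᵐ[P] 0) {C : ℝ} (hC0 : 0 ≤ C)
    (hC : ∀ t, P[fun ω => W t ω ^ 2 | ℱ t] ≤ᵐ[P] fun _ => C)
    {V : ℕ → Ω → ℝ} (hVm : ∀ t, StronglyMeasurable[ℱ t] (V t)) {B : ℝ} (hB0 : 0 ≤ B)
    (hVB : ∀ t, ∫⁻ ω, ENNReal.ofReal (V t ω ^ 2) ∂P ≤ ENNReal.ofReal B) (n : ℕ) :
    MemLp (fun ω => ∑ t ∈ range n, W t ω * V t ω) 2 P ∧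
      ∫⁻ ω, ENNReal.ofReal ((∑ t ∈ range n, W t ω * V t ω) ^ 2) ∂P ≤
        ENNReal.ofReal (n * (C * B)) := by
  have hWm' : ∀ t, StronglyMeasurable (W t) := fun t => (hWm t).mono (ℱ.le _)
  have hVm' : ∀ t, StronglyMeasurable (V t) := fun t => (hVm t).mono (ℱ.le _)
  have hterm : ∀ t, ∫⁻ ω, ENNReal.ofReal ((W t ω * V t ω) ^ 2) ∂P ≤ ENNReal.ofReal (C * B) := by
    intro t
    calc ∫⁻ ω, ENNReal.ofReal ((W t ω * V t ω) ^ 2) ∂P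
        = ∫⁻ ω, ENNReal.ofReal (W t ω ^ 2) * ENNReal.ofReal (V t ω ^ 2) ∂P := by
          simp only [mul_pow, ENNReal.ofReal_mul (sq_nonneg _)]
      _ ≤ ENNReal.ofReal C * ∫⁻ ω, ENNReal.ofReal (V t ω ^ 2) ∂P :=
          lintegral_sq_mul_le (ℱ.le t) (hW2 t) (hC t)
            ((hVm t).measurable.pow_const 2).ennreal_ofReal
      _ ≤ ENNReal.ofReal C * ENNReal.ofReal B := by gcongr; exact hVB t
      _ = _ := (ENNReal.ofReal_mul hC0).symm
  -- The bound on the conditional variance replaces fourth moments: it makes products such as `D_t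
  -- D_{t-k}` square integrable.
  have htermLp : ∀ t, MemLp (fun ω => W t ω * V t ω) 2 P := fun t =>
    memLp_two_of_lintegral_sq ((hWm' t).mul (hVm' t)).aestronglyMeasurable
      ((hterm t).trans_lt ENNReal.ofReal_lt_top)
  induction n with
  | zero => simp
  | succ n ih =>
    obtain ⟨ihL, ihI⟩ := ih
    set S : Ω → ℝ := fun ω => ∑ t ∈ range n, W t ω * V t ω with hS
    have hSm : StronglyMeasurable[ℱ n] S := by
      refine Finset.stronglyMeasurable_fun_sum _ fun t ht => ?_
      have ht' := mem_range.1 ht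
      exact ((hWm t).mono (ℱ.mono ht')).mul ((hVm t).mono (ℱ.mono ht'.le))
    have hL : MemLp (fun ω => S ω + W n ω * V n ω) 2 P := ihL.add (htermLp n)
    simp only [sum_range_succ]
    refine ⟨hL, ?_⟩
    have hcross : Integrable (fun ω => S ω * (W n ω * V n ω)) P := ihL.integrable_mul (htermLp n)
    -- The factor `S V_n` is known at time `n`, when `W n` has conditional mean zero.
    have hzero : ∫ ω, S ω * (W n ω * V n ω) ∂P = 0 := by
      have e1 : (fun ω => S ω * (W n ω * V n ω)) = (fun ω => S ω * V n ω) * W n := by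
        ext ω; simp; ring
      rw [e1] at hcross ⊢
      have e2 := condExp_mul_of_stronglyMeasurable_left (hSm.mul (hVm n)) hcross
        ((hW2 n).integrable (by norm_num))
      have e3 : P[(fun ω => S ω * V n ω) * W n | ℱ n] =ᵐ[P] S * V n * P[W n | ℱ n] := e2
      rw [← integral_condExp (ℱ.le n), integral_congr_ae e3]
      refine integral_eq_zero_of_ae ?_
      filter_upwards [hW0 n] with ω hω
      simp [hω]
    have hint : ∫ ω, (S ω + W n ω * V n ω) ^ 2 ∂P =
        ∫ ω, S ω ^ 2 ∂P + ∫ ω, (W n ω * V n ω) ^ 2 ∂P := by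
      have e1 : ∀ ω, (S ω + W n ω * V n ω) ^ 2 =
          S ω ^ 2 + 2 * (S ω * (W n ω * V n ω)) + (W n ω * V n ω) ^ 2 := fun ω => by ring
      simp only [e1]
      have i1 := integral_add ihL.integrable_sq (hcross.const_mul 2)
      have i2 := integral_add (f := fun ω => S ω ^ 2 + 2 * (S ω * (W n ω * V n ω)))
        (ihL.integrable_sq.add (hcross.const_mul 2)) (htermLp n).integrable_sq
      rw [i2, i1, integral_const_mul, hzero]
      ring
    rw [← ofReal_integral_eq_lintegral_ofReal hL.integrable_sq (ae_of_all _ fun _ => sq_nonneg _),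
      hint, ENNReal.ofReal_add (integral_nonneg fun _ => sq_nonneg _)
        (integral_nonneg fun _ => sq_nonneg _),
      ofReal_integral_eq_lintegral_ofReal ihL.integrable_sq (ae_of_all _ fun _ => sq_nonneg _),
      ofReal_integral_eq_lintegral_ofReal (htermLp n).integrable_sq
        (ae_of_all _ fun _ => sq_nonneg _)]
    refine (add_le_add ihI (hterm n)).trans (le_of_eq ?_)
    rw [← ENNReal.ofReal_add (by positivity) (by positivity)]
    congr 1
    push_cast; ring

end Martingale

/-! ### The mean ergodic theorem -/

section Ergodic

variable {α : Type*} [MeasurableSpace α] {μ : Measure α} [IsProbabilityMeasure μ]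

/-- The mean ergodic theorem for an ergodic map, in probability. -/
lemma tendstoInMeasure_birkhoff {T : α → α} (hT : Ergodic T μ) {f : α → ℝ} (hf : MemLp f 2 μ) :
    TendstoInMeasure μ (fun (n : ℕ) x => (n : ℝ)⁻¹ * ∑ i ∈ range n, f (T^[i] x)) atTop
      fun _ => ∫ x, f x ∂μ := by
  have hmp := hT.toMeasurePreserving
  set U : Lp ℝ 2 μ →L[ℝ] Lp ℝ 2 μ :=
    (Lp.compMeasurePreservingₗᵢ ℝ T hmp).toContinuousLinearMap with hU
  have hUapp : ∀ g, U g = Lp.compMeasurePreserving T hmp g := fun g => rfl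
  set F : Lp ℝ 2 μ := hf.toLp f with hF
  -- By von Neumann's theorem the averages converge in `L²` to the projection onto the invariant
  -- functions. Ergodicity makes the limit constant, and pairing with the function `1` identifies it
  -- as the mean.
  set K := U.eqLocus (1 : Lp ℝ 2 μ →L[ℝ] Lp ℝ 2 μ) with hK
  have hlim := U.tendsto_birkhoffAverage_orthogonalProjection
    (LinearIsometry.norm_toContinuousLinearMap_le _) F
  set G : Lp ℝ 2 μ := (K.orthogonalProjectionOnto F : Lp ℝ 2 μ) with hG
  have hGU : U G = G := (K.orthogonalProjectionOnto F).2
  obtain ⟨c, hc⟩ : ∃ c, G =ᵐ[μ] Function.const α c := by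
    refine hT.ae_eq_const_of_ae_eq_comp_ae (Lp.aestronglyMeasurable G) ?_
    have h1 := Lp.coeFn_compMeasurePreserving G hmp
    rw [← hUapp, hGU] at h1
    exact h1.symm
  have hone : MemLp (fun _ : α => (1 : ℝ)) 2 μ := memLp_const 1
  set I : Lp ℝ 2 μ := hone.toLp _ with hI
  have hIK : I ∈ K := by
    change U I = I
    rw [hUapp, hI, Lp.toLp_compMeasurePreserving]
    rfl
  have hinner : inner ℝ I G = inner ℝ I F :=
    Submodule.inner_orthogonalProjectionOnto_eq_of_mem_left (⟨I, hIK⟩ : K) F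
  have hin : ∀ Z : Lp ℝ 2 μ, inner ℝ I Z = ∫ x, Z x ∂μ := fun Z => by
    rw [L2.inner_def]
    refine integral_congr_ae ?_
    filter_upwards [hone.coeFn_toLp] with x hx
    rw [hI, hx]; simp
  have hcf : c = ∫ x, f x ∂μ := by
    rw [hin, hin, integral_congr_ae hc, integral_congr_ae hf.coeFn_toLp] at hinner
    simpa using hinner
  have hiter : ∀ i : ℕ, (U^[i] F : Lp ℝ 2 μ) =ᵐ[μ] fun x => f (T^[i] x) := fun i => by
    induction i with
    | zero => exact hf.coeFn_toLp
    | succ i ih =>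
      rw [Function.iterate_succ_apply', hUapp]
      refine (Lp.coeFn_compMeasurePreserving _ hmp).trans ?_
      exact hmp.quasiMeasurePreserving.ae_eq_comp ih
  refine (tendstoInMeasure_of_tendsto_Lp hlim).congr (fun n => ?_) (hc.trans (by rw [hcf]; rfl))
  have h1 : birkhoffAverage ℝ U _root_.id n F = (n : ℝ)⁻¹ • ∑ i ∈ range n, U^[i] F := rfl
  rw [h1]
  refine (Lp.coeFn_smul _ _).trans ?_
  have h2 : (∑ i ∈ range n, U^[i] F : Lp ℝ 2 μ) =ᵐ[μ] fun x => ∑ i ∈ range n, f (T^[i] x) := by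
    clear h1
    induction n with
    | zero =>
      refine (Lp.coeFn_zero ℝ 2 μ).trans (ae_of_all _ fun x => ?_)
      simp
    | succ n ih =>
      simp only [sum_range_succ]
      exact (Lp.coeFn_add _ _).trans (ih.add (hiter n))
  filter_upwards [h2] with x hx
  rw [Pi.smul_apply, hx, smul_eq_mul]

/-- For a stationary ergodic sequence that does not vanish, the averages of the squares are
bounded away from zero. -/
lemma exists_sum_sq_ge {Ω : Type*} [MeasurableSpace Ω] {P : Measure Ω} [IsProbabilityMeasure P]
    {W : ℕ → Ω → ℝ} (hW : ∀ i, AEMeasurable (W i) P)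
    (hT : Ergodic (fun (x : ℕ → ℝ) (i : ℕ) => x (i + 1)) (P.map fun ω i => W i ω))
    (h0 : ¬ W 0 =ᵐ[P] 0) : ∃ κ : ℝ, 0 < κ ∧ κ ≤ 1 ∧
      Tendsto (fun n : ℕ => P {ω | ∑ t ∈ range n, W t ω ^ 2 < κ * n}) atTop (𝓝 0) := by
  have hΦ : AEMeasurable (fun ω i => W i ω) P := aemeasurable_pi_iff.2 hW
  set ν := P.map fun ω i => W i ω with hν
  have : IsProbabilityMeasure ν := Measure.isProbabilityMeasure_map hΦ
  -- Truncation puts `f` in `L²` without fourth moments and only lowers the averages. Its mean is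
  -- positive because `W 0` is not almost surely zero, and half of it is the required lower bound.
  set f : (ℕ → ℝ) → ℝ := fun x => min (x 0 ^ 2) 1 with hf
  have hfm : Measurable f := by fun_prop
  have hf0 : ∀ x, 0 ≤ f x := fun x => le_min (sq_nonneg _) zero_le_one
  have hf1 : ∀ x, f x ≤ 1 := fun x => min_le_right _ _
  have hfL : MemLp f 2 ν := MemLp.of_bound hfm.aestronglyMeasurable 1
    (ae_of_all _ fun x => by rw [Real.norm_of_nonneg (hf0 x)]; exact hf1 x)
  have hfi : Integrable f ν := hfL.integrable (by norm_num)
  set m := ∫ x, f x ∂ν with hm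
  have hm1 : m ≤ 1 := by
    calc m ≤ ∫ _, (1 : ℝ) ∂ν := integral_mono hfi (integrable_const _) hf1
      _ = 1 := by simp
  have hm0 : 0 < m := by
    refine lt_of_le_of_ne (integral_nonneg hf0) fun h => h0 ?_
    have h1 := (integral_eq_zero_iff_of_nonneg hf0 hfi).1 h.symm
    filter_upwards [ae_of_ae_map hΦ h1] with ω hω
    simp only [hf, Pi.zero_apply] at hω ⊢
    by_contra hne
    have : 0 < min (W 0 ω ^ 2) 1 := lt_min (by positivity) one_pos
    linarith
  refine ⟨m / 2, by positivity, by linarith, ?_⟩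
  have hlim := tendstoInMeasure_birkhoff hT hfL
  have h2 := hlim (ENNReal.ofReal (m / 2)) (ENNReal.ofReal_pos.2 (by positivity))
  refine tendsto_of_tendsto_of_tendsto_of_le_of_le' tendsto_const_nhds h2
    (Eventually.of_forall fun _ => zero_le) ?_
  filter_upwards [eventually_gt_atTop 0] with n hn
  have hn' : (0 : ℝ) < n := by exact_mod_cast hn
  have hS : ∀ (i : ℕ) (x : ℕ → ℝ),
      (fun (x : ℕ → ℝ) (i : ℕ) => x (i + 1))^[i] x = fun j => x (j + i) := fun i x => by
    induction i generalizing x with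
    | zero => rfl
    | succ i ih => rw [Function.iterate_succ_apply, ih]; ext j; simp [add_assoc]
  have hset : MeasurableSet {x | ENNReal.ofReal (m / 2) ≤
      edist ((n : ℝ)⁻¹ * ∑ i ∈ range n, f ((fun (x : ℕ → ℝ) (i : ℕ) => x (i + 1))^[i] x)) m} := by
    simp only [hS]
    refine measurableSet_le measurable_const (Measurable.edist ?_ measurable_const)
    refine Measurable.const_mul (Finset.measurable_fun_sum _ fun i _ => ?_) _
    have hshift : Measurable fun (x : ℕ → ℝ) (j : ℕ) => x (j + i) :=
      measurable_pi_lambda _ fun j => measurable_pi_apply _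
    exact hfm.comp hshift
  rw [hν, Measure.map_apply_of_aemeasurable hΦ hset]
  refine measure_mono fun ω hω => ?_
  simp only [Set.mem_preimage, Set.mem_ofPred_eq, hS, hf, zero_add] at hω ⊢
  rw [edist_dist, Real.dist_eq]
  refine ENNReal.ofReal_le_ofReal ?_
  have h3 : ∑ i ∈ range n, min (W i ω ^ 2) 1 ≤ ∑ i ∈ range n, W i ω ^ 2 :=
    Finset.sum_le_sum fun i _ => min_le_left _ _
  have h4 : (n : ℝ)⁻¹ * ∑ i ∈ range n, min (W i ω ^ 2) 1 ≤ m / 2 := by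
    rw [inv_mul_le_iff₀ hn']; linarith
  rw [abs_sub_comm]
  refine le_trans ?_ (le_abs_self _)
  linarith

end Ergodic

end DRBeta

namespace DRBeta

open PowerSeries Finset Topology

/-! ### Stochastic orders for the innovations -/

section Innovations

variable {Ω : Type*} [mΩ : MeasurableSpace Ω] {P : Measure Ω}

lemma measurable_ip {n : ℕ} {U V : Ω → ℝ⟦X⟧} (hU : ∀ t, Measurable fun ω => coeff t (U ω))
    (hV : ∀ t, Measurable fun ω => coeff t (V ω)) : Measurable fun ω => ip n (U ω) (V ω) :=
  Finset.measurable_fun_sum _ fun t _ => (hU t).mul (hV t)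

omit mΩ in
lemma measurable_coeff_X_pow_mul {m : MeasurableSpace Ω} {V : Ω → ℝ⟦X⟧} {t : ℕ}
    (hV : ∀ s ≤ t, Measurable[m] fun ω => coeff s (V ω)) (k : ℕ) :
    Measurable[m] fun ω => coeff t (X ^ k * V ω) := by
  simp only [PowerSeries.coeff_X_pow_mul']
  split_ifs
  · exact hV _ (Nat.sub_le _ _)
  · exact measurable_const

lemma lintegral_l2_sq_le {n : ℕ} {U : Ω → ℝ⟦X⟧} (hU : ∀ t, AEMeasurable (fun ω => coeff t (U ω)) P)
    {B : ℝ} (hB : ∀ t < n, ∫⁻ ω, ENNReal.ofReal (coeff t (U ω) ^ 2) ∂P ≤ ENNReal.ofReal B) :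
    ∫⁻ ω, ENNReal.ofReal (l2 n (U ω) ^ 2) ∂P ≤ ENNReal.ofReal (n * B) := by
  simp only [l2_sq_eq_sum]
  simp only [ENNReal.ofReal_sum_of_nonneg fun t (_ : t ∈ range n) => sq_nonneg (coeff t (U _))]
  rw [lintegral_finsetSum' _ fun t _ => ((hU t).pow_const 2).ennreal_ofReal]
  refine (sum_le_sum fun t ht => hB t (mem_range.1 ht)).trans (le_of_eq ?_)
  rw [sum_const, card_range, nsmul_eq_mul, ENNReal.ofReal_mul (by positivity),
    ENNReal.ofReal_natCast]

lemma aemeasurable_l2 {n : ℕ} {U : Ω → ℝ⟦X⟧} (hU : ∀ t, AEMeasurable (fun ω => coeff t (U ω)) P) :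
    AEMeasurable (fun ω => l2 n (U ω)) P := by
  have h1 : (fun ω => l2 n (U ω)) = fun ω => √(∑ t ∈ range n, coeff t (U ω) ^ 2) := by
    ext ω; rw [← l2_sq_eq_sum, Real.sqrt_sq (apply_nonneg _ _)]
  rw [h1]
  exact (Finset.aemeasurable_fun_sum _ fun t _ => (hU t).pow_const 2).sqrt

lemma eventually_sqrt_pos : ∀ᶠ n : ℕ in atTop, 0 < √(n : ℝ) :=
  (eventually_gt_atTop 0).mono fun n hn => Real.sqrt_pos.2 (by exact_mod_cast hn)

lemma corr_sq_le (n : ℕ) {ρ : ℝ} (hρ0 : 0 ≤ ρ) (hρ1 : ρ < 1) (D V : ℝ⟦X⟧) :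
    corr n ρ D V ^ 2 ≤ (1 - ρ)⁻¹ * ∑ k ∈ range n, ρ ^ k * ip n D (X ^ k * V) ^ 2 := by
  rw [corr_apply n hρ0]
  refine (sum_sq_le_sum_mul_sum_of_sq_le_mul (range n) (f := fun k => ρ ^ k)
    (g := fun k => ρ ^ k * ip n D (X ^ k * V) ^ 2) (fun _ _ => by positivity)
    (fun _ _ => by positivity) fun k _ => ?_).trans ?_
  · rw [mul_pow, sq_abs]; exact le_of_eq (by ring)
  · have : 0 ≤ ∑ k ∈ range n, ρ ^ k * ip n D (X ^ k * V) ^ 2 :=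
      sum_nonneg fun _ _ => by positivity
    gcongr
    exact sum_pow_le hρ0 hρ1 n

variable [IsProbabilityMeasure P] {ℱ : Filtration ℕ mΩ} {W : ℕ → Ω → ℝ} {C : ℝ}

/-- A square integrable martingale difference sequence with bounded conditional variances. -/
structure IsInnovation (P : Measure Ω) (ℱ : Filtration ℕ mΩ) (W : ℕ → Ω → ℝ) (C : ℝ) : Prop where
  adapted : ∀ t, StronglyMeasurable[ℱ (t + 1)] (W t)
  memLp : ∀ t, MemLp (W t) 2 P
  condExp : ∀ t, P[W t | ℱ t] =ᵐ[P] 0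
  nonneg : 0 ≤ C
  condVar : ∀ t, P[fun ω => W t ω ^ 2 | ℱ t] ≤ᵐ[P] fun _ => C

omit [IsProbabilityMeasure P] in
lemma IsInnovation.measurable (h : IsInnovation P ℱ W C) (t : ℕ) : Measurable (W t) :=
  ((h.adapted t).mono (ℱ.le _)).measurable

lemma IsInnovation.lintegral_sq_le (h : IsInnovation P ℱ W C) (t : ℕ) :
    ∫⁻ ω, ENNReal.ofReal (W t ω ^ 2) ∂P ≤ ENNReal.ofReal C := by
  simpa using lintegral_sq_mul_le (ℱ.le t) (h.memLp t) (h.condVar t)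
    (measurable_const (a := (1 : ENNReal)))

/-- The innovations as a power series. -/
noncomputable def innovSer (W : ℕ → Ω → ℝ) (ω : Ω) : ℝ⟦X⟧ := PowerSeries.mk fun t => W t ω

omit mΩ in
lemma coeff_innovSer (t : ℕ) (ω : Ω) : coeff t (innovSer W ω) = W t ω := by simp [innovSer]

lemma IsInnovation.isBigOp_l2 (h : IsInnovation P ℱ W C) :
    IsBigOp P atTop (fun n ω => l2 n (innovSer W ω)) (fun n => √(n : ℝ)) := by
  refine isBigOp_of_lintegral_sq eventually_sqrt_pos
    (Eventually.of_forall fun n => aemeasurable_l2 fun t => ?_) (C := C)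
    (Eventually.of_forall fun n => ?_)
  · simpa only [coeff_innovSer] using (h.measurable t).aemeasurable
  · rw [Real.sq_sqrt (by positivity), mul_comm]
    refine lintegral_l2_sq_le (fun t => ?_) fun t _ => ?_
    · simpa only [coeff_innovSer] using (h.measurable t).aemeasurable
    · simpa only [coeff_innovSer] using h.lintegral_sq_le t

/-- A predictable power series with bounded second moments. -/
structure IsPredictable₂ (P : Measure Ω) (ℱ : Filtration ℕ mΩ) (V : Ω → ℝ⟦X⟧) (B : ℝ) : Prop where
  predictable : ∀ t, Measurable[ℱ t] fun ω => coeff t (V ω)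
  nonneg : 0 ≤ B
  lintegral_le : ∀ t, ∫⁻ ω, ENNReal.ofReal (coeff t (V ω) ^ 2) ∂P ≤ ENNReal.ofReal B

omit [IsProbabilityMeasure P] in
lemma IsPredictable₂.X_pow_mul {V : Ω → ℝ⟦X⟧} {B : ℝ} (h : IsPredictable₂ P ℱ V B) (k : ℕ) :
    IsPredictable₂ P ℱ (fun ω => X ^ k * V ω) B where
  predictable t := measurable_coeff_X_pow_mul
    (fun s hs => (h.predictable s).mono (ℱ.mono hs) le_rfl) k
  nonneg := h.nonneg
  lintegral_le t := by
    simp only [PowerSeries.coeff_X_pow_mul']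
    split_ifs
    · exact h.lintegral_le _
    · simp

lemma isPredictable₂_geom : IsPredictable₂ P ℱ (fun _ => geom) 1 where
  predictable t := measurable_const
  nonneg := zero_le_one
  lintegral_le t := by simp [coeff_geom]

/-- The factor `X` is essential: its coefficient at `t` is `W (t - 1)`, which is known at time `t`.
-/
lemma IsInnovation.isPredictable₂ (h : IsInnovation P ℱ W C) :
    IsPredictable₂ P ℱ (fun ω => X * innovSer W ω) C where
  predictable t := by
    simp only [coeff_X_mul]
    split_ifs with ht
    · exact measurable_const
    · simp only [coeff_innovSer]
      obtain ⟨s, rfl⟩ := Nat.exists_eq_succ_of_ne_zero ht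
      exact (h.adapted s).measurable
  nonneg := h.nonneg
  lintegral_le t := by
    simp only [coeff_X_mul]
    split_ifs with ht
    · simp
    · simpa only [coeff_innovSer] using h.lintegral_sq_le _

lemma IsInnovation.lintegral_ip_sq_le (h : IsInnovation P ℱ W C) {V : Ω → ℝ⟦X⟧} {B : ℝ}
    (hV : IsPredictable₂ P ℱ V B) (n : ℕ) :
    ∫⁻ ω, ENNReal.ofReal (ip n (innovSer W ω) (V ω) ^ 2) ∂P ≤ ENNReal.ofReal (n * (C * B)) := by
  have := (lintegral_sq_sum_le h.adapted h.memLp h.condExp h.nonneg h.condVar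
    (fun t => (hV.predictable t).stronglyMeasurable) hV.nonneg hV.lintegral_le n).2
  simpa only [ip, coeff_innovSer] using this

omit [IsProbabilityMeasure P] in
lemma IsInnovation.measurable_ip (h : IsInnovation P ℱ W C) {V : Ω → ℝ⟦X⟧} {B : ℝ}
    (hV : IsPredictable₂ P ℱ V B) (n : ℕ) : Measurable fun ω => ip n (innovSer W ω) (V ω) :=
  DRBeta.measurable_ip (fun t => by simpa only [coeff_innovSer] using h.measurable t)
    fun t => (hV.predictable t).mono (ℱ.le t) le_rfl

/-- Weighted Cauchy–Schwarz reduces the second moment to a geometrically weighted sum of second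
moments of `⟨D, X ^ k V⟩`. Each is at most `n C B`, as shifts of predictable series are predictable.
-/
lemma IsInnovation.isBigOp_corr (h : IsInnovation P ℱ W C) {V : Ω → ℝ⟦X⟧} {B : ℝ}
    (hV : IsPredictable₂ P ℱ V B) {ρ : ℝ} (hρ0 : 0 ≤ ρ) (hρ1 : ρ < 1) :
    IsBigOp P atTop (fun n ω => corr n ρ (innovSer W ω) (V ω)) (fun n => √(n : ℝ)) := by
  have hm : ∀ n k, Measurable fun ω => ip n (innovSer W ω) (X ^ k * V ω) := fun n k =>
    h.measurable_ip (hV.X_pow_mul k) n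
  have hu : 0 ≤ (1 - ρ)⁻¹ := inv_nonneg.2 (by linarith)
  refine isBigOp_of_lintegral_sq eventually_sqrt_pos (Eventually.of_forall fun n => ?_)
    (C := (1 - ρ)⁻¹ * (1 - ρ)⁻¹ * (C * B)) (Eventually.of_forall fun n => ?_)
  · simp only [corr_apply n hρ0]
    refine Measurable.aemeasurable (Finset.measurable_fun_sum _ fun k _ => ?_)
    exact (hm n k).abs.const_mul _
  · have hCB : 0 ≤ C * B := mul_nonneg h.nonneg hV.nonneg
    rw [Real.sq_sqrt (by positivity)]
    calc ∫⁻ ω, ENNReal.ofReal (corr n ρ (innovSer W ω) (V ω) ^ 2) ∂P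
        ≤ ∫⁻ ω, ENNReal.ofReal (1 - ρ)⁻¹ * ∑ k ∈ range n,
            ENNReal.ofReal (ρ ^ k) * ENNReal.ofReal (ip n (innovSer W ω) (X ^ k * V ω) ^ 2) ∂P := by
          refine lintegral_mono fun ω => ?_
          refine (ENNReal.ofReal_le_ofReal (corr_sq_le n hρ0 hρ1 _ _)).trans (le_of_eq ?_)
          rw [ENNReal.ofReal_mul hu, ENNReal.ofReal_sum_of_nonneg fun _ _ => by positivity]
          congr 1
          exact sum_congr rfl fun k _ => ENNReal.ofReal_mul (by positivity)
      _ = ENNReal.ofReal (1 - ρ)⁻¹ * ∑ k ∈ range n, ENNReal.ofReal (ρ ^ k) *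
            ∫⁻ ω, ENNReal.ofReal (ip n (innovSer W ω) (X ^ k * V ω) ^ 2) ∂P := by
          have hm2 : ∀ k, Measurable fun ω =>
              ENNReal.ofReal (ip n (innovSer W ω) (X ^ k * V ω) ^ 2) := fun k =>
            ((hm n k).pow_const 2).ennreal_ofReal
          rw [lintegral_const_mul _ (Finset.measurable_fun_sum _ fun k _ => (hm2 k).const_mul _),
            lintegral_finsetSum _ fun k _ => (hm2 k).const_mul _]
          congr 1
          exact sum_congr rfl fun k _ => lintegral_const_mul _ (hm2 k)
      _ ≤ ENNReal.ofReal (1 - ρ)⁻¹ * ∑ k ∈ range n, ENNReal.ofReal (ρ ^ k) *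
            ENNReal.ofReal (n * (C * B)) := by
          gcongr with k
          exact h.lintegral_ip_sq_le (hV.X_pow_mul k) n
      _ = ENNReal.ofReal (1 - ρ)⁻¹ * (ENNReal.ofReal (∑ k ∈ range n, ρ ^ k) *
            ENNReal.ofReal (n * (C * B))) := by
          rw [← sum_mul, ENNReal.ofReal_sum_of_nonneg fun _ _ => by positivity]
      _ ≤ ENNReal.ofReal (1 - ρ)⁻¹ * (ENNReal.ofReal (1 - ρ)⁻¹ *
            ENNReal.ofReal (n * (C * B))) := by
          gcongr
          exact sum_pow_le hρ0 hρ1 n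
      _ = _ := by
          rw [← ENNReal.ofReal_mul hu, ← ENNReal.ofReal_mul hu]
          congr 1; ring

lemma ip_X_pow_mul_of_le {n k : ℕ} (hk : k ≤ n) (U V : ℝ⟦X⟧) :
    ip n (X ^ k * U) (X ^ k * V) = ip (n - k) U V := by
  conv_lhs => rw [← Nat.sub_add_cancel hk]
  exact ip_X_pow_mul _ _ _ _

lemma IsInnovation.isBigOp_ip_shift (h : IsInnovation P ℱ W C) {V : Ω → ℝ⟦X⟧} {B : ℝ}
    (hV : IsPredictable₂ P ℱ V B) (k : ℕ) :
    IsBigOp P atTop (fun n ω => ip (n - k) (innovSer W ω) (V ω)) (fun n => √(n : ℝ)) := by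
  refine isBigOp_of_lintegral_sq eventually_sqrt_pos (Eventually.of_forall fun n =>
    (h.measurable_ip hV _).aemeasurable) (C := C * B) (Eventually.of_forall fun n => ?_)
  refine (h.lintegral_ip_sq_le hV _).trans (ENNReal.ofReal_le_ofReal ?_)
  have hCB : 0 ≤ C * B := mul_nonneg h.nonneg hV.nonneg
  rw [Real.sq_sqrt (by positivity), mul_comm]
  gcongr
  exact Nat.sub_le _ _

/-- Removing the `k` common shifts leaves the correlation of `D` with a strict lag of itself, on a
window of length `n - k`. -/
lemma IsInnovation.isBigOp_ip_lags (h : IsInnovation P ℱ W C) {l k : ℕ} (hkl : k < l) :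
    IsBigOp P atTop (fun n ω => ip n (X ^ l * innovSer W ω) (X ^ k * innovSer W ω))
      (fun n => √(n : ℝ)) := by
  refine (h.isBigOp_ip_shift (h.isPredictable₂.X_pow_mul (l - k - 1)) k).mono ?_
  filter_upwards [eventually_ge_atTop k] with n hn
  refine ae_of_all _ fun ω => le_of_eq ?_
  obtain ⟨j, rfl⟩ : ∃ j, l = k + (j + 1) := ⟨l - k - 1, by omega⟩
  have e1 : X ^ (k + (j + 1)) * innovSer W ω = X ^ k * (X ^ j * (X * innovSer W ω)) := by ring
  rw [e1, ip_X_pow_mul_of_le hn, ip_comm]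
  congr 4
  omega

lemma ip_X_pow_mul_geom (n l : ℕ) (U : ℝ⟦X⟧) :
    ip n (X ^ l * U) geom = ip n (X ^ l * U) (X ^ l * geom) := by
  refine sum_congr rfl fun t _ => ?_
  rw [PowerSeries.coeff_X_pow_mul', PowerSeries.coeff_X_pow_mul']
  split_ifs <;> simp [coeff_geom]

lemma IsInnovation.isBigOp_ip_geom (h : IsInnovation P ℱ W C) (l : ℕ) :
    IsBigOp P atTop (fun n ω => ip n (X ^ l * innovSer W ω) geom) (fun n => √(n : ℝ)) := by
  refine (h.isBigOp_ip_shift (isPredictable₂_geom (P := P) (ℱ := ℱ)) l).mono ?_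
  filter_upwards [eventually_ge_atTop l] with n hn
  refine ae_of_all _ fun ω => le_of_eq ?_
  rw [ip_X_pow_mul_geom, ip_X_pow_mul_of_le hn]

omit [IsProbabilityMeasure P] in
lemma tendsto_measure_lags {κ : ℝ} (hκ : 0 < κ)
    (h : Tendsto (fun n : ℕ => P {ω | ∑ t ∈ range n, W t ω ^ 2 < κ * n}) atTop (𝓝 0)) (m : ℕ) :
    Tendsto (fun n : ℕ => P {ω | ∃ l < m, l2 n (X ^ l * innovSer W ω) ^ 2 < κ / 2 * n})
      atTop (𝓝 0) := by
  refine tendsto_of_tendsto_of_tendsto_of_le_of_le' tendsto_const_nhds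
    (h.comp (tendsto_sub_atTop_nat m)) (Eventually.of_forall fun _ => zero_le) ?_
  filter_upwards [eventually_ge_atTop (2 * m)] with n hn
  refine measure_mono fun ω ⟨l, hl, hlt⟩ => ?_
  -- A lag loses its last `l` entries; as `n - m ≥ n / 2`, the constant `κ` is halved.
  have h1 : l2 n (X ^ l * innovSer W ω) ^ 2 = l2 (n - l) (innovSer W ω) ^ 2 := by
    rw [l2_sq, l2_sq, ip_X_pow_mul_of_le (by omega)]
  have h2 := l2_mono_sq (show n - m ≤ n - l by omega) (innovSer W ω)
  rw [l2_sq_eq_sum (n - m)] at h2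
  simp only [coeff_innovSer] at h2
  change ∑ t ∈ range (n - m), W t ω ^ 2 < κ * ((n - m : ℕ) : ℝ)
  have h3 : (n : ℝ) / 2 ≤ ((n - m : ℕ) : ℝ) := by
    rw [Nat.cast_sub (by omega)]
    have : (2 * m : ℝ) ≤ n := by exact_mod_cast hn
    linarith
  have h4 : κ / 2 * n ≤ κ * ((n - m : ℕ) : ℝ) := by
    calc κ / 2 * n = κ * (n / 2) := by ring
      _ ≤ _ := by gcongr
  linarith

end Innovations

end DRBeta

/-! ### Stochastic orders in the model and the rate in probability. -/

namespace DRBeta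

open PowerSeries Finset Topology

section Model

variable {Ω : Type*} [mΩ : MeasurableSpace Ω] {P : Measure Ω} {p q : ℕ}

omit mΩ in
lemma measurable_hSeq {ℱ : ℤ → MeasurableSpace Ω} (hmono : Monotone ℱ) (θ : Param p q)
    {x h0 : ℤ → Ω → ℝ} (hx : ∀ i, Measurable[ℱ i] (x i)) (hh0 : ∀ i ≤ 0, Measurable[ℱ i] (h0 i))
    (i : ℤ) : Measurable[ℱ i] fun ω => hSeq θ (fun j => x j ω) (fun j => h0 j ω) i := by
  induction hk : i.toNat using Nat.strong_induction_on generalizing i with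
  | _ k ih =>
    rcases le_or_gt i 0 with hi | hi
    · simp only [hSeq_of_nonpos _ _ _ hi]; exact hh0 i hi
    · simp only [hSeq_of_pos _ _ _ hi]
      have h1 : ∀ j : Fin q, Measurable[ℱ i] fun ω =>
          hSeq θ (fun j => x j ω) (fun j => h0 j ω) (i - ((j : ℤ) + 1)) := fun j =>
        (ih _ (by omega) _ rfl).mono (hmono (by omega)) le_rfl
      have h2 : ∀ j : Fin (max p q), Measurable[ℱ i] (x (i - ((j : ℤ) + 1))) := fun j =>
        (hx _).mono (hmono (by omega)) le_rfl
      refine Measurable.add (Measurable.add measurable_const ?_) ?_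
      · exact Finset.measurable_fun_sum _ fun j _ => (h1 j).const_mul _
      · exact Finset.measurable_fun_sum _ fun j _ => (h2 j).const_mul _

omit mΩ in
lemma innovSer_eq_resid (θ : Param p q) (Iβ h0 : ℤ → Ω → ℝ) (ω : Ω) :
    innovSer (fun t => innovation θ Iβ h0 ((t : ℤ) + 1)) ω =
      resid θ (fun i => Iβ i ω) (fun i => h0 i ω) := by
  ext t
  rw [coeff_innovSer, resid, map_sub, coeff_ser, coeff_ser, innovation]

variable {ι : Type*} {l : Filter ι} {n : ι → ℕ} {m : ι → ℝ}

/-- The order of the measurement errors. -/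
lemma isBigOp_l2_error {RIB : ι → ℤ → Ω → ℝ} {Iβ : ℤ → Ω → ℝ} (hm : ∀ k, 0 < m k)
    (hnlim : Tendsto n l atTop)
    (hmeas : ∀ k i, AEMeasurable (fun ω => RIB k i ω - Iβ i ω) P)
    (hRIB : ∃ C : ℝ, ∀ k, ∀ i : ℕ, 1 ≤ i → i ≤ n k →
      Integrable (fun ω => (RIB k i ω - Iβ i ω) ^ 2) P ∧
        ∫ ω, (RIB k i ω - Iβ i ω) ^ 2 ∂P ≤ C * m k ^ (-(1 / 2) : ℝ)) :
    IsBigOp P l (fun k ω => l2 (n k) (ser ((fun i => RIB k i ω) - fun i => Iβ i ω)))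
      (fun k => √(n k : ℝ) * m k ^ (-(1 / 4) : ℝ)) := by
  obtain ⟨C, hC⟩ := hRIB
  refine isBigOp_of_lintegral_sq (C := C) ?_ (Eventually.of_forall fun k => ?_)
    (Eventually.of_forall fun k => ?_)
  · filter_upwards [hnlim.eventually eventually_sqrt_pos] with k hk
    exact mul_pos hk (Real.rpow_pos_of_pos (hm k) _)
  · refine aemeasurable_l2 fun t => ?_
    simpa only [coeff_ser, Pi.sub_apply] using hmeas k _
  · have h1 : (m k ^ (-(1 / 4) : ℝ)) ^ 2 = m k ^ (-(1 / 2) : ℝ) := by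
      rw [← Real.rpow_natCast, ← Real.rpow_mul (hm k).le]; norm_num
    rw [mul_pow, h1, Real.sq_sqrt (by positivity)]
    have h2 : C * ((n k : ℝ) * m k ^ (-(1 / 2) : ℝ)) = n k * (C * m k ^ (-(1 / 2) : ℝ)) := by ring
    rw [h2]
    refine lintegral_l2_sq_le (fun t => ?_) fun t ht => ?_
    · simpa only [coeff_ser, Pi.sub_apply] using hmeas k _
    · simp only [coeff_ser, Pi.sub_apply]
      have h3 := hC k (t + 1) (by omega) (by omega)
      push_cast at h3
      rw [← ofReal_integral_eq_lintegral_ofReal h3.1 (ae_of_all _ fun _ => sq_nonneg _)]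
      exact ENNReal.ofReal_le_ofReal h3.2

/-- The order of the initial values. -/
lemma isBigOp_initTotal {x h0 : ι → ℤ → Ω → ℝ}
    (hx : ∀ i ≤ 0, IsBigOp P l (fun k => x k i) fun _ => 1)
    (hh0 : ∀ i ≤ 0, IsBigOp P l (fun k => h0 k i) fun _ => 1) :
    IsBigOp P l (fun k ω => initTotal p q (fun i => x k i ω) (fun i => h0 k i ω)) fun _ => 1 := by
  have h1 : ∀ᶠ _ in l, (0 : ℝ) ≤ 1 := Eventually.of_forall fun _ => zero_le_one
  exact (IsBigOp.sum h1 _ fun i _ => (hx _ (by omega)).abs).add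
    (IsBigOp.sum h1 _ fun i _ => (hh0 _ (by omega)).abs)

end Model

/-- The total size of the sample correlations between `D`, its lags, and the constant. -/
noncomputable def corrTotal (m n : ℕ) (ρ : ℝ) (D : ℝ⟦X⟧) : ℝ :=
  corr n ρ D geom + corr n ρ D (X * D) + ∑ l ∈ range m, |ip n (X ^ l * D) geom| +
    ∑ l ∈ range m, ∑ k ∈ range l, |ip n (X ^ l * D) (X ^ k * D)|

lemma IsInnovation.isBigOp_corrTotal {Ω : Type*} [mΩ : MeasurableSpace Ω] {P : Measure Ω}
    [IsProbabilityMeasure P] {ℱ : Filtration ℕ mΩ} {W : ℕ → Ω → ℝ} {C : ℝ}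
    (h : IsInnovation P ℱ W C) (m : ℕ) {ρ : ℝ} (hρ0 : 0 ≤ ρ) (hρ1 : ρ < 1) :
    IsBigOp P atTop (fun n ω => corrTotal m n ρ (innovSer W ω)) (fun n => √(n : ℝ)) := by
  have h1 : ∀ᶠ n : ℕ in atTop, 0 ≤ √(n : ℝ) := Eventually.of_forall fun _ => Real.sqrt_nonneg _
  refine (((h.isBigOp_corr isPredictable₂_geom hρ0 hρ1).add
    (h.isBigOp_corr h.isPredictable₂ hρ0 hρ1)).add ?_).add ?_
  · exact IsBigOp.sum h1 _ fun l _ => (h.isBigOp_ip_geom l).abs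
  · exact IsBigOp.sum h1 _ fun l _ => IsBigOp.sum h1 _ fun k hk =>
      (h.isBigOp_ip_lags (mem_range.1 hk)).abs

lemma corrTotal_le {m n : ℕ} {ρ : ℝ} {D : ℝ⟦X⟧} {A : ℝ} (h : corrTotal m n ρ D ≤ A) :
    corr n ρ D geom ≤ A ∧ corr n ρ D (X * D) ≤ A ∧ (∀ l < m, |ip n (X ^ l * D) geom| ≤ A) ∧
      ∀ l < m, ∀ k < l, |ip n (X ^ l * D) (X ^ k * D)| ≤ A := by
  rw [corrTotal] at h
  have h1 := apply_nonneg (corr n ρ D) geom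
  have h2 := apply_nonneg (corr n ρ D) (X * D)
  have h3 : 0 ≤ ∑ l ∈ range m, |ip n (X ^ l * D) geom| := sum_nonneg fun _ _ => abs_nonneg _
  have h4 : 0 ≤ ∑ l ∈ range m, ∑ k ∈ range l, |ip n (X ^ l * D) (X ^ k * D)| :=
    sum_nonneg fun _ _ => sum_nonneg fun _ _ => abs_nonneg _
  refine ⟨by linarith, by linarith, fun l hl => ?_, fun l hl k hk => ?_⟩
  · have := single_le_sum (f := fun l => |ip n (X ^ l * D) geom|) (fun _ _ => abs_nonneg _)
      (mem_range.2 hl)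
    beta_reduce at this
    linarith
  · have e1 := single_le_sum (f := fun l => ∑ k ∈ range l, |ip n (X ^ l * D) (X ^ k * D)|)
      (fun _ _ => sum_nonneg fun _ _ => abs_nonneg _) (mem_range.2 hl)
    have e2 := single_le_sum (f := fun k => |ip n (X ^ l * D) (X ^ k * D)|)
      (fun _ _ => abs_nonneg _) (mem_range.2 hk)
    beta_reduce at e1 e2
    linarith

/-- The rate `m^{-1/4} + n^{-1/2}`. -/
noncomputable def rate (m : ℝ) (n : ℕ) : ℝ := m ^ (-(1 / 4) : ℝ) + (n : ℝ) ^ (-(1 / 2) : ℝ)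

lemma rate_nonneg {m : ℝ} (hm : 0 < m) (n : ℕ) : 0 ≤ rate m n := by
  unfold rate; positivity

/-- The summand `n ^ (-1/2)` alone gives `1`; this lets the `O_p(1)` effect of the initial values be
absorbed into `√n` times the rate, whatever the relation of `m` and `n`. -/
lemma one_le_sqrt_mul_rate {m : ℝ} (hm : 0 < m) {n : ℕ} (hn : 0 < n) : 1 ≤ √n * rate m n := by
  have hn' : (0 : ℝ) < n := by exact_mod_cast hn
  have h1 : √(n : ℝ) * (n : ℝ) ^ (-(1 / 2) : ℝ) = 1 := by
    rw [Real.sqrt_eq_rpow, ← Real.rpow_add hn']; norm_num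
  have h2 : 0 ≤ √(n : ℝ) * m ^ (-(1 / 4) : ℝ) := by positivity
  rw [rate, mul_add, h1]
  linarith

lemma tendsto_rate {ι : Type*} {l : Filter ι} {n : ι → ℕ} {m : ι → ℝ} (hn : Tendsto n l atTop)
    (hm : Tendsto m l atTop) : Tendsto (fun k => rate (m k) (n k)) l (𝓝 0) := by
  have h1 := (tendsto_rpow_neg_atTop (show (0 : ℝ) < 1 / 4 by norm_num)).comp hm
  have h2 := (tendsto_rpow_neg_atTop (show (0 : ℝ) < 1 / 2 by norm_num)).comp
    (tendsto_natCast_atTop_atTop.comp hn)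
  simpa [rate] using h1.add h2

/-- The rate of convergence of the estimator, given the orders of the innovations, of the
measurement errors and of the initial values. -/
lemma isBigOp_estimator {Ω : Type*} [mΩ : MeasurableSpace Ω] {P : Measure Ω}
    [IsProbabilityMeasure P] {ℱ : Filtration ℕ mΩ} {p q : ℕ} {ωl ωu γl γu αl αu : ℝ}
    {θ₀ : Param p q} (hθ₀ : θ₀ ∈ paramSpace p q ωl ωu γl γu αl αu)
    (hcop : IsCoprime (1 - lagPoly (Param.ga θ₀)) (lagPoly (Param.al θ₀)))
    (horder : HasFullOrder θ₀)
    {W : ℕ → Ω → ℝ} {C : ℝ} (hW : IsInnovation P ℱ W C) {κ : ℝ} (hκ0 : 0 < κ) (hκ1 : κ ≤ 1)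
    (hκ : Tendsto (fun n : ℕ => P {ω | ∑ t ∈ range n, W t ω ^ 2 < κ * n}) atTop (𝓝 0))
    {ι : Type*} {l : Filter ι} {n : ι → ℕ} {m : ι → ℝ} (hm : ∀ k, 0 < m k)
    (hnlim : Tendsto n l atTop) (hmlim : Tendsto m l atTop) {x h0 : ι → ℤ → Ω → ℝ}
    (herr : IsBigOp P l (fun k ω => l2 (n k)
      (resid θ₀ (fun i => x k i ω) (fun i => h0 k i ω) - innovSer W ω))
      fun k => √(n k : ℝ) * rate (m k) (n k))
    (hinit : IsBigOp P l (fun k ω => initTotal p q (fun i => x k i ω) (fun i => h0 k i ω))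
      fun _ => 1)
    {θhat : ι → Ω → Param p q}
    (hθhat : ∀ k, ∀ᵐ ω ∂P, IsQMLE (paramSpace p q ωl ωu γl γu αl αu) (n k)
      (fun i => x k i ω) (fun i => h0 k i ω) (θhat k ω)) :
    IsBigOp P l (fun k ω => ‖θhat k ω - θ₀‖) fun k => rate (m k) (n k) := by
  intro ε hε
  have hε5 : 0 < ε / 4 := by positivity
  obtain ⟨M₁, hM₁, h1⟩ := (hW.isBigOp_l2.comp_tendsto hnlim) (ε / 4) hε5
  obtain ⟨M₂, hM₂, h2⟩ := herr (ε / 4 / 2) (by positivity)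
  obtain ⟨M₃, hM₃, h3⟩ := hinit (ε / 4 / 2) (by positivity)
  -- The constants come in a forced order: `M₁`, `M₂`, `M₃` give `K`, then `K` and `κ` give `ρ`, `ρ`
  -- gives `M₄`, and `M₄` gives `M` and `a₀`.
  obtain ⟨ρ, hρ0, hρ1, hdet⟩ := exists_estimator_bound hθ₀ hcop horder
    (K := max M₁ (max M₂ M₃)) (le_max_of_le_left hM₁.le) (half_pos hκ0) (by linarith : κ / 2 ≤ 1)
  set K := max M₁ (max M₂ M₃) with hK
  have hK1 : M₁ ≤ K := le_max_left _ _
  have hK2 : M₂ ≤ K := (le_max_left _ _).trans (le_max_right _ _)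
  have hK3 : M₃ ≤ K := (le_max_right _ _).trans (le_max_right _ _)
  obtain ⟨M₄, hM₄, h4⟩ :=
    ((hW.isBigOp_corrTotal (2 * max p q + 1) hρ0.le hρ1).comp_tendsto hnlim) (ε / 4) hε5
  obtain ⟨M, a₀, hM, ha₀, hbound⟩ := hdet M₄ hM₄.le
  have h5 := ((tendsto_measure_lags hκ0 hκ (2 * max p q + 1)).comp hnlim).eventually_le_const
    (ENNReal.ofReal_pos.2 hε5)
  have h6 := (tendsto_rate hnlim hmlim).eventually_le_const ha₀
  refine ⟨M, hM, ?_⟩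
  filter_upwards [h1, h2, h3, h4, h5, h6, hnlim.eventually (eventually_gt_atTop 0)]
    with k h1 h2 h3 h4 h5 h6 hn
  set a := rate (m k) (n k) with ha
  have ha_nonneg : 0 ≤ a := rate_nonneg (hm k) _
  set E₁ := {ω | M₁ * √(n k : ℝ) < |l2 (n k) (innovSer W ω)|} with hE₁
  set E₂ := {ω | M₂ * (√(n k : ℝ) * a) < |l2 (n k)
      (resid θ₀ (fun i => x k i ω) (fun i => h0 k i ω) - innovSer W ω)|} with hE₂
  set E₃ := {ω | M₃ * 1 < |initTotal p q (fun i => x k i ω) (fun i => h0 k i ω)|} with hE₃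
  set E₄ := {ω | M₄ * √(n k : ℝ) < |corrTotal (2 * max p q + 1) (n k) ρ (innovSer W ω)|} with hE₄
  set E₅ := {ω | ∃ l < 2 * max p q + 1,
    l2 (n k) (X ^ l * innovSer W ω) ^ 2 < κ / 2 * n k} with hE₅
  have hsub : ∀ᵐ ω ∂P, ω ∈ {ω | M * a < |‖θhat k ω - θ₀‖|} →
      ω ∈ E₁ ∪ ((E₂ ∪ E₃) ∪ (E₄ ∪ E₅)) := by
    filter_upwards [hθhat k] with ω hω hlt
    by_contra hnot
    simp only [Set.mem_union, not_or] at hnot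
    obtain ⟨n1, ⟨n2, n3⟩, n4, n5⟩ := hnot
    have b1 : |l2 (n k) (innovSer W ω)| ≤ M₁ * √(n k : ℝ) := not_lt.1 n1
    have b2 : |l2 (n k) (resid θ₀ (fun i => x k i ω) (fun i => h0 k i ω) - innovSer W ω)| ≤
      M₂ * (√(n k : ℝ) * a) := not_lt.1 n2
    have b3 : |initTotal p q (fun i => x k i ω) (fun i => h0 k i ω)| ≤ M₃ * 1 := not_lt.1 n3
    have b4 : |corrTotal (2 * max p q + 1) (n k) ρ (innovSer W ω)| ≤ M₄ * √(n k : ℝ) := not_lt.1 n4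
    obtain ⟨c1, c2, c3, c4⟩ := corrTotal_le ((le_abs_self _).trans b4)
    have hs : 0 ≤ √(n k : ℝ) := Real.sqrt_nonneg _
    have hfin := hbound (n k) (fun i => x k i ω) (fun i => h0 k i ω) (innovSer W ω) a (θhat k ω) hn
      h6 (one_le_sqrt_mul_rate (hm k) hn)
      ((le_abs_self _).trans (b1.trans (by gcongr))) c1 c2
      (fun l hl => by
        by_contra! hcon
        exact n5 ⟨l, hl, hcon⟩) c3 c4
      ((le_abs_self _).trans (b2.trans (by rw [mul_assoc]; gcongr)))
      ((le_abs_self _).trans (b3.trans (by linarith))) hω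
    have hlt' : M * a < |‖θhat k ω - θ₀‖| := hlt
    rw [abs_norm] at hlt'
    linarith
  calc P {ω | M * a < |‖θhat k ω - θ₀‖|} ≤ P (E₁ ∪ ((E₂ ∪ E₃) ∪ (E₄ ∪ E₅))) := measure_mono_ae hsub
    _ ≤ P E₁ + ((P E₂ + P E₃) + (P E₄ + P E₅)) := by
        refine (measure_union_le _ _).trans ?_
        gcongr
        refine (measure_union_le _ _).trans ?_
        gcongr <;> exact measure_union_le _ _
    _ ≤ ENNReal.ofReal (ε / 4) + ((ENNReal.ofReal (ε / 4 / 2) + ENNReal.ofReal (ε / 4 / 2)) +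
          (ENNReal.ofReal (ε / 4) + ENNReal.ofReal (ε / 4))) :=
        add_le_add h1 (add_le_add (add_le_add h2 h3) (add_le_add h4 h5))
    _ = ENNReal.ofReal ε := by
        rw [← ENNReal.ofReal_add (by positivity) (by positivity),
          ← ENNReal.ofReal_add (by positivity) (by positivity),
          ← ENNReal.ofReal_add (by positivity) (by positivity),
          ← ENNReal.ofReal_add (by positivity) (by positivity)]
        congr 1; ring

end DRBeta

/-! ### The theorem: verification of the stochastic orders for the model. -/

theorem theorem2
    {Ω : Type*} [mΩ : MeasurableSpace Ω] (P : Measure Ω) [IsProbabilityMeasure P]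
    (ℱ : Filtration ℕ mΩ)
    (p q : ℕ)
    -- (a) the parameter space, and the true parameter in it
    (ωl ωu γl γu αl αu : ℝ)
    (hγl : γl ∈ Set.Ioo (-1 : ℝ) 1) (hγu : γu ∈ Set.Ioo (-1 : ℝ) 1)
    (hαl : αl ∈ Set.Ioo (-1 : ℝ) 1) (hαu : αu ∈ Set.Ioo (-1 : ℝ) 1)
    (θ₀ : DRBeta.Param p q) (hθ₀ : θ₀ ∈ DRBeta.paramSpace p q ωl ωu γl γu αl αu)
    -- (b) roots outside the closed unit disc
    (hroot : ∀ θ ∈ DRBeta.paramSpace p q ωl ωu γl γu αl αu,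
      ∀ x : ℂ, DRBeta.phi θ x = 0 → 1 < ‖x‖)
    -- (c) identification: no common root, and no redundant order
    (hcoprime : ∀ x : ℂ, DRBeta.phi θ₀ x = 0 → DRBeta.upsilon θ₀ x ≠ 0)
    (horder : ∀ hq : 0 < q,
      DRBeta.Param.ga θ₀ ⟨q - 1, by omega⟩ ≠ 0 ∨
        DRBeta.Param.al θ₀ ⟨max p q - 1, by omega⟩ ≠ 0)
    -- the integrated betas follow the DR Beta model: `Iβ_i = h_i(θ₀) + D_i`, with `Iβ` adapted,
    -- initial values known at time 0, and `D` a martingale difference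
    (Iβ h0 : ℤ → Ω → ℝ)
    (hIβ : ∀ i : ℤ, Measurable[ℱ i.toNat] (Iβ i))
    (hh0 : ∀ i : ℤ, Measurable[ℱ 0] (h0 i))
    (D : ℤ → Ω → ℝ) (hD : D = DRBeta.innovation θ₀ Iβ h0)
    (hDL2 : ∀ i : ℕ, MemLp (D ((i : ℤ) + 1)) 2 P)
    (hDmart : ∀ i : ℕ, P[D ((i : ℤ) + 1) | ℱ i] =ᵐ[P] 0)
    -- (d) stationary, ergodic, nondegenerate innovations with bounded conditional variance
    (hDerg : DRBeta.StationaryErgodic P D)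
    (hDnondeg : ¬ D 1 =ᵐ[P] 0)
    (hDvar : ∃ C : ℝ, ∀ i : ℕ,
      P[fun ω => D ((i : ℤ) + 1) ω ^ 2 | ℱ i] ≤ᵐ[P] fun _ => C)
    -- the asymptotic regime `m, n → ∞`, with no relation between `m` and `n`
    {ι : Type*} (l : Filter ι) (n : ι → ℕ) (m : ι → ℝ) (hm : ∀ k, 0 < m k)
    (hnlim : Tendsto n l atTop) (hmlim : Tendsto m l atTop)
    -- the estimators `RIB_i`, `1 ≤ i ≤ n`, and the initial values of the recursion for `ĥ`
    (RIB h0hat : ι → ℤ → Ω → ℝ)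
    (hRIBmeas : ∀ k i, AEMeasurable (RIB k i) P)
    (hinit : ∀ i : ℤ, i ≤ 0 → DRBeta.IsBigOp P l (fun k => RIB k i) (fun _ => 1) ∧
      DRBeta.IsBigOp P l (fun k => h0hat k i) (fun _ => 1))
    -- (f) mean square error of the estimators
    (hRIB : ∃ C : ℝ, ∀ k, ∀ i : ℕ, 1 ≤ i → i ≤ n k →
      Integrable (fun ω => (RIB k i ω - Iβ i ω) ^ 2) P ∧
        ∫ ω, (RIB k i ω - Iβ i ω) ^ 2 ∂P ≤ C * m k ^ (-(1 / 2) : ℝ))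
    -- the quasi-maximum likelihood estimator
    (θhat : ι → Ω → DRBeta.Param p q)
    (hθhat : ∀ k, ∀ᵐ ω ∂P, DRBeta.IsQMLE (DRBeta.paramSpace p q ωl ωu γl γu αl αu) (n k)
      (fun i => RIB k i ω) (fun i => h0hat k i ω) (θhat k ω)) :
    DRBeta.IsBigOp P l (fun k ω => ‖θhat k ω - θ₀‖)
      (fun k => m k ^ (-(1 / 4) : ℝ) + (n k : ℝ) ^ (-(1 / 2) : ℝ)) := by

  have hadapt : ∀ t : ℕ, Measurable[ℱ (t + 1)] (D ((t : ℤ) + 1)) := fun t => by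
    have h1 := DRBeta.measurable_hSeq (ℱ := fun i : ℤ => ℱ i.toNat)
      (fun i j hij => ℱ.mono (Int.toNat_le_toNat hij)) θ₀ (x := Iβ) (h0 := h0) hIβ
      (fun i _ => (hh0 i).mono (ℱ.mono (Nat.zero_le _)) le_rfl) ((t : ℤ) + 1)
    rw [hD]
    exact (hIβ ((t : ℤ) + 1)).sub h1
  have hfull : DRBeta.HasFullOrder θ₀ := fun hq => (horder hq).imp
    (fun h => ⟨_, Nat.sub_add_cancel hq, h⟩)
    (fun h => ⟨_, Nat.sub_add_cancel (lt_max_of_lt_right hq), h⟩)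
  obtain ⟨C, hC⟩ := hDvar
  have hW : DRBeta.IsInnovation P ℱ (fun t => D ((t : ℤ) + 1)) (max C 0) :=
    { adapted := fun t => (hadapt t).stronglyMeasurable
      memLp := hDL2
      condExp := hDmart
      nonneg := le_max_right _ _
      condVar := fun t => (hC t).trans (Eventually.of_forall fun _ => le_max_left _ _) }
  obtain ⟨κ, hκ0, hκ1, hκ⟩ := DRBeta.exists_sum_sq_ge
    (fun t => (hW.measurable t).aemeasurable) hDerg (by simpa using hDnondeg)
  obtain ⟨K, hK0, hK⟩ := DRBeta.exists_l2_resid_sub_le θ₀ hθ₀.2.2.2.1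
  have hIβm : ∀ i, Measurable (Iβ i) := fun i => (hIβ i).mono (ℱ.le _) le_rfl
  have hh0m : ∀ i, Measurable (h0 i) := fun i => (hh0 i).mono (ℱ.le _) le_rfl
  have hneg : ∀ (x : ι → ℤ → Ω → ℝ) (y : ℤ → Ω → ℝ), (∀ i, Measurable (y i)) → ∀ i : ℤ,
      DRBeta.IsBigOp P l (fun k => x k i) (fun _ => 1) →
      DRBeta.IsBigOp P l (fun k ω => x k i ω - y i ω) (fun _ => 1) := fun x y hy i hx => by
    have h1 := hx.add (DRBeta.isBigOp_const (P := P) (l := l) (hy i).neg)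
    simpa only [sub_eq_add_neg, Pi.neg_apply] using h1
  have hscale : ∀ᶠ k in l, (1 : ℝ) ≤ 1 * (√(n k : ℝ) * DRBeta.rate (m k) (n k)) := by
    filter_upwards [hnlim.eventually (eventually_gt_atTop 0)] with k hk
    rw [one_mul]
    exact DRBeta.one_le_sqrt_mul_rate (hm k) hk
  have hrate0 : ∀ᶠ k in l, 0 ≤ √(n k : ℝ) * DRBeta.rate (m k) (n k) :=
    Eventually.of_forall fun k => mul_nonneg (Real.sqrt_nonneg _) (DRBeta.rate_nonneg (hm k) _)
  have herr1 := (DRBeta.isBigOp_l2_error (P := P) hm hnlim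
    (fun k i => (hRIBmeas k i).sub (hIβm i).aemeasurable) hRIB).mono_scale
    (b := fun k => √(n k : ℝ) * DRBeta.rate (m k) (n k)) one_pos (Eventually.of_forall fun k => by
      rw [one_mul, DRBeta.rate]
      gcongr
      exact le_add_of_nonneg_right (by positivity))
  have herr2 := (DRBeta.isBigOp_initTotal (p := p) (q := q)
    (x := fun k i ω => RIB k i ω - Iβ i ω) (h0 := fun k i ω => h0hat k i ω - h0 i ω)
    (fun i hi => hneg RIB Iβ hIβm i (hinit i hi).1)
    (fun i hi => hneg h0hat h0 hh0m i (hinit i hi).2)).mono_scale one_pos hscale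
  -- The series of `D` is the residual series at `θ₀` for the true data. The difference from the
  -- observed residuals is thus governed by `RIB - Iβ` and by the differences of initial values,
  -- each of order `√n` times the rate.
  have herr := (herr1.add herr2).const_mul hrate0 K
  refine DRBeta.isBigOp_estimator hθ₀ (DRBeta.isCoprime_of_no_common_root θ₀ hcoprime)
    hfull hW hκ0 hκ1 hκ hm hnlim hmlim (herr.mono (Eventually.of_forall fun k => ae_of_all _ fun ω => ?_))
    (DRBeta.isBigOp_initTotal (fun i hi => (hinit i hi).1) fun i hi => (hinit i hi).2) hθhat
  rw [hD, DRBeta.innovSer_eq_resid, abs_of_nonneg (apply_nonneg _ _)]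
  exact (hK _ _ _ _ _).trans (le_abs_self _)
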